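/- Theorem 3. Let $V(\lambda)=\sum_{j=1}^{p}g_{2j}\lambda^{j}$ ($\lambda=z^2$) be a real polynomial, $V_\lambda=dV/d\lambda$, let $r_c>0$, $T_c\in\mathbb R$, $m\ge 1$, and let $\gamma$ be a positively oriented circle $|\lambda|=\rho$ with $\rho>4r_c$. All square roots $\sqrt{(\lambda-\sigma)(\lambda-\tau)}$ below denote the branch behaving like $\lambda$ at infinity. Put $w_c=\sqrt{\lambda(\lambda-4r_c)}$ and $$F(\sigma,\tau)=\oint_\gamma\frac{d\lambda}{2\pi i}V_\lambda(\lambda)\sqrt{(\lambda-\sigma)(\lambda-\tau)}+\frac{T_c}{2}(\sigma+\tau).$$ Assume that $(\sigma,\tau)=(0,4r_c)$ is a singular solution with a merging of two cuts of order $m$, i.e. at this point $\partial_\sigma^kF=0$ for $k=1,\dots,m$, $\partial_\sigma^{m+1}F\ne0$, $\partial_\tau F=0$ and $\partial_\tau^2F\neq0$. Let $\mathfrak a(\bar\epsilon,x)=r_c+\sum_{k\ge1}\mathfrak a_k(x)\bar\epsilon^k$ and $\mathfrak b(\bar\epsilon,x)=r_c+\sum_{k\ge1}\mathfrak b_k(x)\bar\epsilon^k$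 be formal power series whose coefficients are smooth functions on an open set $I\subseteq\mathbb R$. Let $\mathrm V=\sum_{k\ge0}\mathrm V^{[k]}(\lambda;x)\bar\epsilon^k$ and $\mathrm W=\sum_{k\ge0}\mathrm W^{[k]}(\lambda;x)\bar\epsilon^k$ be the associated generating functions: their coefficients are smooth in $x\in I$ and holomorphic in $|\lambda|>4r_c$, $\mathrm V,\mathrm W\to1$ coefficientwise as $\lambda\to\infty$, and $$\mathfrak a\,(\mathrm V+\mathrm W_{[\overline{-1}]})(\mathrm V+\mathrm W_{[\overline 1]})=\lambda(\mathrm V^2-1),\qquad \mathfrak b\,(\mathrm W+\mathrm V_{[\overline{-1}]})(\mathrm W+\mathrm V_{[\overline 1]})=\lambda(\mathrm W^2-1),$$ where $f_{[\bar j]}(\bar\epsilon,x)=f(\bar\epsilon,x+j\bar\epsilon)$ is understood through its formal Taylor expansion. Suppose that $(\mathfrak a,\mathfrak b)$ solves the scaled string equations $$\oint_\gamma\frac{d\lambda}{2\pi i}V_\lambda\mathrm V=T_c+\bar\epsilon^{2m}x,\qquad \oint_\gamma\frac{d\lambda}{2\pi i}V_\lambda\mathrm W=T_c+\bar\epsilon^{2m}x$$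 in every order of $\bar\epsilon$, and that this solution is symmetric, $\mathfrak b(\bar\epsilon,x)=\mathfrak a(-\bar\epsilon,x)$. Then there is exactly one sequence of pairs $(R_k,S_k)_{k\ge0}$ of differential polynomials in $u$ with real coefficients, each $S_k$ having no constant term, such that $$R_0=-\frac{u}{2r_c},\quad S_0=-\frac{u^2}{8r_c^2},\qquad R_{k+1}=-r_c\,\partial_x^2R_k+2u\,S_k,\qquad 2r_c\,\partial_xS_k=u\,\partial_xR_k\qquad(k\ge0),$$ and $u=\mathfrak a_1$ satisfies on $I$ the $m$-th Painlevé II hierarchy equation $$2r_c\,\varphi_m(r_c)\,R_m(u)+x\,u=0,\qquad \varphi_m(r_c)=\oint_\gamma\frac{d\lambda}{2\pi i}\frac{(\lambda-4r_c)^{m+1}V_\lambda}{w_c^{2m+1}}.$$ -/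

import Mathlib

open scoped ContDiff Topology

noncomputable section

/-! ### Contour integrals over the large circle `|l| = R` -/

/-- The normalized contour integral `(2πi)⁻¹ ∮ f(l) dl` over the positively oriented circle
`|l| = R`. -/
def contourInt (R : ℝ) (f : ℂ → ℂ) : ℂ :=
  (2 * (Real.pi : ℂ) * Complex.I)⁻¹ * ∮ l in C(0, R), f l

/-- The derivative `V_l` of the polynomial `P = V(l)` (a polynomial in `l = z²`, so that `V(z²)` is
the even potential), at a complex point. -/
def dPot (P : Polynomial ℝ) (l : ℂ) : ℂ := Polynomial.aeval l (Polynomial.derivative P)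

/-- The branch of `√((l - σ)(l - τ))` on `|l| > max |σ| |τ|` which behaves like `l` at infinity
(the square roots on the right are principal; their arguments have positive real part). -/
def sqrtBranch (σ τ : ℝ) (l : ℂ) : ℂ :=
  l * (1 - (σ : ℂ) / l) ^ (1 / 2 : ℂ) * (1 - (τ : ℂ) / l) ^ (1 / 2 : ℂ)

/-- `w_c = √(l (l - 4 r_c))`. -/
def wCrit (r : ℝ) (l : ℂ) : ℂ := sqrtBranch 0 (4 * r) l

/-- `F(σ, τ) = (2πi)⁻¹ ∮ V_l √((l - σ)(l - τ)) dl + T (σ + τ) / 2`. -/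
def hodographF (P : Polynomial ℝ) (R T σ τ : ℝ) : ℂ :=
  contourInt R (fun l => dPot P l * sqrtBranch σ τ l) + (T : ℂ) / 2 * ((σ : ℂ) + (τ : ℂ))

/-- `(0, τ)` is, at temperature `T`, a singular solution with a merging of two cuts of order `m`:
the partial derivatives of `F` at `(0, τ)` satisfy `∂_σ^k F = 0` for `1 ≤ k ≤ m`,
`∂_σ^(m+1) F ≠ 0`, `∂_τ F = 0`, `∂_τ² F ≠ 0`. -/
structure IsMergingOfOrder (P : Polynomial ℝ) (R T τ : ℝ) (m : ℕ) : Prop where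
  one_le : 1 ≤ m
  pos : 0 < τ
  sigma_zero : ∀ k : ℕ, 1 ≤ k → k ≤ m →
    iteratedDeriv k (fun σ : ℝ => hodographF P R T σ τ) 0 = 0
  sigma_ne : iteratedDeriv (m + 1) (fun σ : ℝ => hodographF P R T σ τ) 0 ≠ 0
  tau_zero : deriv (fun t : ℝ => hodographF P R T 0 t) τ = 0
  tau_ne : iteratedDeriv 2 (fun t : ℝ => hodographF P R T 0 t) τ ≠ 0

/-- `φ_m(r_c) = (2πi)⁻¹ ∮ (l - 4 r_c)^(m+1) V_l / w_c^(2m+1) dl`. -/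
def phiCoeff (P : Polynomial ℝ) (R r : ℝ) (m : ℕ) : ℂ :=
  contourInt R (fun l =>
    (l - 4 * (r : ℂ)) ^ (m + 1) * dPot P l / wCrit r l ^ (2 * m + 1))

/-! ### Formal power series in `ε` with coefficients that are functions of `x`

A family `f : ℕ → ℝ → ℂ` stands for the formal series `∑ k, f k x * ε ^ k`. -/

/-- The formal power series in `ε` at the point `x`. -/
def epsSeries (f : ℕ → ℝ → ℂ) (x : ℝ) : PowerSeries ℂ := PowerSeries.mk (fun k => f k x)

/-- The coefficients of `f(ε, x + s ε)`, expanded by Taylor's formula in powers of `ε`. -/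
def epsShift (s : ℤ) (f : ℕ → ℝ → ℂ) : ℕ → ℝ → ℂ := fun k x =>
  ∑ n ∈ Finset.range (k + 1),
    (s : ℂ) ^ n / (n.factorial : ℂ) * iteratedDeriv n (f (k - n)) x

/-- `V(l, ε; x) = ∑ k, V k l x * ε ^ k` and `W` (likewise) are the generating functions that
belong to the series `a` and `b`: the coefficients are smooth in `x ∈ I` and holomorphic in
`|l| > 4 r`, the series tend to `1` as `l → ∞`, and they satisfy the scaled quadratic system. -/
structure IsGeneratingPair (r : ℝ) (I : Set ℝ) (a b : ℕ → ℝ → ℂ) (V W : ℕ → ℂ → ℝ → ℂ) :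
    Prop where
  smooth_V : ∀ k : ℕ, ∀ l : ℂ, 4 * r < ‖l‖ → ContDiffOn ℝ ∞ (V k l) I
  smooth_W : ∀ k : ℕ, ∀ l : ℂ, 4 * r < ‖l‖ → ContDiffOn ℝ ∞ (W k l) I
  holo_V : ∀ k : ℕ, ∀ x ∈ I, DifferentiableOn ℂ (fun l => V k l x) {l : ℂ | 4 * r < ‖l‖}
  holo_W : ∀ k : ℕ, ∀ x ∈ I, DifferentiableOn ℂ (fun l => W k l x) {l : ℂ | 4 * r < ‖l‖}
  lim_V : ∀ k : ℕ, ∀ x ∈ I, Filter.Tendsto (fun l => V k l x) (Bornology.cobounded ℂ)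
    (𝓝 (if k = 0 then 1 else 0))
  lim_W : ∀ k : ℕ, ∀ x ∈ I, Filter.Tendsto (fun l => W k l x) (Bornology.cobounded ℂ)
    (𝓝 (if k = 0 then 1 else 0))
  quad_V : ∀ l : ℂ, 4 * r < ‖l‖ → ∀ x ∈ I,
    epsSeries a x *
      (epsSeries (fun k => V k l) x + epsSeries (epsShift (-1) (fun k => W k l)) x) *
      (epsSeries (fun k => V k l) x + epsSeries (epsShift 1 (fun k => W k l)) x)
    = PowerSeries.C l * (epsSeries (fun k => V k l) x ^ 2 - 1)
  quad_W : ∀ l : ℂ, 4 * r < ‖l‖ → ∀ x ∈ I,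
    epsSeries b x *
      (epsSeries (fun k => W k l) x + epsSeries (epsShift (-1) (fun k => V k l)) x) *
      (epsSeries (fun k => W k l) x + epsSeries (epsShift 1 (fun k => V k l)) x)
    = PowerSeries.C l * (epsSeries (fun k => W k l) x ^ 2 - 1)

/-- The coefficient of `ε ^ k` in `T_c + ε ^ (2m) x` (for `m ≥ 1`). -/
def stringRHS (T : ℝ) (m k : ℕ) (x : ℝ) : ℂ :=
  (if k = 0 then (T : ℂ) else 0) + (if k = 2 * m then (x : ℂ) else 0)

/-- The formal series `a = r + ∑_{k ≥ 1} a k x ε^k`, `b = r + ∑_{k ≥ 1} b k x ε^k`, with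
coefficients smooth on `I`, solve the scaled system of string equations: their
generating functions `V`, `W` satisfy
`(2πi)⁻¹ ∮ V_l V dl = (2πi)⁻¹ ∮ V_l W dl = T + ε^(2m) x` in each order of `ε`, on `I`. -/
structure IsFormalStringSolution (P : Polynomial ℝ) (R T r : ℝ) (m : ℕ) (I : Set ℝ)
    (a b : ℕ → ℝ → ℂ) : Prop where
  smooth_a : ∀ k : ℕ, ContDiffOn ℝ ∞ (a k) I
  smooth_b : ∀ k : ℕ, ContDiffOn ℝ ∞ (b k) I
  zero_a : ∀ x ∈ I, a 0 x = (r : ℂ)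
  zero_b : ∀ x ∈ I, b 0 x = (r : ℂ)
  string_eqs : ∃ V W : ℕ → ℂ → ℝ → ℂ, IsGeneratingPair r I a b V W ∧
    ∀ k : ℕ, ∀ x ∈ I,
      contourInt R (fun l => dPot P l * V k l x) = stringRHS T m k x ∧
      contourInt R (fun l => dPot P l * W k l x) = stringRHS T m k x

/-- The symmetry `b(ε, x) = a(-ε, x)`. -/
def IsSymmetricPair (I : Set ℝ) (a b : ℕ → ℝ → ℂ) : Prop :=
  ∀ k : ℕ, ∀ x ∈ I, b k x = (-1) ^ k * a k x

/-! ### Differential polynomials and the Painlevé II hierarchy -/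

/-- Differential polynomials in one function `u`; the variable `X n` stands for `∂ⁿ u`. -/
abbrev DiffPoly : Type := MvPolynomial ℕ ℝ

/-- The total derivative `∂_x`, the derivation with `X n ↦ X (n + 1)`. -/
def totalD : Derivation ℝ DiffPoly DiffPoly :=
  MvPolynomial.mkDerivation ℝ (fun n => (MvPolynomial.X (n + 1) : DiffPoly))

/-- The value at `x` of the differential polynomial `Q(u)`. -/
def evalDiffPoly (Q : DiffPoly) (u : ℝ → ℂ) (x : ℝ) : ℂ :=
  MvPolynomial.aeval (fun n => iteratedDeriv n u x) Q

/-- The recursion for the differential polynomials `R_m(u)` and `S_m(u)`. The constant of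
integration in `S_m` is fixed by the absence of a constant term. -/
structure IsPainleveIIHierarchy (r : ℝ) (Rp Sp : ℕ → DiffPoly) : Prop where
  R_zero : Rp 0 = MvPolynomial.C (-(1 / (2 * r))) * MvPolynomial.X 0
  S_zero : Sp 0 = MvPolynomial.C (-(1 / (8 * r ^ 2))) * MvPolynomial.X 0 ^ 2
  R_succ : ∀ m : ℕ, Rp (m + 1) =
    -(MvPolynomial.C r * totalD (totalD (Rp m))) + 2 * MvPolynomial.X 0 * Sp m
  S_deriv : ∀ m : ℕ, MvPolynomial.C (2 * r) * totalD (Sp m) = MvPolynomial.X 0 * totalD (Rp m)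
  S_const : ∀ m : ℕ, MvPolynomial.constantCoeff (Sp m) = 0

end

/-!
At order `0` in `ε` the quadratic system has the only admissible solution `V = W = l / w_c`
(`leading_coefficient`), and it determines the higher orders. By uniqueness the symmetry
`b(ε) = a(-ε)` passes to the generating functions, `W(ε) = V(-ε)`
(`eq_signTwist_of_quadratic_system`). So `V = (l / w_c) (1 + ε γ / l)`, where the series `γ` solves
a single quadratic equation `quadDefect = 0` over the ring of smooth functions on `I`.

This equation is solved order by order. If the lower coefficients are polynomials in `1 / l`, then
`γ k` for even `k` is such a polynomial as well, of degree at most `k / 2`, and for odd `k` it is a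
polynomial plus a multiple `c` of `l / (l - 4 r)`. The string equations control `c`.
Differentiation of `F` under the integral sign shows that at a merging of order `m` the moments of
`l⁻ʲ` with weight `V_l l / w_c` vanish for `1 ≤ j ≤ m`, that the one of `l^(-m-1)` is
`-φ_m / (4 r)`, and that the one of `1 / (l - 4 r)`, which is called `ψ` here, is nonzero because
of `∂_τ² F ≠ 0`. Hence `c = 0` below the order `2 m - 1`, where `c ψ = x`. At order `2 m` the
coefficient `γ (2 m)` is a polynomial of degree at most `m`, with top coefficient `o_m`, plus
`2 u c / (l - 4 r)`, and the string equation for `ε ^ (2 m + 1)` reads `o_m μ + u x / (2 r) = 0`,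
where `μ = -φ_m / (4 r)` (`hierarchyCoeff_equation`).

It remains to identify `o_m`. The top coefficients `o_n` and `e_{n + 1}` of the polynomial parts of
`γ (2 n)` and `γ (2 n + 1)` are the leading symbols as `ε → 0` with `z = ε² / l` fixed. In this
limit the quadratic equation becomes, up to the critical order, two relations between
`E = 1 + z ∑ e_{n + 1} zⁿ` and `O = ∑ o_n zⁿ`, `evenQuad = 0` and `oddQuad = 0`, which determine
`E` and `O` (`quad_unique`). The Painlevé II hierarchy provides a solution: with
`R_n = -o_n / (4 r)`, `S_n = -e_{n + 1} / (4 r)` the recursion says `O = 2 u E - r z O''` and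
`2 r E' = u z O'`, and the integral `4 r E² - r z² O'² - z O² = 4 r` of these equations, solved for
the top coefficient, defines the `e_n` without any integration. This also gives the existence of
the hierarchy (`hierarchyCoeff`). Its uniqueness holds because a differential polynomial with
vanishing total derivative is constant (`eq_C_of_totalD_eq_zero`).
-/

noncomputable section

/-! ### The total derivative of differential polynomials -/

theorem totalD_X (n : ℕ) : totalD (MvPolynomial.X n) = MvPolynomial.X (n + 1) :=
  MvPolynomial.mkDerivation_X _ _ _

theorem constantCoeff_totalD (p : DiffPoly) : MvPolynomial.constantCoeff (totalD p) = 0 := by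
  induction p using MvPolynomial.induction_on with
  | C a => simp [MvPolynomial.derivation_C]
  | add p q hp hq => simp [hp, hq]
  | mul_X p n hp => simp [Derivation.leibniz, totalD_X, hp]

/-- The commutation relation `[∂/∂u⁽ⁿ⁺¹⁾, ∂_x] = ∂/∂u⁽ⁿ⁾`. -/
theorem pderiv_succ_totalD (n : ℕ) (p : DiffPoly) :
    MvPolynomial.pderiv (n + 1) (totalD p) =
      totalD (MvPolynomial.pderiv (n + 1) p) + MvPolynomial.pderiv n p := by
  have h : ⁅MvPolynomial.pderiv (R := ℝ) (n + 1), totalD⁆ = MvPolynomial.pderiv n := by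
    apply MvPolynomial.derivation_ext
    intro i
    rw [Derivation.commutator_apply, totalD_X, MvPolynomial.pderiv_X, MvPolynomial.pderiv_X,
      MvPolynomial.pderiv_X]
    rcases eq_or_ne i n with rfl | hi
    · simp
    · rcases eq_or_ne i (n + 1) with rfl | hi'
      · simp
      · have : i + 1 ≠ n + 1 := fun h => hi (by omega)
        simp [hi, hi']
  have := congrArg (fun d => d p) h
  simp only [Derivation.commutator_apply] at this
  rw [← this]; ring

/-- A differential polynomial with vanishing total derivative is a constant. -/
theorem eq_C_of_totalD_eq_zero {p : DiffPoly} (hp : totalD p = 0) :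
    p = MvPolynomial.C (MvPolynomial.constantCoeff p) := by
  have key : ∀ n, MvPolynomial.pderiv n p = 0 := by
    -- The partial derivatives vanish for large `n`; the commutator carries this downwards.
    have hbig : ∀ n, p.vars.sup id < n → MvPolynomial.pderiv n p = 0 := fun n hn =>
      MvPolynomial.pderiv_eq_zero_of_notMem_vars fun hmem =>
        absurd (Finset.le_sup (f := id) hmem) (by simpa using hn)
    have hdown : ∀ d n, p.vars.sup id < n + d → MvPolynomial.pderiv n p = 0 := by
      intro d
      induction d with
      | zero => intro n hn; exact hbig n hn
      | succ d ih =>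
        intro n hn
        have h1 := ih (n + 1) (by omega)
        have h2 := pderiv_succ_totalD n p
        rw [hp, h1] at h2
        simpa using h2.symm
    intro n
    exact hdown (p.vars.sup id + 1) n (by omega)
  ext s
  rw [MvPolynomial.coeff_C]
  split_ifs with hs
  · subst hs; rfl
  · obtain ⟨i, hi⟩ : ∃ i, s i ≠ 0 := by
      by_contra hcon
      push Not at hcon
      exact hs (Finsupp.ext fun i => (hcon i).symm)
    have h := MvPolynomial.coeff_pderiv (i := i) p (s - Finsupp.single i 1)
    have hs' : s - Finsupp.single i 1 + Finsupp.single i 1 = s := by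
      ext j
      rcases eq_or_ne j i with rfl | hj
      · simp; omega
      · simp [hj.symm]
    rw [key i, hs', MvPolynomial.coeff_zero] at h
    have hne : ((((s - Finsupp.single i 1 : ℕ →₀ ℕ) i : ℕ) : ℝ)) + 1 ≠ 0 := by positivity
    exact (mul_eq_zero.mp h.symm).resolve_right hne

theorem eq_of_totalD_eq {p q : DiffPoly} (hD : totalD p = totalD q)
    (h0 : MvPolynomial.constantCoeff p = MvPolynomial.constantCoeff q) : p = q := by
  have h := eq_C_of_totalD_eq_zero (p := p - q) (by rw [map_sub, hD, sub_self])
  rw [map_sub, h0, sub_self, map_zero] at h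
  exact sub_eq_zero.mp h

/-- The recursion determines the hierarchy. -/
theorem IsPainleveIIHierarchy.unique {r : ℝ} (hr : r ≠ 0) {R S R' S' : ℕ → DiffPoly}
    (h : IsPainleveIIHierarchy r R S) (h' : IsPainleveIIHierarchy r R' S') :
    R = R' ∧ S = S' := by
  have hS : ∀ n, R n = R' n → S n = S' n := by
    intro n hn
    apply eq_of_totalD_eq
    · have h1 := h.S_deriv n
      rw [hn, ← h'.S_deriv n] at h1
      exact mul_left_cancel₀ (by simp [hr]) h1
    · rw [h.S_const, h'.S_const]
  have hR : ∀ n, R n = R' n := by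
    intro n
    induction n with
    | zero => rw [h.R_zero, h'.R_zero]
    | succ n ih => rw [h.R_succ, h'.R_succ, ih, hS n ih]
  exact ⟨funext hR, funext fun n => hS n (hR n)⟩

/-! ### Quadratic relations between generating series -/

section Quadratic

variable {k A : Type*} [CommRing k] [CommRing A] [Algebra k A]

/-- The coefficientwise extension of a derivation to power series. -/
def coeffD (D : Derivation k A A) : Derivation k (PowerSeries A) (PowerSeries A) :=
  Derivation.mk'
    { toFun := fun f => PowerSeries.mk fun n => D (PowerSeries.coeff n f)
      map_add' := fun f g => by ext n; simp
      map_smul' := fun c f => by ext n; simp }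
    (fun f g => by
      ext n
      simp only [LinearMap.coe_mk, AddHom.coe_mk, PowerSeries.coeff_mk, smul_eq_mul, map_add,
        PowerSeries.coeff_mul, map_sum, Derivation.leibniz]
      rw [Finset.sum_add_distrib]
      congr 1
      rw [← Finset.Nat.sum_antidiagonal_swap]
      rfl)

theorem coeff_coeffD (D : Derivation k A A) (f : PowerSeries A) (n : ℕ) :
    PowerSeries.coeff n (coeffD D f) = D (PowerSeries.coeff n f) := by
  simp [coeffD]

theorem coeffD_X (D : Derivation k A A) : coeffD D (PowerSeries.X : PowerSeries A) = 0 := by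
  ext n
  rw [coeff_coeffD, PowerSeries.coeff_X]
  split_ifs <;> simp

theorem coeffD_C (D : Derivation k A A) (a : A) :
    coeffD D (PowerSeries.C a) = PowerSeries.C (D a) := by
  ext n
  rw [coeff_coeffD, PowerSeries.coeff_C, PowerSeries.coeff_C]
  split_ifs <;> simp

theorem coeffD_X_pow_mul (D : Derivation k A A) (n : ℕ) (f : PowerSeries A) :
    coeffD D (PowerSeries.X ^ n * f) = PowerSeries.X ^ n * coeffD D f := by
  rw [Derivation.leibniz, Derivation.leibniz_pow, coeffD_X]
  simp

/-- The defect of the relation `4 r E² - r z² O'² = 4 r + z O²` for series in `z`. It is the term of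
order `0` of the quadratic equation at `ε → 0` with `z = ε² / l` fixed. -/
def evenQuad (D : Derivation k A A) (r : A) (E O : PowerSeries A) : PowerSeries A :=
  PowerSeries.C r * (4 * E ^ 2 - PowerSeries.X ^ 2 * coeffD D O ^ 2) -
    (4 * PowerSeries.C r + PowerSeries.X * O ^ 2)

/-- The defect of the relation `u (4 E² - z² O'²) + 2 r z (O' E' - E O'') = 2 O E` for series in
`z`. It is the term of order `1` of the quadratic equation at `ε → 0` with `z = ε² / l` fixed. -/
def oddQuad (D : Derivation k A A) (r u : A) (E O : PowerSeries A) : PowerSeries A :=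
  PowerSeries.C u * (4 * E ^ 2 - PowerSeries.X ^ 2 * coeffD D O ^ 2) +
    2 * PowerSeries.C r * PowerSeries.X *
      (coeffD D O * coeffD D E - E * coeffD D (coeffD D O)) - 2 * O * E

theorem map_evenQuad {k' B : Type*} [CommRing k'] [CommRing B] [Algebra k' B]
    (D : Derivation k A A) (D' : Derivation k' B B) (φ : A →+* B) (hφ : ∀ a, φ (D a) = D' (φ a))
    (r : A) (E O : PowerSeries A) :
    PowerSeries.map φ (evenQuad D r E O) =
      evenQuad D' (φ r) (PowerSeries.map φ E) (PowerSeries.map φ O) := by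
  have hD : ∀ f, PowerSeries.map φ (coeffD D f) = coeffD D' (PowerSeries.map φ f) := by
    intro f; ext n; simp [coeff_coeffD, hφ]
  simp [evenQuad, hD, map_ofNat]

theorem map_oddQuad {k' B : Type*} [CommRing k'] [CommRing B] [Algebra k' B]
    (D : Derivation k A A) (D' : Derivation k' B B) (φ : A →+* B) (hφ : ∀ a, φ (D a) = D' (φ a))
    (r u : A) (E O : PowerSeries A) :
    PowerSeries.map φ (oddQuad D r u E O) =
      oddQuad D' (φ r) (φ u) (PowerSeries.map φ E) (PowerSeries.map φ O) := by
  have hD : ∀ f, PowerSeries.map φ (coeffD D f) = coeffD D' (PowerSeries.map φ f) := by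
    intro f; ext n; simp [coeff_coeffD, hφ]
  simp [oddQuad, hD, map_ofNat]

theorem exists_eq_add_X_pow_mul {f g : PowerSeries A} {n : ℕ}
    (h : ∀ i < n, PowerSeries.coeff i f = PowerSeries.coeff i g) :
    ∃ d, f = g + PowerSeries.X ^ n * d := by
  obtain ⟨d, hd⟩ := PowerSeries.X_pow_dvd_iff.mpr
    (fun i hi => by rw [map_sub, h i hi, sub_self] :
      ∀ i < n, PowerSeries.coeff i (f - g) = 0)
  exact ⟨d, by rw [← hd]; ring⟩

/-- Up to any given order the two quadratic relations and `E = 1 + O(z)` determine `E` and `O`. -/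
theorem quad_unique (D : Derivation k A A) {r u : A} (h8 : IsUnit (8 * r)) (h2 : IsUnit (2 : A))
    {E O E' O' : PowerSeries A} {m : ℕ}
    (hE : PowerSeries.constantCoeff E = 1) (hE' : PowerSeries.constantCoeff E' = 1)
    (he : ∀ n ≤ m, PowerSeries.coeff n (evenQuad D r E O) =
      PowerSeries.coeff n (evenQuad D r E' O'))
    (ho : ∀ n ≤ m, PowerSeries.coeff n (oddQuad D r u E O) =
      PowerSeries.coeff n (oddQuad D r u E' O')) :
    ∀ n ≤ m, PowerSeries.coeff n E = PowerSeries.coeff n E' ∧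
      PowerSeries.coeff n O = PowerSeries.coeff n O' := by
  intro n
  induction n using Nat.strong_induction_on with
  | _ n ih =>
  intro hn
  have hEn : PowerSeries.coeff n E = PowerSeries.coeff n E' := by
    obtain ⟨d, hd⟩ := exists_eq_add_X_pow_mul fun i hi => (ih i hi (by omega)).1
    obtain ⟨f, hf⟩ := exists_eq_add_X_pow_mul fun i hi => (ih i hi (by omega)).2
    have hq : evenQuad D r E O - evenQuad D r E' O' = PowerSeries.X ^ n *
        (PowerSeries.C r * 4 * d * (E + E') - PowerSeries.X *
          (PowerSeries.C r * PowerSeries.X * coeffD D f * (coeffD D O + coeffD D O')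
            + f * (O + O'))) := by
      simp only [evenQuad, hd, hf, map_add, coeffD_X_pow_mul]
      ring
    have h0 := congrArg (PowerSeries.coeff n) hq
    rw [map_sub, he n hn, sub_self, PowerSeries.coeff_X_pow_mul', if_pos le_rfl, Nat.sub_self,
      PowerSeries.coeff_zero_eq_constantCoeff_apply] at h0
    simp only [map_sub, map_mul, map_add, hE, hE', PowerSeries.constantCoeff_C, map_ofNat,
      PowerSeries.constantCoeff_X, zero_mul, sub_zero] at h0
    have h1 : PowerSeries.constantCoeff d = 0 :=
      (h8.mul_right_eq_zero).mp (by rw [h0]; ring)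
    rw [hd, map_add, PowerSeries.coeff_X_pow_mul', if_pos le_rfl, Nat.sub_self,
      PowerSeries.coeff_zero_eq_constantCoeff_apply, h1, add_zero]
  refine ⟨hEn, ?_⟩
  obtain ⟨d, hd⟩ := exists_eq_add_X_pow_mul (n := n + 1) (f := E) (g := E') fun i hi => by
    rcases Nat.lt_succ_iff_lt_or_eq.mp hi with h | rfl
    · exact (ih i h (by omega)).1
    · exact hEn
  obtain ⟨f, hf⟩ := exists_eq_add_X_pow_mul fun i hi => (ih i hi (by omega)).2
  have hq : oddQuad D r u E O - oddQuad D r u E' O' = PowerSeries.X ^ n *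
      (PowerSeries.X * (PowerSeries.C u * (4 * d * (E + E') -
          PowerSeries.X * coeffD D f * (coeffD D O + coeffD D O')) +
        2 * PowerSeries.C r *
          (coeffD D f * coeffD D E + coeffD D O' * PowerSeries.X * coeffD D d
            - PowerSeries.X * d * coeffD D (coeffD D O) - E' * coeffD D (coeffD D f))
        - 2 * O * d) - 2 * f * E') := by
    simp only [oddQuad, hd, hf, map_add, coeffD_X_pow_mul]
    ring
  have h0 := congrArg (PowerSeries.coeff n) hq
  rw [map_sub, ho n hn, sub_self, PowerSeries.coeff_X_pow_mul', if_pos le_rfl, Nat.sub_self,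
    PowerSeries.coeff_zero_eq_constantCoeff_apply] at h0
  simp only [map_sub, map_mul, hE', map_ofNat,
    PowerSeries.constantCoeff_X, zero_mul, zero_sub, mul_one] at h0
  have h1 : PowerSeries.constantCoeff f = 0 :=
    (h2.mul_right_eq_zero).mp (neg_eq_zero.mp h0.symm)
  rw [hf, map_add, PowerSeries.coeff_X_pow_mul', if_pos le_rfl, Nat.sub_self,
    PowerSeries.coeff_zero_eq_constantCoeff_apply, h1, add_zero]

end Quadratic

/-! ### Existence of the hierarchy -/

/-- The coefficients `(eₙ, oₙ)` of the generating series `E = ∑ eₙ zⁿ` and `O = ∑ oₙ zⁿ` of the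
Painlevé II hierarchy: `O = 2 u E - r z O''` and `4 r E² - r z² O'² = 4 r + z O²`, solved for the
top coefficients. -/
def hierarchyCoeff (r : ℝ) : ℕ → DiffPoly × DiffPoly
  | 0 => (1, 2 * MvPolynomial.X 0)
  | n + 1 =>
    let e : DiffPoly := MvPolynomial.C (8 * r)⁻¹ *
      (∑ i : Fin (n + 1), (hierarchyCoeff r i).2 * (hierarchyCoeff r (n - i)).2 +
        ∑ i : Fin n, (MvPolynomial.C r * (totalD (hierarchyCoeff r i).2 *
            totalD (hierarchyCoeff r (n - 1 - i)).2) -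
          4 * MvPolynomial.C r *
            ((hierarchyCoeff r (i + 1)).1 * (hierarchyCoeff r (n - i)).1)))
    (e, 2 * MvPolynomial.X 0 * e - MvPolynomial.C r * totalD (totalD (hierarchyCoeff r n).2))
  termination_by n => n
  decreasing_by all_goals omega

/-- The generating series of the `eₙ`. -/
def hierarchyE (r : ℝ) : PowerSeries DiffPoly := PowerSeries.mk fun n => (hierarchyCoeff r n).1

/-- The generating series of the `oₙ`. -/
def hierarchyO (r : ℝ) : PowerSeries DiffPoly := PowerSeries.mk fun n => (hierarchyCoeff r n).2

theorem hierarchyE_constantCoeff (r : ℝ) : PowerSeries.constantCoeff (hierarchyE r) = 1 := by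
  rw [← PowerSeries.coeff_zero_eq_constantCoeff_apply, hierarchyE, PowerSeries.coeff_mk,
    hierarchyCoeff]

theorem hierarchyO_eq (r : ℝ) :
    hierarchyO r = 2 * PowerSeries.C (MvPolynomial.X 0) * hierarchyE r -
      PowerSeries.C (MvPolynomial.C r) * PowerSeries.X *
        coeffD totalD (coeffD totalD (hierarchyO r)) := by
  ext1 n
  have h2 : (2 : PowerSeries DiffPoly) = PowerSeries.C 2 := (map_ofNat PowerSeries.C 2).symm
  rw [h2, map_sub, ← map_mul, PowerSeries.coeff_C_mul, mul_assoc (PowerSeries.C _),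
    PowerSeries.coeff_C_mul]
  cases n with
  | zero => simp [hierarchyO, hierarchyE, hierarchyCoeff]
  | succ n =>
    rw [PowerSeries.coeff_succ_X_mul, coeff_coeffD, coeff_coeffD, hierarchyO, hierarchyE]
    simp only [PowerSeries.coeff_mk]
    conv_lhs => rw [hierarchyCoeff]
    conv_rhs => enter [1, 2]; rw [hierarchyCoeff]

theorem evenQuad_hierarchy {r : ℝ} (hr : r ≠ 0) :
    evenQuad totalD (MvPolynomial.C r) (hierarchyE r) (hierarchyO r) = 0 := by
  have h4 : (4 : PowerSeries DiffPoly) = PowerSeries.C 4 := (map_ofNat PowerSeries.C 4).symm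
  have hC : (MvPolynomial.C r : DiffPoly) * (8 * MvPolynomial.C (8 * r)⁻¹) = 1 := by
    rw [show (8 : DiffPoly) = MvPolynomial.C 8 from (map_ofNat MvPolynomial.C 8).symm,
      ← map_mul, ← map_mul, ← map_one MvPolynomial.C]
    congr 1
    field_simp
  ext1 n
  rw [evenQuad, h4, ← map_mul, map_sub, PowerSeries.coeff_C_mul, map_sub, PowerSeries.coeff_C_mul,
    map_add, map_zero]
  cases n with
  | zero =>
    rw [pow_two PowerSeries.X, mul_assoc, PowerSeries.coeff_zero_X_mul,
      PowerSeries.coeff_zero_X_mul, PowerSeries.coeff_zero_eq_constantCoeff_apply, map_pow,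
      hierarchyE_constantCoeff, PowerSeries.coeff_zero_C]
    ring
  | succ n =>
    have hE : PowerSeries.coeff (n + 1) (hierarchyE r ^ 2) = 2 * (hierarchyCoeff r (n + 1)).1 +
        ∑ i ∈ Finset.range n, (hierarchyCoeff r (i + 1)).1 * (hierarchyCoeff r (n - i)).1 := by
      rw [pow_two, PowerSeries.coeff_mul, Finset.Nat.sum_antidiagonal_eq_sum_range_succ_mk,
        Finset.sum_range_succ, Finset.sum_range_succ']
      simp only [hierarchyE, PowerSeries.coeff_mk, Nat.sub_self, Nat.sub_zero,
        Nat.add_sub_add_right]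
      rw [show (hierarchyCoeff r 0).1 = 1 by rw [hierarchyCoeff]]
      ring
    have hO : PowerSeries.coeff (n + 1) (PowerSeries.X * hierarchyO r ^ 2) =
        ∑ i ∈ Finset.range (n + 1), (hierarchyCoeff r i).2 * (hierarchyCoeff r (n - i)).2 := by
      rw [PowerSeries.coeff_succ_X_mul, pow_two, PowerSeries.coeff_mul,
        Finset.Nat.sum_antidiagonal_eq_sum_range_succ_mk]
      simp only [hierarchyO, PowerSeries.coeff_mk]
    have hO' : PowerSeries.coeff (n + 1) (PowerSeries.X ^ 2 * coeffD totalD (hierarchyO r) ^ 2) =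
        ∑ i ∈ Finset.range n, totalD (hierarchyCoeff r i).2 *
          totalD (hierarchyCoeff r (n - 1 - i)).2 := by
      rw [pow_two PowerSeries.X, mul_assoc, PowerSeries.coeff_succ_X_mul]
      cases n with
      | zero => simp
      | succ n =>
        rw [PowerSeries.coeff_succ_X_mul, pow_two, PowerSeries.coeff_mul,
          Finset.Nat.sum_antidiagonal_eq_sum_range_succ_mk]
        simp only [hierarchyO, PowerSeries.coeff_mk, coeff_coeffD, Nat.add_sub_cancel]
    rw [hE, hO, hO', PowerSeries.coeff_succ_C]
    conv_lhs => enter [1, 2, 1, 2, 1]; rw [hierarchyCoeff]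
    simp only [Finset.sum_range, Finset.sum_sub_distrib, ← Finset.mul_sum]
    generalize (∑ i : Fin (n + 1), (hierarchyCoeff r i).2 * (hierarchyCoeff r (n - i)).2) = a
    generalize (∑ i : Fin n, totalD (hierarchyCoeff r i).2 *
      totalD (hierarchyCoeff r (n - 1 - i)).2) = b
    generalize (∑ i : Fin n, (hierarchyCoeff r (i + 1)).1 * (hierarchyCoeff r (n - i)).1) = c
    linear_combination (a + MvPolynomial.C r * b - 4 * MvPolynomial.C r * c) * hC

/-- The relation `2 r E' = u z O'` follows by differentiation of the quadratic relation, since `E`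
is not a zero divisor. -/
theorem two_mul_coeffD_hierarchyE {r : ℝ} (hr : r ≠ 0) :
    2 * PowerSeries.C (MvPolynomial.C r) * coeffD totalD (hierarchyE r) =
      PowerSeries.C (MvPolynomial.X 0) * PowerSeries.X * coeffD totalD (hierarchyO r) := by
  have h := congrArg (coeffD totalD) (evenQuad_hierarchy hr)
  have hO := hierarchyO_eq r
  have hX2 : ∀ f : PowerSeries DiffPoly, coeffD totalD (PowerSeries.X ^ 2 * f) =
      PowerSeries.X ^ 2 * coeffD totalD f := coeffD_X_pow_mul _ 2
  have hX1 : ∀ f : PowerSeries DiffPoly, coeffD totalD (PowerSeries.X * f) =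
      PowerSeries.X * coeffD totalD f := by simpa using coeffD_X_pow_mul totalD 1
  have hC : coeffD totalD (PowerSeries.C (MvPolynomial.C r)) = 0 := by
    rw [coeffD_C, MvPolynomial.derivation_C, map_zero]
  have h4 : ∀ f : PowerSeries DiffPoly, coeffD totalD (4 * f) = 4 * coeffD totalD f := by
    intro f
    rw [show (4 : PowerSeries DiffPoly) * f = f + f + f + f by ring]
    simp only [map_add]; ring
  simp only [evenQuad, map_sub, map_add, map_zero, Derivation.leibniz, hC, hX2, hX1, h4,
    smul_eq_mul, pow_two (hierarchyE r), pow_two (hierarchyO r),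
    pow_two (coeffD totalD (hierarchyO r)), mul_zero] at h
  have hne : 4 * hierarchyE r ≠ 0 := by
    intro h0
    have := congrArg PowerSeries.constantCoeff h0
    rw [map_mul, hierarchyE_constantCoeff] at this
    rw [map_ofNat, mul_one, map_zero] at this
    have h40 := congrArg MvPolynomial.constantCoeff this
    rw [map_ofNat, map_zero] at h40
    exact four_ne_zero h40
  apply mul_left_cancel₀ hne
  generalize hierarchyE r = E at *
  generalize coeffD totalD (hierarchyO r) = O' at *
  generalize hierarchyO r = O at *
  linear_combination h + 2 * PowerSeries.X * O' * hO

theorem oddQuad_hierarchy {r : ℝ} (hr : r ≠ 0) :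
    oddQuad totalD (MvPolynomial.C r) (MvPolynomial.X 0) (hierarchyE r) (hierarchyO r) = 0 := by
  have hY := two_mul_coeffD_hierarchyE hr
  have hO := hierarchyO_eq r
  rw [oddQuad]
  linear_combination (PowerSeries.X * coeffD totalD (hierarchyO r)) * hY - 2 * hierarchyE r * hO

theorem constantCoeff_hierarchyCoeff {r : ℝ} (n : ℕ) :
    MvPolynomial.constantCoeff (hierarchyCoeff r n).2 = 0 ∧
      MvPolynomial.constantCoeff (hierarchyCoeff r (n + 1)).1 = 0 := by
  induction n using Nat.strong_induction_on with
  | _ n ih =>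
  have hO : MvPolynomial.constantCoeff (hierarchyCoeff r n).2 = 0 := by
    cases n with
    | zero => rw [hierarchyCoeff]; simp
    | succ n => rw [hierarchyCoeff]; simp [constantCoeff_totalD]
  refine ⟨hO, ?_⟩
  have hO' : ∀ i ≤ n, MvPolynomial.constantCoeff (hierarchyCoeff r i).2 = 0 := fun i hi => by
    rcases hi.lt_or_eq with h | rfl
    · exact (ih i h).1
    · exact hO
  rw [hierarchyCoeff]
  simp only [map_mul, map_add, map_sum, map_sub, constantCoeff_totalD, mul_zero, zero_sub]
  rw [Finset.sum_eq_zero, Finset.sum_eq_zero, add_zero, mul_zero]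
  · intro i _
    rw [(ih i i.2).2]; ring
  · intro i _
    rw [hO' i (by omega)]; ring

/-- The hierarchy is `R_n = -o_n / (4 r)`, `S_n = -e_{n + 1} / (4 r)`. -/
theorem isPainleveIIHierarchy_hierarchyCoeff {r : ℝ} (hr : r ≠ 0) :
    IsPainleveIIHierarchy r (fun n => MvPolynomial.C (-(1 / (4 * r))) * (hierarchyCoeff r n).2)
      (fun n => MvPolynomial.C (-(1 / (4 * r))) * (hierarchyCoeff r (n + 1)).1) where
  R_zero := by
    rw [hierarchyCoeff, ← mul_assoc,
      show (2 : DiffPoly) = MvPolynomial.C 2 from (map_ofNat MvPolynomial.C 2).symm, ← map_mul]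
    congr 2
    field_simp
    norm_num
  S_zero := by
    have h4 : (4 : DiffPoly) = MvPolynomial.C 4 := (map_ofNat MvPolynomial.C 4).symm
    rw [hierarchyCoeff]
    simp only [Finset.univ_eq_empty, Finset.sum_empty, add_zero]
    rw [Fin.sum_univ_one]
    simp only [Fin.val_zero, Nat.sub_zero]
    rw [show (hierarchyCoeff r 0).2 = 2 * MvPolynomial.X 0 by rw [hierarchyCoeff],
      show (2 * MvPolynomial.X 0 * (2 * MvPolynomial.X 0) : DiffPoly) =
        MvPolynomial.C 4 * MvPolynomial.X 0 ^ 2 by rw [← h4]; ring, ← mul_assoc, ← mul_assoc,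
      ← map_mul, ← map_mul]
    congr 2
    field_simp
  R_succ n := by
    conv_lhs => rw [hierarchyCoeff]
    conv_rhs => enter [2, 2, 2]; rw [hierarchyCoeff]
    simp only [MvPolynomial.C_mul', Derivation.map_smul, smul_sub, mul_smul_comm, mul_assoc]
    simp only [← MvPolynomial.C_mul']
    ring
  S_deriv n := by
    have h := congrArg (PowerSeries.coeff (n + 1)) (two_mul_coeffD_hierarchyE hr)
    rw [show (2 : PowerSeries DiffPoly) = PowerSeries.C 2 from (map_ofNat PowerSeries.C 2).symm,
      mul_assoc, PowerSeries.coeff_C_mul, PowerSeries.coeff_C_mul, mul_assoc,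
      PowerSeries.coeff_C_mul, PowerSeries.coeff_succ_X_mul, coeff_coeffD, coeff_coeffD,
      hierarchyE, hierarchyO, PowerSeries.coeff_mk, PowerSeries.coeff_mk] at h
    have h2 : (MvPolynomial.C (2 * r) : DiffPoly) = 2 * MvPolynomial.C r := by
      rw [map_mul]; rfl
    simp only [MvPolynomial.C_mul', Derivation.map_smul]
    simp only [← MvPolynomial.C_mul']
    rw [h2]
    linear_combination MvPolynomial.C (-(1 / (4 * r))) * h
  S_const n := by
    rw [map_mul, (constantCoeff_hierarchyCoeff n).2, mul_zero]

theorem existsUnique_isPainleveIIHierarchy {r : ℝ} (hr : r ≠ 0) :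
    ∃! RS : (ℕ → DiffPoly) × (ℕ → DiffPoly), IsPainleveIIHierarchy r RS.1 RS.2 := by
  refine ⟨(_, _), isPainleveIIHierarchy_hierarchyCoeff hr, fun RS h => ?_⟩
  obtain ⟨h1, h2⟩ := h.unique hr (isPainleveIIHierarchy_hierarchyCoeff hr)
  exact Prod.ext h1 h2

/-! ### The leading coefficient of the generating functions -/

/-- The branch `√(1 - 4r/l)`, so that `w_c = l √(1 - 4r/l)`. -/
def critRoot (r : ℝ) (l : ℂ) : ℂ := (1 - ((4 * r : ℝ) : ℂ) / l) ^ (1 / 2 : ℂ)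

theorem one_sub_div_mem_slitPlane {t : ℝ} {l : ℂ} (h : |t| < ‖l‖) :
    1 - (t : ℂ) / l ∈ Complex.slitPlane := by
  have h0 : 0 < ‖l‖ := (abs_nonneg t).trans_lt h
  rw [sub_eq_add_neg]
  refine Complex.mem_slitPlane_of_norm_lt_one ?_
  rw [norm_neg, norm_div, Complex.norm_real, Real.norm_eq_abs, div_lt_one h0]
  exact h

theorem wCrit_eq (r : ℝ) (l : ℂ) : wCrit r l = l * critRoot r l := by
  simp [wCrit, sqrtBranch, critRoot]

theorem critRoot_sq (r : ℝ) (l : ℂ) : critRoot r l ^ 2 = 1 - 4 * (r : ℂ) / l := by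
  rw [critRoot, ← Complex.cpow_nat_mul]
  push_cast
  norm_num

theorem critRoot_ne_zero {r : ℝ} (hr : 0 < r) {l : ℂ} (hl : 4 * r < ‖l‖) : critRoot r l ≠ 0 := by
  have h := Complex.slitPlane_ne_zero
    (one_sub_div_mem_slitPlane (t := 4 * r) (by rwa [abs_of_pos (by positivity)]))
  rw [critRoot]
  exact fun h0 => h ((Complex.cpow_eq_zero_iff _ _).mp h0).1

theorem continuousOn_critRoot {r : ℝ} (hr : 0 < r) :
    ContinuousOn (critRoot r) {l : ℂ | 4 * r < ‖l‖} := by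
  intro l hl
  have hl0 : l ≠ 0 := norm_pos_iff.mp (lt_trans (by positivity) hl)
  apply ContinuousAt.continuousWithinAt
  have h1 : ContinuousAt (fun l : ℂ => 1 - ((4 * r : ℝ) : ℂ) / l) l :=
    continuousAt_const.sub (continuousAt_const.div continuousAt_id hl0)
  exact h1.cpow continuousAt_const
    (one_sub_div_mem_slitPlane (by rwa [abs_of_pos (by positivity)]))

theorem tendsto_critRoot (r : ℝ) :
    Filter.Tendsto (critRoot r) (Bornology.cobounded ℂ) (𝓝 1) := by
  have h1 : Filter.Tendsto (fun l : ℂ => 1 - ((4 * r : ℝ) : ℂ) / l) (Bornology.cobounded ℂ)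
      (𝓝 (1 - ((4 * r : ℝ) : ℂ) * 0)) := by
    simp only [div_eq_mul_inv]
    exact tendsto_const_nhds.sub (tendsto_const_nhds.mul Filter.tendsto_inv₀_cobounded)
  rw [mul_zero, sub_zero] at h1
  have h2 : ContinuousAt (fun z : ℂ => z ^ (1 / 2 : ℂ)) 1 :=
    continuousAt_id.cpow continuousAt_const (by simp [Complex.slitPlane])
  have h3 := h2.tendsto.comp h1
  rwa [Complex.one_cpow] at h3

/-- The quadratic system at order `0` has, among the pairs of functions which are continuous in
`|l| > 4r` and tend to `1`, only the solution `l / w_c = (1 - 4r/l)^(-1/2)`. The algebraic equations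
leave finitely many values for `(f + g) / 2 · √(1 - 4r/l)`, and continuity along a ray towards
infinity selects the value `1`. -/
theorem leading_coefficient {r : ℝ} (hr : 0 < r) {f g : ℂ → ℂ}
    (hf : ContinuousOn f {l : ℂ | 4 * r < ‖l‖}) (hg : ContinuousOn g {l : ℂ | 4 * r < ‖l‖})
    (hf1 : Filter.Tendsto f (Bornology.cobounded ℂ) (𝓝 1))
    (hg1 : Filter.Tendsto g (Bornology.cobounded ℂ) (𝓝 1))
    (h1 : ∀ l : ℂ, 4 * r < ‖l‖ → (r : ℂ) * (f l + g l) ^ 2 = l * (f l ^ 2 - 1))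
    (h2 : ∀ l : ℂ, 4 * r < ‖l‖ → (r : ℂ) * (f l + g l) ^ 2 = l * (g l ^ 2 - 1))
    {l : ℂ} (hl : 4 * r < ‖l‖) : f l = (critRoot r l)⁻¹ ∧ g l = (critRoot r l)⁻¹ := by
  have hl0' : 0 < ‖l‖ := lt_trans (by positivity) hl
  have hl0 : l ≠ 0 := norm_pos_iff.mp hl0'
  have hval : ∀ z : ℂ, 4 * r < ‖z‖ →
      f z + g z = 0 ∨ f z = g z ∧ (f z * critRoot r z) ^ 2 = 1 := by
    intro z hz
    have hz0 : z ≠ 0 := norm_pos_iff.mp (lt_trans (by positivity) hz)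
    have h3 : z * ((f z + g z) * (f z - g z)) = 0 := by linear_combination h2 z hz - h1 z hz
    rcases mul_eq_zero.mp ((mul_eq_zero.mp h3).resolve_left hz0) with h | h
    · exact Or.inl h
    · right
      have hfg := sub_eq_zero.mp h
      refine ⟨hfg, ?_⟩
      have h4 := h1 z hz
      rw [← hfg] at h4
      rw [mul_pow, critRoot_sq]
      apply mul_left_cancel₀ hz0
      field_simp
      linear_combination -h4
  set h : ℝ → ℂ := fun t => (f (t * l) + g (t * l)) * critRoot r (t * l) / 2 with hh
  have hmem : ∀ t ∈ Set.Ici (1 : ℝ), ((t : ℂ) * l) ∈ {l : ℂ | 4 * r < ‖l‖} := by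
    intro t ht
    have ht1 : (1 : ℝ) ≤ t := ht
    show 4 * r < ‖(t : ℂ) * l‖
    rw [norm_mul, Complex.norm_real, Real.norm_of_nonneg (by linarith)]
    nlinarith
  have hcont : ContinuousOn h (Set.Ici 1) := by
    have hm : ContinuousOn (fun t : ℝ => (t : ℂ) * l) (Set.Ici 1) := by fun_prop
    exact (((hf.comp hm hmem).add (hg.comp hm hmem)).mul
      ((continuousOn_critRoot hr).comp hm hmem)).div_const 2
  have hmaps : Set.MapsTo h (Set.Ici 1) ({0, 1, -1} : Set ℂ) := by
    intro t ht
    rcases hval _ (hmem t ht) with h0 | ⟨h0, h0'⟩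
    · left; simp [hh, h0]
    · right
      have : h t = f (t * l) * critRoot r (t * l) := by
        simp only [hh]; rw [← h0]; ring
      rw [this]
      rcases sq_eq_sq_iff_eq_or_eq_neg.mp (h0'.trans (one_pow 2).symm) with h | h
      · left; exact h
      · right; exact h
  have hconst : ∀ t ∈ Set.Ici (1 : ℝ), h t = h 1 := by
    intro t ht
    have hfin : ({0, 1, -1} : Set ℂ).Finite := by simp
    exact (convex_Ici (1 : ℝ)).isPreconnected.constant_of_mapsTo hfin.isDiscrete hcont hmaps ht
      (Set.mem_Ici.mpr le_rfl)
  have hlim : Filter.Tendsto h Filter.atTop (𝓝 1) := by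
    have ht : Filter.Tendsto (fun t : ℝ => (t : ℂ) * l) Filter.atTop (Bornology.cobounded ℂ) := by
      rw [← tendsto_norm_atTop_iff_cobounded]
      have : Filter.Tendsto (fun t : ℝ => t * ‖l‖) Filter.atTop Filter.atTop :=
        Filter.tendsto_id.atTop_mul_const hl0'
      refine this.congr' ?_
      filter_upwards [Filter.eventually_ge_atTop 0] with t ht
      rw [norm_mul, Complex.norm_real, Real.norm_of_nonneg ht]
    have h3 := (((hf1.comp ht).add (hg1.comp ht)).mul ((tendsto_critRoot r).comp ht)).div_const 2
    norm_num at h3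
    exact h3
  have hone : h 1 = 1 := by
    have h3 : Filter.Tendsto h Filter.atTop (𝓝 (h 1)) :=
      tendsto_const_nhds.congr' (by
        filter_upwards [Filter.eventually_ge_atTop 1] with t ht using (hconst t ht).symm)
    exact tendsto_nhds_unique h3 hlim
  have hy := critRoot_ne_zero hr hl
  simp only [hh, Complex.ofReal_one, one_mul] at hone
  rcases hval l hl with h0 | ⟨h0, -⟩
  · rw [h0] at hone; norm_num at hone
  · rw [← h0] at hone
    have : f l = (critRoot r l)⁻¹ := by
      field_simp; linear_combination hone
    exact ⟨this, h0 ▸ this⟩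

/-! ### Differentiation of the hodograph function under the integral sign -/

theorem contourInt_congr {R : ℝ} (hR : 0 ≤ R) {f g : ℂ → ℂ} (h : ∀ l : ℂ, ‖l‖ = R → f l = g l) :
    contourInt R f = contourInt R g := by
  rw [contourInt, contourInt, circleIntegral.integral_congr hR fun l hl => h l (by simpa using hl)]

theorem contourInt_const_mul (R : ℝ) (c : ℂ) (f : ℂ → ℂ) :
    contourInt R (fun l => c * f l) = c * contourInt R f := by
  rw [contourInt, contourInt, circleIntegral.integral_const_mul]; ring

theorem contourInt_add {R : ℝ} (hR : 0 ≤ R) {f g : ℂ → ℂ}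
    (hf : ContinuousOn f (Metric.sphere 0 R)) (hg : ContinuousOn g (Metric.sphere 0 R)) :
    contourInt R (fun l => f l + g l) = contourInt R f + contourInt R g := by
  rw [contourInt, contourInt, contourInt,
    circleIntegral.integral_add (hf.circleIntegrable hR) (hg.circleIntegrable hR), mul_add]

theorem contourInt_sum {ι : Type*} {R : ℝ} (hR : 0 ≤ R) (s : Finset ι) {f : ι → ℂ → ℂ}
    (hf : ∀ i ∈ s, ContinuousOn (f i) (Metric.sphere 0 R)) :
    contourInt R (fun l => ∑ i ∈ s, f i l) = ∑ i ∈ s, contourInt R (f i) := by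
  simp only [contourInt]
  rw [circleIntegral.integral_fun_sum fun i hi => (hf i hi).circleIntegrable hR, Finset.mul_sum]

theorem hasDerivAt_contourInt_cpow {R : ℝ} {f : ℂ → ℂ} (hf : ContinuousOn f (Metric.sphere 0 R))
    (α : ℂ) {t₀ : ℝ} (ht : |t₀| < R) :
    HasDerivAt (fun t : ℝ => contourInt R fun l => f l * (1 - (t : ℂ) / l) ^ α)
      (contourInt R fun l => f l * (-α / l * (1 - (t₀ : ℂ) / l) ^ (α - 1))) t₀ := by
  have hR : 0 < R := (abs_nonneg t₀).trans_lt ht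
  obtain ⟨ρ, hρ, hρR⟩ := exists_between ht
  have hnorm : ∀ θ : ℝ, ‖circleMap 0 R θ‖ = R := fun θ => by
    rw [norm_circleMap_zero, abs_of_pos hR]
  have hne : ∀ θ : ℝ, circleMap 0 R θ ≠ 0 := fun θ => norm_pos_iff.mp (by rw [hnorm]; exact hR)
  have hfc : Continuous fun θ => f (circleMap 0 R θ) :=
    hf.comp_continuous (continuous_circleMap 0 R) fun θ => by simpa using hnorm θ
  have hslit : ∀ t ∈ Set.Icc (-ρ) ρ, ∀ θ : ℝ,
      1 - (t : ℂ) / circleMap 0 R θ ∈ Complex.slitPlane := fun t ht θ =>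
    one_sub_div_mem_slitPlane (by rw [hnorm]; exact (abs_le.mpr ht).trans_lt hρR)
  have hbase : ContinuousOn (fun p : ℝ × ℝ => 1 - (p.1 : ℂ) / circleMap 0 R p.2)
      (Set.Icc (-ρ) ρ ×ˢ Set.univ) := by
    apply Continuous.continuousOn
    exact continuous_const.sub ((Complex.continuous_ofReal.comp continuous_fst).div
      ((continuous_circleMap 0 R).comp continuous_snd) fun p => hne _)
  have hcpow : ∀ β : ℂ, ContinuousOn
      (fun p : ℝ × ℝ => (1 - (p.1 : ℂ) / circleMap 0 R p.2) ^ β)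
      (Set.Icc (-ρ) ρ ×ˢ Set.univ) := fun β =>
    hbase.cpow continuousOn_const fun p hp => hslit p.1 hp.1 p.2
  have hslice : ∀ β : ℂ, ∀ t ∈ Set.Icc (-ρ) ρ,
      Continuous fun θ : ℝ => (1 - (t : ℂ) / circleMap 0 R θ) ^ β := fun β t ht =>
    (hcpow β).comp_continuous (continuous_const.prodMk continuous_id) fun θ => ⟨ht, trivial⟩
  have hderivc : Continuous fun θ : ℝ => deriv (circleMap 0 R) θ := by
    simp only [deriv_circleMap]; fun_prop
  have hs : Set.Icc (-ρ) ρ ∈ 𝓝 t₀ := Icc_mem_nhds (abs_lt.mp hρ).1 (abs_lt.mp hρ).2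
  have ht₀ : t₀ ∈ Set.Icc (-ρ) ρ := abs_le.mp hρ.le
  set F : ℝ → ℝ → ℂ := fun t θ => deriv (circleMap 0 R) θ *
    (f (circleMap 0 R θ) * (1 - (t : ℂ) / circleMap 0 R θ) ^ α) with hF
  set F' : ℝ → ℝ → ℂ := fun t θ => deriv (circleMap 0 R) θ * (f (circleMap 0 R θ) *
    (-α / circleMap 0 R θ * (1 - (t : ℂ) / circleMap 0 R θ) ^ (α - 1))) with hF'
  have hFc : ∀ t ∈ Set.Icc (-ρ) ρ, Continuous (F t) := fun t ht =>
    hderivc.mul (hfc.mul (hslice α t ht))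
  have hF'c : ContinuousOn (fun p : ℝ × ℝ => F' p.1 p.2) (Set.Icc (-ρ) ρ ×ˢ Set.univ) := by
    refine ContinuousOn.mul (hderivc.comp continuous_snd).continuousOn
      (ContinuousOn.mul (hfc.comp continuous_snd).continuousOn
        (ContinuousOn.mul (Continuous.continuousOn ?_) (hcpow _)))
    exact continuous_const.div ((continuous_circleMap 0 R).comp continuous_snd) fun p => hne _
  obtain ⟨C, hC⟩ := ((isCompact_Icc (a := -ρ) (b := ρ)).prod
    (isCompact_uIcc (a := (0 : ℝ)) (b := 2 * Real.pi))).exists_bound_of_continuousOn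
    (hF'c.mono (Set.prod_mono le_rfl (Set.subset_univ _)))
  have hF'slice : Continuous (F' t₀) :=
    hF'c.comp_continuous (continuous_const.prodMk continuous_id) fun θ => ⟨ht₀, trivial⟩
  have key := (intervalIntegral.hasDerivAt_integral_of_dominated_loc_of_deriv_le
    (μ := MeasureTheory.volume) (a := 0) (b := 2 * Real.pi) (F := F) (F' := F') (x₀ := t₀)
    (bound := fun _ => C) hs
    (by filter_upwards [hs] with t ht using (hFc t ht).aestronglyMeasurable)
    ((hFc t₀ ht₀).intervalIntegrable _ _) hF'slice.aestronglyMeasurable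
    (Filter.Eventually.of_forall fun θ hθ t ht =>
      hC (t, θ) ⟨ht, Set.uIoc_subset_uIcc hθ⟩)
    intervalIntegrable_const
    (Filter.Eventually.of_forall fun θ hθ t ht => by
      have h1 : HasDerivAt (fun z : ℂ => 1 - z / circleMap 0 R θ)
          (-(1 / circleMap 0 R θ)) (t : ℂ) :=
        ((hasDerivAt_id (t : ℂ)).div_const _).const_sub 1
      have h2 := (h1.cpow_const (c := α) (hslit t ht θ)).comp_ofReal
      refine ((h2.const_mul (f (circleMap 0 R θ))).const_mul
        (deriv (circleMap 0 R) θ)).congr_deriv ?_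
      simp only [hF']
      ring)).2
  exact key.const_mul _

/-- The factor `∏ i < k, (i - 1 / 2)` produced by `k` differentiations of
`t ↦ (1 - t / l) ^ (1 / 2)`, up to the powers of `l` and of `1 - t / l`. -/
def rootDerivCoeff (k : ℕ) : ℂ := ∏ i ∈ Finset.range k, (-((1 / 2 : ℂ) - i))

theorem rootDerivCoeff_ne_zero (k : ℕ) : rootDerivCoeff k ≠ 0 := by
  refine Finset.prod_ne_zero_iff.mpr fun i _ h => ?_
  have h1 : (1 : ℂ) = ((2 * i : ℕ) : ℂ) := by push_cast; linear_combination (-2) * h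
  have h2 : (1 : ℕ) = 2 * i := by exact_mod_cast h1
  omega

/-- The derivatives of `t ↦ ∮ f (1 - t / l) ^ (1 / 2) + p + q t`. -/
theorem iteratedDeriv_contourInt_root {R : ℝ} {f : ℂ → ℂ}
    (hf : ContinuousOn f (Metric.sphere 0 R)) (p q : ℂ) (k : ℕ) : ∀ t₀ : ℝ, |t₀| < R →
    iteratedDeriv k
      (fun t : ℝ => contourInt R (fun l => f l * (1 - (t : ℂ) / l) ^ (1 / 2 : ℂ)) +
        (p + q * t)) t₀ =
      contourInt R (fun l => f l * (rootDerivCoeff k / l ^ k) *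
        (1 - (t₀ : ℂ) / l) ^ ((1 / 2 : ℂ) - k)) +
      (if k = 0 then p + q * t₀ else if k = 1 then q else 0) := by
  induction k with
  | zero => intro t₀ ht; simp [rootDerivCoeff]
  | succ k ih =>
    intro t₀ ht
    have hR : 0 < R := (abs_nonneg t₀).trans_lt ht
    rw [iteratedDeriv_succ]
    have hev : iteratedDeriv k (fun t : ℝ =>
        contourInt R (fun l => f l * (1 - (t : ℂ) / l) ^ (1 / 2 : ℂ)) + (p + q * t)) =ᶠ[𝓝 t₀]
        fun t : ℝ => contourInt R (fun l => f l * (rootDerivCoeff k / l ^ k) *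
          (1 - (t : ℂ) / l) ^ ((1 / 2 : ℂ) - k)) +
        (if k = 0 then p + q * t else if k = 1 then q else 0) := by
      have : {t : ℝ | |t| < R} ∈ 𝓝 t₀ := (isOpen_lt continuous_abs continuous_const).mem_nhds ht
      filter_upwards [this] with t ht using ih t ht
    rw [hev.deriv_eq]
    have hg : ContinuousOn (fun l : ℂ => f l * (rootDerivCoeff k / l ^ k))
        (Metric.sphere 0 R) := by
      refine hf.mul (continuousOn_const.div (by fun_prop) fun l hl => pow_ne_zero _ ?_)
      exact norm_pos_iff.mp (by rw [show ‖l‖ = R by simpa using hl]; exact hR)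
    have h1 := hasDerivAt_contourInt_cpow hg ((1 / 2 : ℂ) - k) ht
    have h2 : HasDerivAt (fun t : ℝ => if k = 0 then p + q * t else if k = 1 then q else 0)
        (if k + 1 = 0 then p + q * t₀ else if k + 1 = 1 then q else 0) t₀ := by
      rcases k with _ | _ | k
      · simpa using (((hasDerivAt_id (t₀ : ℂ)).comp_ofReal.const_mul q).const_add p)
      · simpa using hasDerivAt_const t₀ q
      · simpa using hasDerivAt_const t₀ (0 : ℂ)
    refine (h1.add h2).deriv.trans ?_
    congr 1
    refine contourInt_congr hR.le fun l _ => ?_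
    rw [rootDerivCoeff, rootDerivCoeff, Finset.prod_range_succ]
    push_cast
    rw [← sub_sub (1 / 2 : ℂ), pow_succ]
    field_simp

/-- The moment `(2πi)⁻¹ ∮ V_l (l / w_c) f dl`, with the weight `l / w_c = (1 - 4r/l)^(-1/2)`. -/
def critMoment (P : Polynomial ℝ) (R r : ℝ) (f : ℂ → ℂ) : ℂ :=
  contourInt R fun l => dPot P l * (critRoot r l)⁻¹ * f l

section Moments

variable {P : Polynomial ℝ} {R r T : ℝ} {m : ℕ}

theorem continuous_dPot (P : Polynomial ℝ) : Continuous (dPot P) :=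
  Polynomial.continuous_aeval _

theorem continuousOn_critMoment_integrand (hr : 0 < r) (hR : 4 * r < R) {f : ℂ → ℂ}
    (hf : ContinuousOn f (Metric.sphere 0 R)) :
    ContinuousOn (fun l => dPot P l * (critRoot r l)⁻¹ * f l) (Metric.sphere 0 R) := by
  have hsub : Metric.sphere (0 : ℂ) R ⊆ {l : ℂ | 4 * r < ‖l‖} := fun l hl => by
    rw [Set.mem_ofPred_eq, show ‖l‖ = R by simpa using hl]; exact hR
  exact ((continuous_dPot P).continuousOn.mul (((continuousOn_critRoot hr).mono hsub).inv₀
    fun l hl => critRoot_ne_zero hr (hsub hl))).mul hf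

theorem critMoment_add (hr : 0 < r) (hR : 4 * r < R) {f g : ℂ → ℂ}
    (hf : ContinuousOn f (Metric.sphere 0 R)) (hg : ContinuousOn g (Metric.sphere 0 R)) :
    critMoment P R r (fun l => f l + g l) = critMoment P R r f + critMoment P R r g := by
  have hR0 : 0 ≤ R := by linarith
  rw [critMoment, critMoment, critMoment, ← contourInt_add hR0
    (continuousOn_critMoment_integrand hr hR hf) (continuousOn_critMoment_integrand hr hR hg)]
  simp only [mul_add]

theorem critMoment_const_mul (c : ℂ) (f : ℂ → ℂ) :
    critMoment P R r (fun l => c * f l) = c * critMoment P R r f := by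
  rw [critMoment, critMoment, ← contourInt_const_mul]
  congr 1; ext l; ring

theorem critMoment_sum (hr : 0 < r) (hR : 4 * r < R) {ι : Type*} (s : Finset ι) {f : ι → ℂ → ℂ}
    (hf : ∀ i ∈ s, ContinuousOn (f i) (Metric.sphere 0 R)) :
    critMoment P R r (fun l => ∑ i ∈ s, f i l) = ∑ i ∈ s, critMoment P R r (f i) := by
  have hR0 : 0 ≤ R := by linarith
  simp only [critMoment]
  rw [← contourInt_sum hR0 s fun i hi => continuousOn_critMoment_integrand hr hR (hf i hi)]
  simp only [Finset.mul_sum]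

theorem continuousOn_inv_pow (hR : 0 < R) (j : ℕ) :
    ContinuousOn (fun l : ℂ => (l⁻¹) ^ j) (Metric.sphere 0 R) := by
  refine (continuousOn_inv₀.mono fun l hl => ?_).pow j
  exact norm_pos_iff.mp (by rw [show ‖l‖ = R by simpa using hl]; exact hR)

theorem continuousOn_inv_sub (hr : 0 < r) (hR : 4 * r < R) :
    ContinuousOn (fun l : ℂ => (l - 4 * (r : ℂ))⁻¹) (Metric.sphere 0 R) := by
  refine ContinuousOn.inv₀ (by fun_prop) fun l hl h0 => ?_
  have h1 : ‖l‖ = R := by simpa using hl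
  rw [sub_eq_zero.mp h0, norm_mul, Complex.norm_real, Real.norm_of_nonneg hr.le] at h1
  norm_num at h1
  linarith

/-- The combination of two moments that appears in the `σ`-derivatives of `F` and in `φ_m`. -/
theorem critMoment_sub_eq (hr : 0 < r) (hR : 4 * r < R) (k : ℕ) :
    contourInt R (fun l => dPot P l * critRoot r l * (l⁻¹) ^ k) =
      critMoment P R r (fun l => (l⁻¹) ^ k) -
        4 * r * critMoment P R r (fun l => (l⁻¹) ^ (k + 1)) := by
  have hR0 : 0 < R := by linarith
  rw [sub_eq_add_neg, ← neg_mul, ← critMoment_const_mul, ← critMoment_add hr hR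
    (continuousOn_inv_pow hR0 _) (g := fun l => -(4 * (r : ℂ)) * l⁻¹ ^ (k + 1))
    (continuousOn_const.mul (continuousOn_inv_pow hR0 (k + 1))), critMoment]
  refine contourInt_congr hR0.le fun l hl => ?_
  have hy := critRoot_ne_zero hr (show 4 * r < ‖l‖ by rw [hl]; exact hR)
  have h2 := critRoot_sq r l
  field_simp
  rw [h2]
  ring

theorem phiCoeff_eq (hr : 0 < r) (hR : 4 * r < R) (m : ℕ) :
    phiCoeff P R r m = critMoment P R r (fun l => (l⁻¹) ^ m) -
      4 * r * critMoment P R r (fun l => (l⁻¹) ^ (m + 1)) := by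
  have hR0 : 0 < R := by linarith
  rw [← critMoment_sub_eq hr hR, phiCoeff]
  refine contourInt_congr hR0.le fun l hl => ?_
  have hy := critRoot_ne_zero hr (show 4 * r < ‖l‖ by rw [hl]; exact hR)
  have hl0 : l ≠ 0 := norm_pos_iff.mp (by rw [hl]; exact hR0)
  have h2 : l - 4 * r = l * critRoot r l ^ 2 := by rw [critRoot_sq]; field_simp
  rw [h2, wCrit_eq, inv_pow]
  field_simp
  ring

theorem hodographF_sigma (P : Polynomial ℝ) (R T r : ℝ) :
    (fun s : ℝ => hodographF P R T s (4 * r)) = fun s : ℝ =>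
      contourInt R (fun l => dPot P l * l * critRoot r l * (1 - (s : ℂ) / l) ^ (1 / 2 : ℂ)) +
        (T / 2 * (4 * r) + T / 2 * s) := by
  ext s
  rw [hodographF]
  congr 1
  · congr 1; ext l; rw [sqrtBranch, critRoot]; ring
  · push_cast; ring

theorem hodographF_tau (P : Polynomial ℝ) (R T : ℝ) :
    (fun t : ℝ => hodographF P R T 0 t) = fun t : ℝ =>
      contourInt R (fun l => dPot P l * l * (1 - (t : ℂ) / l) ^ (1 / 2 : ℂ)) +
        (0 + T / 2 * t) := by
  ext s
  rw [hodographF]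
  congr 1
  · congr 1; ext l; rw [sqrtBranch]; simp; ring
  · push_cast; ring

theorem iteratedDeriv_sigma (hr : 0 < r) (hR : 4 * r < R) (k : ℕ) :
    iteratedDeriv (k + 1) (fun s : ℝ => hodographF P R T s (4 * r)) 0 =
      rootDerivCoeff (k + 1) * (critMoment P R r (fun l => (l⁻¹) ^ k) -
        4 * r * critMoment P R r (fun l => (l⁻¹) ^ (k + 1))) +
        if k = 0 then (T : ℂ) / 2 else 0 := by
  have hR0 : 0 < R := by linarith
  have hsub : Metric.sphere (0 : ℂ) R ⊆ {l : ℂ | 4 * r < ‖l‖} := fun l hl => by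
    rw [Set.mem_ofPred_eq, show ‖l‖ = R by simpa using hl]; exact hR
  rw [hodographF_sigma, iteratedDeriv_contourInt_root _ _ _ _ _ (by simpa using hR0),
    ← critMoment_sub_eq hr hR, ← contourInt_const_mul]
  · congr 1
    · refine contourInt_congr hR0.le fun l hl => ?_
      have hl0 : l ≠ 0 := norm_pos_iff.mp (by rw [hl]; exact hR0)
      simp
      field_simp
      ring
    · simp
  · exact ((continuous_dPot P).mul continuous_id).continuousOn.mul
      ((continuousOn_critRoot hr).mono hsub)

theorem iteratedDeriv_tau (hr : 0 < r) (hR : 4 * r < R) (k : ℕ) :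
    iteratedDeriv (k + 1) (fun t : ℝ => hodographF P R T 0 t) (4 * r) =
      rootDerivCoeff (k + 1) * critMoment P R r (fun l => ((l - 4 * (r : ℂ))⁻¹) ^ k) +
        if k = 0 then (T : ℂ) / 2 else 0 := by
  have hR0 : 0 < R := by linarith
  rw [hodographF_tau, iteratedDeriv_contourInt_root _ _ _ _ _
      (by rwa [abs_of_pos (by positivity)]), critMoment, ← contourInt_const_mul]
  · congr 1
    · refine contourInt_congr hR0.le fun l hl => ?_
      have hl4 : 4 * r < ‖l‖ := by rw [hl]; exact hR
      have hl0 : l ≠ 0 := norm_pos_iff.mp (by rw [hl]; exact hR0)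
      have hy := critRoot_ne_zero hr hl4
      have hb : 1 - ((4 * r : ℝ) : ℂ) / l ≠ 0 := Complex.slitPlane_ne_zero
        (one_sub_div_mem_slitPlane (t := 4 * r) (by rwa [abs_of_pos (by positivity)]))
      have h2 : l - 4 * r = l * critRoot r l ^ 2 := by rw [critRoot_sq]; field_simp
      rw [Complex.cpow_sub _ _ hb, Complex.cpow_natCast, h2,
        show (1 - ((4 * r : ℝ) : ℂ) / l) ^ (1 / 2 : ℂ) = critRoot r l from rfl,
        show 1 - ((4 * r : ℝ) : ℂ) / l = critRoot r l ^ 2 by rw [critRoot_sq]; push_cast; rfl,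
        inv_pow]
      field_simp
      ring
    · simp
  · exact ((continuous_dPot P).mul continuous_id).continuousOn

/-- The moments at a merging of two cuts of order `m`: the difference of `∂_σ F = 0` and `∂_τ F = 0`
gives the first moment, in which `T` has cancelled, and `∂_σ^k F = 0` then gives the others one
after the other. -/
theorem IsMergingOfOrder.critMoment_eq_zero (hR : 4 * r < R)
    (h : IsMergingOfOrder P R T (4 * r) m) {k : ℕ} (hk : 1 ≤ k) (hkm : k ≤ m) :
    critMoment P R r (fun l => (l⁻¹) ^ k) = 0 := by
  have hr : 0 < r := by linarith [h.pos]
  have hr' : (4 * r : ℂ) ≠ 0 := by exact_mod_cast h.pos.ne'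
  have hT := iteratedDeriv_tau (P := P) (T := T) hr hR 0
  rw [zero_add, iteratedDeriv_one, h.tau_zero] at hT
  simp only [pow_zero, if_pos] at hT
  induction k, hk using Nat.le_induction with
  | base =>
    have h1 := iteratedDeriv_sigma (P := P) (T := T) hr hR 0
    rw [zero_add, h.sigma_zero 1 le_rfl hkm] at h1
    simp only [pow_zero, if_pos] at h1
    have h2 : rootDerivCoeff 1 * (4 * r * critMoment P R r (fun l => (l⁻¹) ^ 1)) = 0 := by
      linear_combination h1 - hT
    exact (mul_eq_zero.mp ((mul_eq_zero.mp h2).resolve_left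
      (rootDerivCoeff_ne_zero 1))).resolve_left hr'
  | succ k hk ih =>
    have h1 := iteratedDeriv_sigma (P := P) (T := T) hr hR k
    rw [h.sigma_zero (k + 1) (by omega) hkm, ih (by omega), if_neg (by omega)] at h1
    have h2 : rootDerivCoeff (k + 1) *
        (4 * r * critMoment P R r (fun l => (l⁻¹) ^ (k + 1))) = 0 := by
      linear_combination h1
    exact (mul_eq_zero.mp ((mul_eq_zero.mp h2).resolve_left
      (rootDerivCoeff_ne_zero _))).resolve_left hr'

theorem IsMergingOfOrder.phiCoeff_eq_moment (hR : 4 * r < R)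
    (h : IsMergingOfOrder P R T (4 * r) m) :
    phiCoeff P R r m = -(4 * r * critMoment P R r (fun l => (l⁻¹) ^ (m + 1))) := by
  rw [phiCoeff_eq (by linarith [h.pos]) hR, h.critMoment_eq_zero hR h.one_le le_rfl, zero_sub]

/-- The second derivative `∂_τ² F` is a nonzero multiple of the moment of `1 / (l - 4 r)`. -/
theorem IsMergingOfOrder.critMoment_inv_sub_ne_zero (hR : 4 * r < R)
    (h : IsMergingOfOrder P R T (4 * r) m) :
    critMoment P R r (fun l => (l - 4 * (r : ℂ))⁻¹) ≠ 0 := by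
  intro h0
  have h1 := iteratedDeriv_tau (P := P) (T := T) (by linarith [h.pos]) hR 1
  simp only [pow_one, h0, mul_zero, one_ne_zero, if_false, add_zero] at h1
  exact h.tau_ne h1

end Moments

/-! ### The differential ring of smooth functions on an open set -/

/-- The algebra of the complex functions on `I` that are restrictions of functions smooth on `I`. -/
def smoothFun (I : Set ℝ) : Subalgebra ℂ (I → ℂ) where
  carrier := {f | ∃ g : ℝ → ℂ, ContDiffOn ℝ ∞ g I ∧ ∀ x : I, f x = g x}
  mul_mem' := by
    rintro f f' ⟨g, hg, h⟩ ⟨g', hg', h'⟩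
    exact ⟨g * g', hg.mul hg', fun x => by simp [h, h']⟩
  add_mem' := by
    rintro f f' ⟨g, hg, h⟩ ⟨g', hg', h'⟩
    exact ⟨g + g', hg.add hg', fun x => by simp [h, h']⟩
  algebraMap_mem' c := ⟨fun _ => c, contDiffOn_const, fun x => rfl⟩

section SmoothFun

variable {I : Set ℝ}

/-- The element of `smoothFun I` given by a function on `ℝ` that is smooth on `I`. -/
def mkSmooth (g : ℝ → ℂ) (hg : ContDiffOn ℝ ∞ g I) : smoothFun I :=
  ⟨fun x => g x, g, hg, fun _ => rfl⟩

theorem mkSmooth_apply (g : ℝ → ℂ) (hg : ContDiffOn ℝ ∞ g I) (x : I) :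
    (mkSmooth g hg : I → ℂ) x = g x := rfl

theorem exists_mkSmooth (f : smoothFun I) : ∃ g hg, f = mkSmooth g hg := by
  obtain ⟨f, g, hg, h⟩ := f
  exact ⟨g, hg, Subtype.ext (funext h)⟩

theorem contDiffOn_deriv_smooth (hI : IsOpen I) {g : ℝ → ℂ} (hg : ContDiffOn ℝ ∞ g I) :
    ContDiffOn ℝ ∞ (deriv g) I :=
  hg.deriv_of_isOpen hI le_rfl

theorem differentiableAt_of_smooth (hI : IsOpen I) {g : ℝ → ℂ} (hg : ContDiffOn ℝ ∞ g I) (x : I) :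
    DifferentiableAt ℝ g x :=
  (hg.differentiableOn (by simp)).differentiableAt (hI.mem_nhds x.2)

theorem mkSmooth_deriv_congr (hI : IsOpen I) {g g' : ℝ → ℂ} (hg : ContDiffOn ℝ ∞ g I)
    (hg' : ContDiffOn ℝ ∞ g' I) (h : mkSmooth g hg = mkSmooth g' hg') :
    mkSmooth (deriv g) (contDiffOn_deriv_smooth hI hg) =
      mkSmooth (deriv g') (contDiffOn_deriv_smooth hI hg') := by
  have h' : ∀ y ∈ I, g y = g' y := fun y hy => congrFun (congrArg Subtype.val h) ⟨y, hy⟩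
  refine Subtype.ext (funext fun x => ?_)
  exact Filter.EventuallyEq.deriv_eq (by filter_upwards [hI.mem_nhds x.2] with y hy using h' y hy)

/-- The underlying map of `smoothD`. It is defined by a choice of a representative on `ℝ`; the
derivative on the open set `I` does not depend on that choice. -/
def smoothDFun (hI : IsOpen I) (f : smoothFun I) : smoothFun I :=
  mkSmooth (deriv (exists_mkSmooth f).choose)
    (contDiffOn_deriv_smooth hI (exists_mkSmooth f).choose_spec.choose)

theorem smoothDFun_mk (hI : IsOpen I) (g : ℝ → ℂ) (hg : ContDiffOn ℝ ∞ g I) :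
    smoothDFun hI (mkSmooth g hg) = mkSmooth (deriv g) (contDiffOn_deriv_smooth hI hg) :=
  mkSmooth_deriv_congr hI _ _ (exists_mkSmooth (mkSmooth g hg)).choose_spec.choose_spec.symm

/-- The derivative as a derivation of `smoothFun I`. -/
def smoothD (hI : IsOpen I) : Derivation ℂ (smoothFun I) (smoothFun I) :=
  Derivation.mk'
    { toFun := smoothDFun hI
      map_add' := fun f f' => by
        obtain ⟨g, hg, rfl⟩ := exists_mkSmooth f
        obtain ⟨g', hg', rfl⟩ := exists_mkSmooth f'
        rw [show mkSmooth g hg + mkSmooth g' hg' = mkSmooth (g + g') (hg.add hg') from rfl,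
          smoothDFun_mk, smoothDFun_mk, smoothDFun_mk]
        refine Subtype.ext (funext fun x => ?_)
        exact deriv_add (differentiableAt_of_smooth hI hg x) (differentiableAt_of_smooth hI hg' x)
      map_smul' := fun c f => by
        obtain ⟨g, hg, rfl⟩ := exists_mkSmooth f
        rw [show c • mkSmooth g hg = mkSmooth (fun x => c * g x) (contDiffOn_const.mul hg) from rfl,
          smoothDFun_mk, smoothDFun_mk]
        refine Subtype.ext (funext fun x => ?_)
        exact deriv_const_mul c (differentiableAt_of_smooth hI hg x) }
    (fun f f' => by
      obtain ⟨g, hg, rfl⟩ := exists_mkSmooth f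
      obtain ⟨g', hg', rfl⟩ := exists_mkSmooth f'
      simp only [LinearMap.coe_mk, AddHom.coe_mk]
      rw [show mkSmooth g hg * mkSmooth g' hg' = mkSmooth (g * g') (hg.mul hg') from rfl,
        smoothDFun_mk, smoothDFun_mk, smoothDFun_mk]
      refine Subtype.ext (funext fun x => ?_)
      refine (deriv_mul (differentiableAt_of_smooth hI hg x)
        (differentiableAt_of_smooth hI hg' x)).trans ?_
      change _ = g x * deriv g' x + g' x * deriv g x
      ring)

theorem smoothD_mk (hI : IsOpen I) (g : ℝ → ℂ) (hg : ContDiffOn ℝ ∞ g I) :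
    smoothD hI (mkSmooth g hg) = mkSmooth (deriv g) (contDiffOn_deriv_smooth hI hg) :=
  smoothDFun_mk hI g hg

theorem smoothD_pow_mk (hI : IsOpen I) (n : ℕ) (g : ℝ → ℂ) (hg : ContDiffOn ℝ ∞ g I) (x : I) :
    (((smoothD hI : Module.End ℂ (smoothFun I)) ^ n) (mkSmooth g hg) : I → ℂ) x =
      iteratedDeriv n g x := by
  induction n generalizing g with
  | zero => simp [mkSmooth_apply]
  | succ n ih =>
    rw [pow_succ, Module.End.mul_apply, iteratedDeriv_succ', ← ih _ (contDiffOn_deriv_smooth hI hg)]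
    rw [show (smoothD hI : Module.End ℂ (smoothFun I)) (mkSmooth g hg) = _ from
      smoothD_mk hI g hg]

/-- Evaluation at a point of `I`. -/
def evalAt (x : I) : smoothFun I →ₐ[ℂ] ℂ :=
  (Pi.evalAlgHom ℂ (fun _ : I => ℂ) x).comp (smoothFun I).val

theorem evalAt_apply (x : I) (f : smoothFun I) : evalAt x f = (f : I → ℂ) x := rfl

theorem smoothFun_ext {f g : smoothFun I} (h : ∀ x, evalAt x f = evalAt x g) : f = g :=
  Subtype.ext (funext h)

theorem powerSeries_smoothFun_ext {f g : PowerSeries (smoothFun I)}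
    (h : ∀ x : I, PowerSeries.map (evalAt x : smoothFun I →+* ℂ) f =
      PowerSeries.map (evalAt x : smoothFun I →+* ℂ) g) : f = g := by
  ext1 n
  refine smoothFun_ext fun x => ?_
  simpa using congrArg (PowerSeries.coeff n) (h x)

/-- Evaluation of a differential polynomial at an element of `smoothFun I`. -/
def evalSmooth (hI : IsOpen I) (u : smoothFun I) : DiffPoly →ₐ[ℝ] smoothFun I :=
  MvPolynomial.aeval fun n => ((smoothD hI : Module.End ℂ (smoothFun I)) ^ n) u

theorem evalSmooth_totalD (hI : IsOpen I) (u : smoothFun I) (p : DiffPoly) :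
    evalSmooth hI u (totalD p) = smoothD hI (evalSmooth hI u p) := by
  induction p using MvPolynomial.induction_on with
  | C a =>
    rw [MvPolynomial.derivation_C, map_zero, ← MvPolynomial.algebraMap_eq, AlgHom.commutes]
    rw [IsScalarTower.algebraMap_apply ℝ ℂ (smoothFun I), Derivation.map_algebraMap]
  | add p q hp hq => simp [hp, hq]
  | mul_X p n hp =>
    rw [Derivation.leibniz, totalD_X, map_mul, Derivation.leibniz, ← hp]
    simp only [smul_eq_mul, map_add, map_mul]
    congr 2
    simp only [evalSmooth, MvPolynomial.aeval_X]
    rw [pow_succ', Module.End.mul_apply]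
    rfl

theorem evalAt_evalSmooth (hI : IsOpen I) (g : ℝ → ℂ) (hg : ContDiffOn ℝ ∞ g I) (p : DiffPoly)
    (x : I) : evalAt x (evalSmooth hI (mkSmooth g hg) p) = evalDiffPoly p g x := by
  have h : ((evalAt x).restrictScalars ℝ).comp (evalSmooth hI (mkSmooth g hg)) =
      MvPolynomial.aeval fun n => iteratedDeriv n g x := by
    refine MvPolynomial.algHom_ext fun n => ?_
    rw [AlgHom.comp_apply, evalSmooth, MvPolynomial.aeval_X, MvPolynomial.aeval_X]
    exact smoothD_pow_mk hI n g hg x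
  exact congrArg (fun φ => φ p) h

end SmoothFun

/-! ### Formal series in `ε` over a differential ring -/

theorem coeff_zero_mul' {C : Type*} [CommRing C] (f g : PowerSeries C) :
    PowerSeries.coeff 0 (f * g) = PowerSeries.coeff 0 f * PowerSeries.coeff 0 g := by
  simp

theorem coeff_one_mul' {C : Type*} [CommRing C] (f g : PowerSeries C) :
    PowerSeries.coeff 1 (f * g) = PowerSeries.coeff 0 f * PowerSeries.coeff 1 g +
      PowerSeries.coeff 1 f * PowerSeries.coeff 0 g := by
  rw [PowerSeries.coeff_mul, Finset.Nat.antidiagonal_succ]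
  simp

theorem coeff_mul_sub_mul_zero {C : Type*} [CommRing C] {f f' g g' : PowerSeries C} {k : ℕ}
    (hf : ∀ i < k, PowerSeries.coeff i f = PowerSeries.coeff i f')
    (hg : ∀ i < k, PowerSeries.coeff i g = PowerSeries.coeff i g') :
    PowerSeries.coeff k (f * g) - PowerSeries.coeff k (f' * g') =
      (PowerSeries.coeff k f - PowerSeries.coeff k f') * PowerSeries.coeff 0 g +
        PowerSeries.coeff 0 f' * (PowerSeries.coeff k g - PowerSeries.coeff k g') := by
  obtain ⟨d, rfl⟩ := exists_eq_add_X_pow_mul hf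
  obtain ⟨e, rfl⟩ := exists_eq_add_X_pow_mul hg
  set g := g' + PowerSeries.X ^ k * e with hge
  rw [← map_sub, show (f' + PowerSeries.X ^ k * d) * g - f' * g' =
    PowerSeries.X ^ k * (d * g + f' * e) by rw [hge]; ring]
  have h : ∀ f : PowerSeries C, PowerSeries.coeff k (PowerSeries.X ^ k * f) =
      PowerSeries.coeff 0 f := fun f => by
    rw [PowerSeries.coeff_X_pow_mul', if_pos le_rfl, Nat.sub_self]
  have hg' : PowerSeries.coeff k g - PowerSeries.coeff k g' = PowerSeries.coeff 0 e := by
    rw [hge, map_add, h, add_sub_cancel_left]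
  rw [hg']
  simp only [map_add, h, add_sub_cancel_left, coeff_zero_mul']

theorem coeff_succ_mul_sub_mul {C : Type*} [CommRing C] {f f' g g' : PowerSeries C} {k : ℕ}
    (hf : ∀ i < k, PowerSeries.coeff i f = PowerSeries.coeff i f')
    (hg : ∀ i < k, PowerSeries.coeff i g = PowerSeries.coeff i g') :
    PowerSeries.coeff (k + 1) (f * g) - PowerSeries.coeff (k + 1) (f' * g') =
      (PowerSeries.coeff (k + 1) f - PowerSeries.coeff (k + 1) f') * PowerSeries.coeff 0 g +
      (PowerSeries.coeff k f - PowerSeries.coeff k f') * PowerSeries.coeff 1 g +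
      PowerSeries.coeff 1 f' * (PowerSeries.coeff k g - PowerSeries.coeff k g') +
      PowerSeries.coeff 0 f' * (PowerSeries.coeff (k + 1) g - PowerSeries.coeff (k + 1) g') := by
  obtain ⟨d, rfl⟩ := exists_eq_add_X_pow_mul hf
  obtain ⟨e, rfl⟩ := exists_eq_add_X_pow_mul hg
  set g := g' + PowerSeries.X ^ k * e with hge
  rw [← map_sub, show (f' + PowerSeries.X ^ k * d) * g - f' * g' =
    PowerSeries.X ^ k * (d * g + f' * e) by rw [hge]; ring]
  have h : ∀ f : PowerSeries C, PowerSeries.coeff k (PowerSeries.X ^ k * f) =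
      PowerSeries.coeff 0 f := fun f => by
    rw [PowerSeries.coeff_X_pow_mul', if_pos le_rfl, Nat.sub_self]
  have h' : ∀ f : PowerSeries C, PowerSeries.coeff (k + 1) (PowerSeries.X ^ k * f) =
      PowerSeries.coeff 1 f := fun f => by
    rw [PowerSeries.coeff_X_pow_mul', if_pos (by omega), Nat.add_sub_cancel_left]
  have hg' : PowerSeries.coeff k g - PowerSeries.coeff k g' = PowerSeries.coeff 0 e := by
    rw [hge, map_add, h, add_sub_cancel_left]
  have hg'' : PowerSeries.coeff (k + 1) g - PowerSeries.coeff (k + 1) g' =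
      PowerSeries.coeff 1 e := by
    rw [hge, map_add, h', add_sub_cancel_left]
  rw [hg', hg'']
  simp only [map_add, h, h', coeff_one_mul', add_sub_cancel_left]
  ring

/-- The coefficients of `f(-ε, x)`. -/
def signTwist {C : Type*} [CommRing C] (f : ℕ → C) (k : ℕ) : C := (-1) ^ k * f k

theorem signTwist_signTwist {C : Type*} [CommRing C] (f : ℕ → C) :
    signTwist (signTwist f) = f := by
  ext k
  rw [signTwist, signTwist, ← mul_assoc, ← mul_pow]
  simp

section Formal

variable {C : Type*} [CommRing C] [Algebra ℂ C] (D : Module.End ℂ C)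

/-- The coefficients of `f(ε, x + σ ε)`, for the formal series with coefficients `f`. -/
def taylorShift (σ : ℂ) (f : ℕ → C) (k : ℕ) : C :=
  ∑ n ∈ Finset.range (k + 1), (σ ^ n / (n.factorial : ℂ)) • (D ^ n) (f (k - n))

/-- The series `v(ε, x) + w(ε, x + σ ε)`. -/
def pairSum (σ : ℂ) (v w : ℕ → C) : PowerSeries C :=
  PowerSeries.mk fun k => v k + taylorShift D σ w k

theorem coeff_pairSum (σ : ℂ) (v w : ℕ → C) (k : ℕ) :
    PowerSeries.coeff k (pairSum D σ v w) = v k + taylorShift D σ w k :=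
  PowerSeries.coeff_mk _ _

variable {D}

theorem taylorShift_zero (σ : ℂ) (f : ℕ → C) : taylorShift D σ f 0 = f 0 := by
  simp [taylorShift]

theorem taylorShift_sub (σ : ℂ) (f g : ℕ → C) (k : ℕ) :
    taylorShift D σ f k - taylorShift D σ g k = taylorShift D σ (f - g) k := by
  simp [taylorShift, smul_sub, Finset.sum_sub_distrib]

theorem taylorShift_eq_of_vanish {σ : ℂ} {f : ℕ → C} {k : ℕ} (hf : ∀ i < k, f i = 0) :
    ∀ j ≤ k, taylorShift D σ f j = f j := by
  intro j hj
  rw [taylorShift, Finset.sum_eq_single 0]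
  · simp
  · intro n hn hn0
    rw [Finset.mem_range] at hn
    rw [hf (j - n) (by omega), map_zero, smul_zero]
  · simp

theorem taylorShift_succ_of_vanish {σ : ℂ} {f : ℕ → C} {k : ℕ} (hf : ∀ i < k, f i = 0) :
    taylorShift D σ f (k + 1) = f (k + 1) + σ • D (f k) := by
  rw [taylorShift, Finset.sum_range_succ', Finset.sum_range_succ', Finset.sum_eq_zero]
  · simp [add_comm]
  · intro n hn
    rw [Finset.mem_range] at hn
    rw [hf _ (by omega), map_zero, smul_zero]

theorem taylorShift_sub_of_agree {σ : ℂ} {f g : ℕ → C} {k : ℕ} (h : ∀ i < k, f i = g i)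
    {j : ℕ} (hj : j ≤ k) :
    taylorShift D σ f j - taylorShift D σ g j = f j - g j := by
  rw [taylorShift_sub, taylorShift_eq_of_vanish (k := k) (fun i hi => by simp [h i hi]) j hj]
  rfl

theorem taylorShift_succ_sub_of_agree {σ : ℂ} {f g : ℕ → C} {k : ℕ} (h : ∀ i < k, f i = g i) :
    taylorShift D σ f (k + 1) - taylorShift D σ g (k + 1) =
      f (k + 1) - g (k + 1) + σ • D (f k - g k) := by
  rw [taylorShift_sub, taylorShift_succ_of_vanish (k := k) (fun i hi => by simp [h i hi])]
  rfl

theorem signTwist_taylorShift (σ : ℂ) (f : ℕ → C) :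
    signTwist (taylorShift D σ f) = taylorShift D (-σ) (signTwist f) := by
  ext k
  simp only [signTwist, taylorShift]
  rw [Finset.mul_sum]
  refine Finset.sum_congr rfl fun n hn => ?_
  rw [Finset.mem_range] at hn
  have h : ((-1) ^ (k - n) : C) * f (k - n) = ((-1 : ℂ) ^ (k - n)) • f (k - n) := by
    rw [Algebra.smul_def]; simp
  have h' : ∀ x : C, ((-1) ^ k : C) * x = ((-1 : ℂ) ^ k) • x := fun x => by
    rw [Algebra.smul_def]; simp
  rw [h, h', map_smul, smul_smul, smul_smul]
  congr 1
  have hk : (-1 : ℂ) ^ k = (-1) ^ n * (-1) ^ (k - n) := by rw [← pow_add]; congr 1; omega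
  rw [hk, neg_pow σ n]
  ring

theorem rescale_pairSum (σ : ℂ) (v w : ℕ → C) :
    PowerSeries.rescale (-1 : C) (pairSum D σ v w) =
      pairSum D (-σ) (signTwist v) (signTwist w) := by
  ext k
  rw [PowerSeries.coeff_rescale, coeff_pairSum, coeff_pairSum, ← signTwist_taylorShift, mul_add]
  rfl

/-- The two quadratic equations determine `v` and `w` from their coefficients of order `0`. -/
theorem quadratic_system_unique {a b v w v' w' : ℕ → C} {r lam β : C} (ha : a 0 = r) (hb : b 0 = r)
    (hlam : IsUnit lam) (hlam4 : IsUnit (lam - 4 * r))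
    (hv : v 0 = 1) (hw : w 0 = 1) (hv' : v' 0 = 1) (hw' : w' 0 = 1)
    (h1 : PowerSeries.mk a * pairSum D (-1) v w * pairSum D 1 v w =
      PowerSeries.C lam * (PowerSeries.mk v ^ 2 - PowerSeries.C β))
    (h2 : PowerSeries.mk b * pairSum D (-1) w v * pairSum D 1 w v =
      PowerSeries.C lam * (PowerSeries.mk w ^ 2 - PowerSeries.C β))
    (h1' : PowerSeries.mk a * pairSum D (-1) v' w' * pairSum D 1 v' w' =
      PowerSeries.C lam * (PowerSeries.mk v' ^ 2 - PowerSeries.C β))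
    (h2' : PowerSeries.mk b * pairSum D (-1) w' v' * pairSum D 1 w' v' =
      PowerSeries.C lam * (PowerSeries.mk w' ^ 2 - PowerSeries.C β)) (k : ℕ) :
    v k = v' k ∧ w k = w' k := by
  have h2u : IsUnit (2 : C) := by
    rw [← map_ofNat (algebraMap ℂ C) 2]
    exact (IsUnit.mk0 (2 : ℂ) two_ne_zero).map _
  -- The equations of order `k` compare two solutions which agree below `k`.
  have step : ∀ (c f g f' g' : ℕ → C) (k : ℕ), c 0 = r → f 0 = 1 → g 0 = 1 → f' 0 = 1 →
      g' 0 = 1 → (∀ i < k, f i = f' i) → (∀ i < k, g i = g' i) →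
      PowerSeries.mk c * pairSum D (-1) f g * pairSum D 1 f g =
        PowerSeries.C lam * (PowerSeries.mk f ^ 2 - PowerSeries.C β) →
      PowerSeries.mk c * pairSum D (-1) f' g' * pairSum D 1 f' g' =
        PowerSeries.C lam * (PowerSeries.mk f' ^ 2 - PowerSeries.C β) →
      2 * (2 * r * ((f k - f' k) + (g k - g' k))) = 2 * (lam * (f k - f' k)) := by
    intro c f g f' g' k hc hf hg hf' hg' hff hgg e e'
    have hY : ∀ σ : ℂ, ∀ i < k, PowerSeries.coeff i (pairSum D σ f g) =
        PowerSeries.coeff i (pairSum D σ f' g') := fun σ i hi => by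
      rw [coeff_pairSum, coeff_pairSum, hff i hi]
      have := taylorShift_sub_of_agree (D := D) (σ := σ) hgg hi.le
      rw [hgg i hi, sub_self, sub_eq_zero] at this
      rw [this]
    have hYk : ∀ σ : ℂ, PowerSeries.coeff k (pairSum D σ f g) -
        PowerSeries.coeff k (pairSum D σ f' g') = (f k - f' k) + (g k - g' k) := fun σ => by
      rw [coeff_pairSum, coeff_pairSum,
        ← taylorShift_sub_of_agree (D := D) (σ := σ) hgg le_rfl]
      ring
    have hc' : ∀ i < k, PowerSeries.coeff i (PowerSeries.mk c * pairSum D (-1) f g) =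
        PowerSeries.coeff i (PowerSeries.mk c * pairSum D (-1) f' g') := fun i hi => by
      rw [← sub_eq_zero, coeff_mul_sub_mul_zero (fun _ _ => rfl)
        (fun j hj => hY (-1) j (hj.trans hi)), hY (-1) i hi]
      ring
    have hl := coeff_mul_sub_mul_zero hc' (hY 1)
    rw [coeff_mul_sub_mul_zero (fun _ _ => rfl) (hY (-1)), hYk, hYk, e, e', ← map_sub,
      ← mul_sub, PowerSeries.coeff_C_mul, sub_sub_sub_cancel_right, map_sub, pow_two, pow_two,
      coeff_mul_sub_mul_zero (f := PowerSeries.mk f) (f' := PowerSeries.mk f')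
        (by simpa using hff) (by simpa using hff)] at hl
    simp only [PowerSeries.coeff_mk, coeff_pairSum, coeff_zero_mul', taylorShift_zero,
      hc, hf, hg, hf', hg'] at hl
    linear_combination -hl
  induction k using Nat.strong_induction_on with
  | _ k ih =>
  have e1 := step a v w v' w' k ha hv hw hv' hw' (fun i hi => (ih i hi).1)
    (fun i hi => (ih i hi).2) h1 h1'
  have e2 := step b w v w' v' k hb hw hv hw' hv' (fun i hi => (ih i hi).2)
    (fun i hi => (ih i hi).1) h2 h2'
  have e3 : v k - v' k = w k - w' k := by
    have : (2 * lam) * ((v k - v' k) - (w k - w' k)) = 0 := by linear_combination e2 - e1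
    exact sub_eq_zero.mp (((h2u.mul hlam).mul_right_eq_zero).mp this)
  have e4 : v k - v' k = 0 := by
    have : (2 * (lam - 4 * r)) * (v k - v' k) = 0 := by
      linear_combination -e1 - 4 * r * e3
    exact ((h2u.mul hlam4).mul_right_eq_zero).mp this
  exact ⟨sub_eq_zero.mp e4, sub_eq_zero.mp (e3 ▸ e4)⟩

/-- The symmetry `b(ε) = a(-ε)` is inherited by the solution of the quadratic system. -/
theorem eq_signTwist_of_quadratic_system {a v w : ℕ → C} {r lam β : C} (ha : a 0 = r)
    (hlam : IsUnit lam) (hlam4 : IsUnit (lam - 4 * r)) (hv : v 0 = 1) (hw : w 0 = 1)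
    (h1 : PowerSeries.mk a * pairSum D (-1) v w * pairSum D 1 v w =
      PowerSeries.C lam * (PowerSeries.mk v ^ 2 - PowerSeries.C β))
    (h2 : PowerSeries.mk (signTwist a) * pairSum D (-1) w v * pairSum D 1 w v =
      PowerSeries.C lam * (PowerSeries.mk w ^ 2 - PowerSeries.C β)) :
    w = signTwist v := by
  have hres : ∀ f : ℕ → C, PowerSeries.rescale (-1 : C) (PowerSeries.mk f) =
      PowerSeries.mk (signTwist f) := fun f => by
    ext k; rw [PowerSeries.coeff_rescale]; simp [signTwist]
  have hC : ∀ c : C, PowerSeries.rescale (-1 : C) (PowerSeries.C c) = PowerSeries.C c := by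
    intro c
    ext k
    rw [PowerSeries.coeff_rescale, PowerSeries.coeff_C]
    split_ifs with h <;> simp [h]
  have h1' := congrArg (PowerSeries.rescale (-1 : C)) h1
  have h2' := congrArg (PowerSeries.rescale (-1 : C)) h2
  simp only [map_mul, map_sub, map_pow, hres, hC, rescale_pairSum, neg_neg,
    signTwist_signTwist] at h1' h2'
  have h0 : ∀ f : ℕ → C, signTwist f 0 = f 0 := fun f => by simp [signTwist]
  ext k
  exact (quadratic_system_unique (D := D) (v' := signTwist w) (w' := signTwist v)
    ha ((h0 a).trans ha) hlam hlam4 hv hw ((h0 w).trans hw) ((h0 v).trans hv) h1 h2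
    (by rw [← h2']; ring) (by rw [← h1']; ring) k).2

end Formal

/-! ### The reduced quadratic equation -/

theorem coeff_mul_of_agree {C : Type*} [CommRing C] {f f' g g' : PowerSeries C} {k : ℕ}
    (hf : ∀ i < k, PowerSeries.coeff i f = PowerSeries.coeff i f')
    (hg : ∀ i < k, PowerSeries.coeff i g = PowerSeries.coeff i g') :
    ∀ i < k, PowerSeries.coeff i (f * g) = PowerSeries.coeff i (f' * g') := fun i hi => by
  rw [← sub_eq_zero, coeff_mul_sub_mul_zero (fun j hj => hf j (hj.trans hi))
    (fun j hj => hg j (hj.trans hi)), hf i hi, hg i hi]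
  ring

theorem coeff_X_mul_of_agree {C : Type*} [CommRing C] {f f' : PowerSeries C} {k : ℕ}
    (hf : ∀ i < k, PowerSeries.coeff i f = PowerSeries.coeff i f') :
    ∀ i ≤ k, PowerSeries.coeff i (PowerSeries.X * f) =
      PowerSeries.coeff i (PowerSeries.X * f') := fun i hi => by
  cases i with
  | zero => simp
  | succ i => rw [PowerSeries.coeff_succ_X_mul, PowerSeries.coeff_succ_X_mul, hf i hi]

/-- The coefficients of `1 + ε s γ`. -/
def ofReduced {C : Type*} [CommRing C] (s : C) (γ : ℕ → C) : ℕ → C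
  | 0 => 1
  | k + 1 => s * γ k

theorem ofReduced_agree {C : Type*} [CommRing C] {s : C} {γ γ' : ℕ → C} {k : ℕ}
    (h : ∀ i < k, γ i = γ' i) :
    ∀ i < k + 1, ofReduced s γ i = ofReduced s γ' i := fun i hi => by
  cases i with
  | zero => rfl
  | succ i => rw [ofReduced, ofReduced, h i (by omega)]

theorem signTwist_ofReduced_agree {C : Type*} [CommRing C] {s : C} {γ γ' : ℕ → C} {k : ℕ}
    (h : ∀ i < k, γ i = γ' i) :
    ∀ i < k + 1, signTwist (ofReduced s γ) i = signTwist (ofReduced s γ') i := fun i hi => by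
  rw [signTwist, signTwist, ofReduced_agree h i hi]

section Reduced

variable {C : Type*} [CommRing C] [Algebra ℂ C] (D : Module.End ℂ C)

/-- For `v = 1 + ε s γ`, the series `v(ε, x) + v(-ε, x + σ ε)`, where the second summand is the
shift of the series `v(-ε, x)`. -/
def symPair (σ : ℂ) (s : C) (γ : ℕ → C) : PowerSeries C :=
  pairSum D σ (ofReduced s γ) (signTwist (ofReduced s γ))

/-- The defect of the quadratic equation for a symmetric solution `v = 1 + ε s γ`, `s = 1 / l`,
divided by the square of the leading coefficient. -/
def quadDefect (a : ℕ → C) (s : C) (γ : ℕ → C) : PowerSeries C :=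
  PowerSeries.mk a * symPair D (-1) s γ * symPair D 1 s γ -
    (PowerSeries.C (4 * a 0) + PowerSeries.X * (2 * PowerSeries.mk γ) +
      PowerSeries.X * (PowerSeries.X * (PowerSeries.C s * (PowerSeries.mk γ * PowerSeries.mk γ))))

variable {D}

theorem quadDefect_eq_zero {a v : ℕ → C} {lam s β : C} (hs : lam * s = 1) (hv : v 0 = 1)
    (hβ : lam * β = lam - 4 * a 0)
    (h : PowerSeries.mk a * pairSum D (-1) v (signTwist v) * pairSum D 1 v (signTwist v) =
      PowerSeries.C lam * (PowerSeries.mk v ^ 2 - PowerSeries.C β)) :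
    quadDefect D a s (fun k => lam * v (k + 1)) = 0 := by
  have hof : ofReduced s (fun k => lam * v (k + 1)) = v := by
    ext k
    cases k with
    | zero => exact hv.symm
    | succ k => rw [ofReduced, ← mul_assoc, mul_comm s, hs, one_mul]
  have hmk : PowerSeries.mk v = 1 + PowerSeries.X * (PowerSeries.C s *
      PowerSeries.mk (fun k => lam * v (k + 1))) := by
    ext k
    cases k with
    | zero => simp [hv]
    | succ k =>
      rw [map_add, PowerSeries.coeff_succ_X_mul, PowerSeries.coeff_C_mul, PowerSeries.coeff_mk,
        PowerSeries.coeff_mk, PowerSeries.coeff_one, if_neg (by omega), ← mul_assoc, mul_comm s, hs]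
      ring
  have hCs : PowerSeries.C lam * PowerSeries.C s = 1 := by rw [← map_mul, hs, map_one]
  have hCβ : PowerSeries.C lam * PowerSeries.C β = PowerSeries.C lam - PowerSeries.C (4 * a 0) := by
    rw [← map_mul, hβ, map_sub]
  rw [quadDefect, symPair, symPair, hof, h, hmk]
  generalize PowerSeries.mk (fun k => lam * v (k + 1)) = g
  linear_combination (2 * PowerSeries.X * g + PowerSeries.X ^ 2 * g ^ 2 * PowerSeries.C s) * hCs
    - hCβ

theorem coeff_zero_symPair (σ : ℂ) (s : C) (γ : ℕ → C) :
    PowerSeries.coeff 0 (symPair D σ s γ) = 2 := by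
  rw [symPair, coeff_pairSum, taylorShift_zero, signTwist, ofReduced]; norm_num

theorem coeff_one_symPair (hD : D 1 = 0) (σ : ℂ) (s : C) (γ : ℕ → C) :
    PowerSeries.coeff 1 (symPair D σ s γ) = 0 := by
  rw [symPair, coeff_pairSum, taylorShift, Finset.sum_range_succ, Finset.sum_range_one]
  simp [signTwist, ofReduced, hD]

theorem symPair_agree {s : C} {γ γ' : ℕ → C} {k : ℕ} (h : ∀ i < k, γ i = γ' i) (σ : ℂ) :
    ∀ i < k + 1, PowerSeries.coeff i (symPair D σ s γ) =
      PowerSeries.coeff i (symPair D σ s γ') := fun i hi => by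
  have h1 := taylorShift_sub_of_agree (D := D) (σ := σ)
    (signTwist_ofReduced_agree (s := s) h) hi.le
  rw [signTwist_ofReduced_agree h i hi, sub_self, sub_eq_zero] at h1
  rw [symPair, symPair, coeff_pairSum, coeff_pairSum, ofReduced_agree h i hi, h1]

theorem symPair_sub {s : C} {γ γ' : ℕ → C} {k : ℕ} (h : ∀ i < k, γ i = γ' i) (σ : ℂ) :
    PowerSeries.coeff (k + 1) (symPair D σ s γ) - PowerSeries.coeff (k + 1) (symPair D σ s γ') =
      (1 + (-1) ^ (k + 1)) * (s * (γ k - γ' k)) := by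
  have h1 := taylorShift_sub_of_agree (D := D) (σ := σ)
    (signTwist_ofReduced_agree (s := s) h) le_rfl
  simp only [signTwist, ofReduced] at h1
  rw [symPair, symPair, coeff_pairSum, coeff_pairSum]
  simp only [ofReduced]
  linear_combination h1

theorem symPair_succ_sub {s : C} {γ γ' : ℕ → C} {k : ℕ} (hk : Odd k) (h : ∀ i < k, γ i = γ' i)
    (σ : ℂ) :
    PowerSeries.coeff (k + 2) (symPair D σ s γ) - PowerSeries.coeff (k + 2) (symPair D σ s γ') =
      σ • D (s * (γ k - γ' k)) := by
  have h1 := taylorShift_succ_sub_of_agree (D := D) (σ := σ)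
    (signTwist_ofReduced_agree (s := s) h)
  have e1 : (-1 : C) ^ (k + 1) = 1 := hk.add_one.neg_one_pow
  have e2 : (-1 : C) ^ (k + 1 + 1) = -1 := by rw [pow_succ, e1, one_mul]
  simp only [signTwist, ofReduced, e1, e2, one_mul, ← mul_sub] at h1
  rw [symPair, symPair, coeff_pairSum, coeff_pairSum]
  simp only [ofReduced]
  linear_combination h1

theorem coeff_quadDefect_agree {a : ℕ → C} {s : C} {γ γ' : ℕ → C} {k : ℕ}
    (h : ∀ i < k, γ i = γ' i) :
    ∀ j ≤ k, PowerSeries.coeff j (quadDefect D a s γ) =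
      PowerSeries.coeff j (quadDefect D a s γ') := fun j hj => by
  have hγ : ∀ i < k, PowerSeries.coeff i (PowerSeries.mk γ) =
      PowerSeries.coeff i (PowerSeries.mk γ') := by simpa using h
  rw [quadDefect, quadDefect, map_sub, map_sub, map_add, map_add, map_add, map_add]
  rw [coeff_mul_of_agree (coeff_mul_of_agree (fun _ _ => rfl) (symPair_agree h (-1)))
    (symPair_agree h 1) j (by omega),
    coeff_X_mul_of_agree (coeff_mul_of_agree (fun _ _ => rfl) hγ) j hj,
    coeff_X_mul_of_agree (fun i hi => coeff_X_mul_of_agree (coeff_mul_of_agree (fun _ _ => rfl)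
      (coeff_mul_of_agree hγ hγ)) i hi.le) j hj]

/-- How the equation of order `k + 1` depends on `γ k`. -/
theorem coeff_quadDefect_sub {a : ℕ → C} {s : C} {γ γ' : ℕ → C} {k : ℕ}
    (h : ∀ i < k, γ i = γ' i) :
    PowerSeries.coeff (k + 1) (quadDefect D a s γ) -
        PowerSeries.coeff (k + 1) (quadDefect D a s γ') =
      (4 * a 0 * (1 + (-1) ^ (k + 1)) * s - 2) * (γ k - γ' k) := by
  have hγ : ∀ i < k, PowerSeries.coeff i (PowerSeries.mk γ) =
      PowerSeries.coeff i (PowerSeries.mk γ') := by simpa using h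
  have h2 : (2 : PowerSeries C) = PowerSeries.C 2 := (map_ofNat PowerSeries.C 2).symm
  have hG := coeff_mul_sub_mul_zero (coeff_mul_of_agree (fun _ _ => rfl) (symPair_agree h (-1)))
    (symPair_agree h 1) (f := PowerSeries.mk a * symPair D (-1) s γ)
    (f' := PowerSeries.mk a * symPair D (-1) s γ') (g := symPair D 1 s γ)
    (g' := symPair D 1 s γ')
  rw [coeff_mul_sub_mul_zero (fun _ _ => rfl) (symPair_agree h (-1)), symPair_sub h,
    symPair_sub h, coeff_zero_mul', coeff_zero_symPair, coeff_zero_symPair, coeff_zero_symPair,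
    PowerSeries.coeff_mk, PowerSeries.coeff_mk, sub_self] at hG
  have hQ := coeff_X_mul_of_agree (coeff_mul_of_agree (f := PowerSeries.C s) (fun _ _ => rfl)
    (coeff_mul_of_agree hγ hγ)) k le_rfl
  simp only [quadDefect, map_sub, map_add, h2, PowerSeries.coeff_succ_X_mul,
    PowerSeries.coeff_C_mul, PowerSeries.coeff_mk] at hG hQ ⊢
  linear_combination hG - hQ

/-- How the equation of order `k + 2`, for odd `k`, depends on `γ k` and `γ (k + 1)`: the
contributions of the derivative of `γ k` from the two shifts cancel. -/
theorem coeff_quadDefect_succ_sub {a : ℕ → C} {s : C} {γ γ' : ℕ → C} {k : ℕ} (hD : D 1 = 0)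
    (hk : Odd k) (h : ∀ i < k, γ i = γ' i) :
    PowerSeries.coeff (k + 2) (quadDefect D a s γ) -
        PowerSeries.coeff (k + 2) (quadDefect D a s γ') =
      8 * a 1 * s * (γ k - γ' k) - 2 * (γ (k + 1) - γ' (k + 1)) -
        2 * s * γ 0 * (γ k - γ' k) := by
  have hγ : ∀ i < k, PowerSeries.coeff i (PowerSeries.mk γ) =
      PowerSeries.coeff i (PowerSeries.mk γ') := by simpa using h
  have h2 : (2 : PowerSeries C) = PowerSeries.C 2 := (map_ofNat PowerSeries.C 2).symm
  have e1 : (-1 : C) ^ (k + 1) = 1 := hk.add_one.neg_one_pow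
  have hA := coeff_mul_of_agree (f := PowerSeries.mk a) (fun _ _ => rfl)
    (symPair_agree (D := D) (s := s) h (-1))
  have hG := coeff_succ_mul_sub_mul hA (symPair_agree (D := D) (s := s) h 1)
  rw [coeff_succ_mul_sub_mul (fun _ _ => rfl) (symPair_agree h (-1)),
    coeff_mul_sub_mul_zero (fun _ _ => rfl) (symPair_agree h (-1)), symPair_sub h,
    symPair_sub h, symPair_succ_sub hk h, symPair_succ_sub hk h, coeff_zero_mul',
    coeff_one_mul', e1] at hG
  simp only [coeff_zero_symPair, coeff_one_symPair hD, PowerSeries.coeff_mk, sub_self] at hG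
  have hQ := coeff_mul_sub_mul_zero hγ hγ
  have h0 : γ 0 = γ' 0 := h 0 hk.pos
  simp only [PowerSeries.coeff_mk, ← h0] at hQ
  simp only [quadDefect, map_sub, map_add, h2, PowerSeries.coeff_succ_X_mul,
    PowerSeries.coeff_C_mul, PowerSeries.coeff_mk, PowerSeries.coeff_succ_C] at hG hQ ⊢
  rw [neg_smul, one_smul] at hG
  linear_combination hG - s * hQ

theorem coeff_zero_quadDefect (a : ℕ → C) (s : C) (γ : ℕ → C) :
    PowerSeries.coeff 0 (quadDefect D a s γ) = 0 := by
  simp only [quadDefect, map_sub, map_add, coeff_zero_mul', coeff_zero_symPair,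
    PowerSeries.coeff_zero_C, PowerSeries.coeff_zero_X, PowerSeries.coeff_mk]
  ring

theorem coeff_one_quadDefect (hD : D 1 = 0) (a : ℕ → C) (s : C) (γ : ℕ → C) :
    PowerSeries.coeff 1 (quadDefect D a s γ) = 4 * a 1 - 2 * γ 0 := by
  have h2 : (2 : PowerSeries C) = PowerSeries.C 2 := (map_ofNat PowerSeries.C 2).symm
  simp only [quadDefect, map_sub, map_add, coeff_one_mul', coeff_zero_mul', coeff_zero_symPair,
    coeff_one_symPair hD, PowerSeries.coeff_zero_X, PowerSeries.coeff_one_X, PowerSeries.coeff_mk,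
    h2, PowerSeries.coeff_C, if_neg one_ne_zero, if_true]
  ring

end Reduced

theorem map_quadDefect {C C' : Type*} [CommRing C] [Algebra ℂ C] [CommRing C'] [Algebra ℂ C']
    {D : Module.End ℂ C} {D' : Module.End ℂ C'} (φ : C →ₐ[ℂ] C') (hφ : ∀ c, φ (D c) = D' (φ c))
    (a : ℕ → C) (s : C) (γ : ℕ → C) :
    PowerSeries.map (φ : C →+* C') (quadDefect D a s γ) =
      quadDefect D' (fun k => φ (a k)) (φ s) (fun k => φ (γ k)) := by
  have hmk : ∀ f : ℕ → C, PowerSeries.map (φ : C →+* C') (PowerSeries.mk f) =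
      PowerSeries.mk fun k => φ (f k) := fun f => by ext k; simp
  have hpow : ∀ n c, φ ((D ^ n) c) = (D' ^ n) (φ c) := fun n => by
    induction n with
    | zero => simp
    | succ n ih => intro c; rw [pow_succ, pow_succ, Module.End.mul_apply, Module.End.mul_apply,
        ih, hφ]
  have hof : ∀ k, φ (ofReduced s γ k) = ofReduced (φ s) (fun k => φ (γ k)) k := fun k => by
    cases k <;> simp [ofReduced]
  have hsym : ∀ σ, PowerSeries.map (φ : C →+* C') (symPair D σ s γ) =
      symPair D' σ (φ s) (fun k => φ (γ k)) := fun σ => by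
    ext k
    rw [PowerSeries.coeff_map, symPair, symPair, coeff_pairSum, coeff_pairSum]
    simp only [RingHom.coe_coe, map_add, hof, taylorShift, map_sum, map_smul, hpow, signTwist,
      map_mul, map_pow, map_neg, map_one]
  simp only [quadDefect, map_sub, map_mul, map_add, hmk, hsym, PowerSeries.map_C,
    PowerSeries.map_X, map_ofNat, RingHom.coe_coe]

/-! ### Polynomials in `1 / l` and their leading symbols -/

section PolyD

variable {A : Type*} [CommRing A] [Algebra ℂ A]

/-- The coefficientwise extension of a linear map to polynomials. -/
def polyD (D : Module.End ℂ A) : Module.End ℂ (Polynomial A) :=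
  have key : ∀ (p : Polynomial A) (i : ℕ),
      (p.sum fun n a => Polynomial.monomial n (D a)).coeff i = D (p.coeff i) := fun p i => by
    rw [Polynomial.sum_def, Polynomial.finsetSum_coeff]
    simp only [Polynomial.coeff_monomial]
    rw [Finset.sum_ite_eq' p.support i]
    split_ifs with h
    · rfl
    · rw [Polynomial.notMem_support_iff.mp h, map_zero]
  { toFun := fun p => p.sum fun n a => Polynomial.monomial n (D a)
    map_add' := fun p q => by ext i; simp only [Polynomial.coeff_add, key, map_add]
    map_smul' := fun c p => by
      ext i; simp only [Polynomial.coeff_smul, key, map_smul, RingHom.id_apply] }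

theorem coeff_polyD (D : Module.End ℂ A) (p : Polynomial A) (i : ℕ) :
    (polyD D p).coeff i = D (p.coeff i) := by
  simp only [polyD, LinearMap.coe_mk, AddHom.coe_mk]
  rw [Polynomial.sum_def, Polynomial.finsetSum_coeff]
  simp only [Polynomial.coeff_monomial]
  rw [Finset.sum_ite_eq' p.support i]
  split_ifs with h
  · rfl
  · rw [Polynomial.notMem_support_iff.mp h, map_zero]

theorem coeff_polyD_pow (D : Module.End ℂ A) (n : ℕ) (p : Polynomial A) (i : ℕ) :
    ((polyD D ^ n) p).coeff i = (D ^ n) (p.coeff i) := by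
  induction n generalizing p with
  | zero => simp
  | succ n ih => rw [pow_succ, pow_succ, Module.End.mul_apply, Module.End.mul_apply, ih,
      coeff_polyD]

theorem polyD_monomial (D : Module.End ℂ A) (n : ℕ) (a : A) :
    polyD D (Polynomial.monomial n a) = Polynomial.monomial n (D a) := by
  ext i
  rw [coeff_polyD, Polynomial.coeff_monomial, Polynomial.coeff_monomial]
  split_ifs <;> simp

variable (A) in
/-- Evaluation of a polynomial in `s = 1 / l` at a constant. -/
def evalConst (s : ℂ) : Polynomial A →ₐ[ℂ] A :=
  (Polynomial.aeval (R := A) (algebraMap ℂ A s)).restrictScalars ℂ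

theorem evalConst_C (s : ℂ) (a : A) : evalConst A s (Polynomial.C a) = a :=
  Polynomial.aeval_C _ _

theorem evalConst_X (s : ℂ) : evalConst A s Polynomial.X = algebraMap ℂ A s :=
  Polynomial.aeval_X _

theorem evalConst_monomial (s : ℂ) (n : ℕ) (a : A) :
    evalConst A s (Polynomial.monomial n a) = s ^ n • a := by
  rw [← Polynomial.C_mul_X_pow_eq_monomial, map_mul, map_pow, evalConst_C, evalConst_X, ← map_pow,
    Algebra.smul_def, mul_comm]

theorem evalConst_polyD (D : Module.End ℂ A) (s : ℂ) (p : Polynomial A) :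
    evalConst A s (polyD D p) = D (evalConst A s p) := by
  induction p using Polynomial.induction_on' with
  | add p q hp hq => simp only [map_add, hp, hq]
  | monomial n a => rw [polyD_monomial, evalConst_monomial, evalConst_monomial, map_smul]

theorem evalConst_eq_sum (s : ℂ) {p : Polynomial A} {n : ℕ} (hp : p.natDegree ≤ n) :
    evalConst A s p = ∑ i ∈ Finset.range (n + 1), s ^ i • p.coeff i := by
  conv_lhs => rw [p.as_sum_range' (n + 1) (by omega)]
  simp only [map_sum, evalConst_monomial]

end PolyD

section Symbols

variable {A : Type*} [CommRing A]

/-- The series in `ε` whose coefficient of order `k` is a polynomial in `1 / l` of degree at most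
`k / 2`, i.e. those that are regular for `ε → 0` with `ε² / l` fixed. -/
def IsFiltered (f : PowerSeries (Polynomial A)) : Prop :=
  ∀ k, (PowerSeries.coeff k f).natDegree ≤ k / 2

/-- The term of order `0` of a filtered series, as a series in `z = ε² / l`. -/
def evenSymbol (f : PowerSeries (Polynomial A)) : PowerSeries A :=
  PowerSeries.mk fun n => (PowerSeries.coeff (2 * n) f).coeff n

/-- The term of order `1` of a filtered series, as a series in `z = ε² / l`. -/
def oddSymbol (f : PowerSeries (Polynomial A)) : PowerSeries A :=
  PowerSeries.mk fun n => (PowerSeries.coeff (2 * n + 1) f).coeff n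

theorem evenSymbol_add (f g : PowerSeries (Polynomial A)) :
    evenSymbol (f + g) = evenSymbol f + evenSymbol g := by
  ext n; simp [evenSymbol]

theorem evenSymbol_sub (f g : PowerSeries (Polynomial A)) :
    evenSymbol (f - g) = evenSymbol f - evenSymbol g := by
  ext n; simp [evenSymbol]

theorem oddSymbol_add (f g : PowerSeries (Polynomial A)) :
    oddSymbol (f + g) = oddSymbol f + oddSymbol g := by
  ext n; simp [oddSymbol]

theorem oddSymbol_sub (f g : PowerSeries (Polynomial A)) :
    oddSymbol (f - g) = oddSymbol f - oddSymbol g := by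
  ext n; simp [oddSymbol]

theorem IsFiltered.add {f g : PowerSeries (Polynomial A)} (hf : IsFiltered f)
    (hg : IsFiltered g) : IsFiltered (f + g) := fun k => by
  rw [map_add]; exact Polynomial.natDegree_add_le_of_degree_le (hf k) (hg k)

theorem IsFiltered.sub {f g : PowerSeries (Polynomial A)} (hf : IsFiltered f)
    (hg : IsFiltered g) : IsFiltered (f - g) := fun k => by
  rw [map_sub]; exact (Polynomial.natDegree_sub_le_of_le (hf k) (hg k)).trans (max_self _).le

theorem IsFiltered.mul {f g : PowerSeries (Polynomial A)} (hf : IsFiltered f)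
    (hg : IsFiltered g) : IsFiltered (f * g) := fun k => by
  rw [PowerSeries.coeff_mul]
  refine Polynomial.natDegree_sum_le_of_forall_le _ _ fun p hp => ?_
  rw [Finset.HasAntidiagonal.mem_antidiagonal] at hp
  exact (Polynomial.natDegree_mul_le_of_le (hf p.1) (hg p.2)).trans (by omega)

theorem sum_range_odd {M : Type*} [AddCommMonoid M] (F : ℕ → M) (n : ℕ) :
    ∑ i ∈ Finset.range (2 * n + 1), F i =
      ∑ i ∈ Finset.range (n + 1), F (2 * i) + ∑ i ∈ Finset.range n, F (2 * i + 1) := by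
  induction n with
  | zero => simp
  | succ n ih =>
    rw [show 2 * (n + 1) + 1 = 2 * n + 1 + 1 + 1 by ring, Finset.sum_range_succ,
      Finset.sum_range_succ, ih, Finset.sum_range_succ (fun i => F (2 * i)) (n + 1),
      Finset.sum_range_succ (fun i => F (2 * i + 1)) n, show 2 * (n + 1) = 2 * n + 1 + 1 by ring]
    abel

theorem IsFiltered.evenSymbol_mul {f g : PowerSeries (Polynomial A)} (hf : IsFiltered f)
    (hg : IsFiltered g) : evenSymbol (f * g) = evenSymbol f * evenSymbol g := by
  ext n
  rw [evenSymbol, PowerSeries.coeff_mk, PowerSeries.coeff_mul, PowerSeries.coeff_mul,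
    Finset.Nat.sum_antidiagonal_eq_sum_range_succ_mk,
    Finset.Nat.sum_antidiagonal_eq_sum_range_succ_mk, sum_range_odd, Polynomial.coeff_add,
    Polynomial.finsetSum_coeff, Polynomial.finsetSum_coeff]
  -- The products of two coefficients of odd order have degree less than `n`.
  rw [Finset.sum_eq_zero (s := Finset.range n), add_zero]
  · refine Finset.sum_congr rfl fun i hi => ?_
    rw [Finset.mem_range] at hi
    simp only [evenSymbol, PowerSeries.coeff_mk]
    obtain ⟨j, rfl⟩ := Nat.exists_eq_add_of_le (Nat.lt_succ_iff.mp hi)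
    rw [show 2 * (i + j) - 2 * i = 2 * j by omega, Nat.add_sub_cancel_left]
    exact Polynomial.coeff_mul_add_eq_of_natDegree_le ((hf _).trans (by omega))
      ((hg _).trans (by omega))
  · intro i hi
    rw [Finset.mem_range] at hi
    refine Polynomial.coeff_eq_zero_of_natDegree_lt
      ((Polynomial.natDegree_mul_le_of_le (hf _) (hg _)).trans_lt ?_)
    omega

theorem IsFiltered.oddSymbol_mul {f g : PowerSeries (Polynomial A)} (hf : IsFiltered f)
    (hg : IsFiltered g) :
    oddSymbol (f * g) = evenSymbol f * oddSymbol g + oddSymbol f * evenSymbol g := by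
  ext n
  rw [oddSymbol, PowerSeries.coeff_mk, map_add, PowerSeries.coeff_mul, PowerSeries.coeff_mul,
    PowerSeries.coeff_mul, Finset.Nat.sum_antidiagonal_eq_sum_range_succ_mk,
    Finset.Nat.sum_antidiagonal_eq_sum_range_succ_mk,
    Finset.Nat.sum_antidiagonal_eq_sum_range_succ_mk, Finset.sum_range_succ, sum_range_odd,
    add_assoc, ← Finset.sum_range_succ (fun i => PowerSeries.coeff (2 * i + 1) f *
      PowerSeries.coeff (2 * n + 1 - (2 * i + 1)) g) n, Polynomial.coeff_add,
    Polynomial.finsetSum_coeff, Polynomial.finsetSum_coeff]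
  congr 1
  all_goals
    refine Finset.sum_congr rfl fun i hi => ?_
    rw [Finset.mem_range] at hi
    simp only [evenSymbol, oddSymbol, PowerSeries.coeff_mk]
    obtain ⟨j, rfl⟩ := Nat.exists_eq_add_of_le (Nat.lt_succ_iff.mp hi)
  · rw [show 2 * (i + j) + 1 - 2 * i = 2 * j + 1 by omega, Nat.add_sub_cancel_left]
    exact Polynomial.coeff_mul_add_eq_of_natDegree_le ((hf _).trans (by omega))
      ((hg _).trans (by omega))
  · rw [show 2 * (i + j) + 1 - (2 * i + 1) = 2 * j by omega, Nat.add_sub_cancel_left]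
    exact Polynomial.coeff_mul_add_eq_of_natDegree_le ((hf _).trans (by omega))
      ((hg _).trans (by omega))

theorem IsFiltered.X_mul {f : PowerSeries (Polynomial A)} (hf : IsFiltered f) :
    IsFiltered (PowerSeries.X * f) := fun k => by
  cases k with
  | zero => simp
  | succ k => rw [PowerSeries.coeff_succ_X_mul]; exact (hf k).trans (by omega)

theorem IsFiltered.evenSymbol_X_mul {f : PowerSeries (Polynomial A)} (hf : IsFiltered f) :
    evenSymbol (PowerSeries.X * f) = 0 := by
  ext n
  rw [evenSymbol, PowerSeries.coeff_mk, map_zero]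
  cases n with
  | zero => simp
  | succ n =>
    rw [show 2 * (n + 1) = 2 * n + 1 + 1 by ring, PowerSeries.coeff_succ_X_mul]
    exact Polynomial.coeff_eq_zero_of_natDegree_lt ((hf _).trans_lt (by omega))

theorem oddSymbol_X_mul (f : PowerSeries (Polynomial A)) :
    oddSymbol (PowerSeries.X * f) = evenSymbol f := by
  ext n
  rw [oddSymbol, evenSymbol, PowerSeries.coeff_mk, PowerSeries.coeff_mk,
    PowerSeries.coeff_succ_X_mul]

/-- Multiplication by `ε² / l`. -/
theorem IsFiltered.X_sq_mul {f : PowerSeries (Polynomial A)} (hf : IsFiltered f) :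
    IsFiltered (PowerSeries.X * (PowerSeries.X * (PowerSeries.C Polynomial.X * f))) := fun k => by
  rcases k with _ | _ | k
  · simp
  · rw [PowerSeries.coeff_succ_X_mul]; simp
  · rw [PowerSeries.coeff_succ_X_mul, PowerSeries.coeff_succ_X_mul, PowerSeries.coeff_C_mul]
    exact (Polynomial.natDegree_mul_le_of_le Polynomial.natDegree_X_le (hf k)).trans (by omega)

theorem evenSymbol_X_sq_mul (f : PowerSeries (Polynomial A)) :
    evenSymbol (PowerSeries.X * (PowerSeries.X * (PowerSeries.C Polynomial.X * f))) =
      PowerSeries.X * evenSymbol f := by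
  ext n
  rw [evenSymbol, PowerSeries.coeff_mk]
  cases n with
  | zero => simp
  | succ n =>
    rw [show 2 * (n + 1) = 2 * n + 1 + 1 by ring, PowerSeries.coeff_succ_X_mul,
      PowerSeries.coeff_succ_X_mul, PowerSeries.coeff_C_mul, PowerSeries.coeff_succ_X_mul,
      Polynomial.coeff_X_mul, evenSymbol, PowerSeries.coeff_mk]

theorem oddSymbol_X_sq_mul (f : PowerSeries (Polynomial A)) :
    oddSymbol (PowerSeries.X * (PowerSeries.X * (PowerSeries.C Polynomial.X * f))) =
      PowerSeries.X * oddSymbol f := by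
  ext n
  rw [oddSymbol, PowerSeries.coeff_mk]
  cases n with
  | zero => rw [PowerSeries.coeff_succ_X_mul]; simp
  | succ n =>
    rw [show 2 * (n + 1) + 1 = 2 * n + 1 + 1 + 1 by ring, PowerSeries.coeff_succ_X_mul,
      PowerSeries.coeff_succ_X_mul, PowerSeries.coeff_C_mul, PowerSeries.coeff_succ_X_mul,
      Polynomial.coeff_X_mul, oddSymbol, PowerSeries.coeff_mk]

theorem isFiltered_mk_C (a : ℕ → A) :
    IsFiltered (PowerSeries.mk fun k => Polynomial.C (a k)) := fun k => by simp

theorem evenSymbol_mk_C (a : ℕ → A) :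
    evenSymbol (PowerSeries.mk fun k => Polynomial.C (a k)) = PowerSeries.C (a 0) := by
  ext n
  cases n with
  | zero => simp [evenSymbol]
  | succ n => simp [evenSymbol, PowerSeries.coeff_succ_C]

theorem oddSymbol_mk_C (a : ℕ → A) :
    oddSymbol (PowerSeries.mk fun k => Polynomial.C (a k)) = PowerSeries.C (a 1) := by
  ext n
  cases n with
  | zero => simp [oddSymbol]
  | succ n => simp [oddSymbol, PowerSeries.coeff_succ_C]

theorem isFiltered_mk {p : ℕ → Polynomial A} (hp : ∀ k, (p k).natDegree ≤ k / 2) :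
    IsFiltered (PowerSeries.mk p) := fun k => by rw [PowerSeries.coeff_mk]; exact hp k

theorem isFiltered_C_C (c : A) :
    IsFiltered (PowerSeries.C (Polynomial.C c)) := fun k => by
  rw [PowerSeries.coeff_C]; split_ifs <;> simp

theorem evenSymbol_C_C (c : A) :
    evenSymbol (PowerSeries.C (Polynomial.C c)) = PowerSeries.C c := by
  ext n
  cases n with
  | zero => simp [evenSymbol]
  | succ n => simp [evenSymbol, PowerSeries.coeff_C]

theorem oddSymbol_C_C (c : A) : oddSymbol (PowerSeries.C (Polynomial.C c)) = 0 := by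
  ext n
  simp [oddSymbol, PowerSeries.coeff_succ_C]

theorem natDegree_ofReduced_le {p : ℕ → Polynomial A} (hp : ∀ k, (p k).natDegree ≤ k / 2)
    (k : ℕ) : (ofReduced Polynomial.X p k).natDegree ≤ (k + 1) / 2 := by
  cases k with
  | zero => simp [ofReduced]
  | succ k =>
    rw [ofReduced]
    exact (Polynomial.natDegree_mul_le_of_le Polynomial.natDegree_X_le (hp k)).trans (by omega)

theorem coeff_ofReduced_even (p : ℕ → Polynomial A) (n : ℕ) :
    (ofReduced Polynomial.X p (2 * n)).coeff n =
      PowerSeries.coeff n (1 + PowerSeries.X * oddSymbol (PowerSeries.mk p)) := by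
  cases n with
  | zero => simp [ofReduced]
  | succ n =>
    rw [show 2 * (n + 1) = 2 * n + 1 + 1 by ring, ofReduced, Polynomial.coeff_X_mul, map_add,
      PowerSeries.coeff_succ_X_mul, PowerSeries.coeff_one, if_neg (by omega), zero_add, oddSymbol,
      PowerSeries.coeff_mk, PowerSeries.coeff_mk]

theorem coeff_ofReduced_odd (p : ℕ → Polynomial A) (n : ℕ) :
    (ofReduced Polynomial.X p (2 * n + 1)).coeff (n + 1) =
      PowerSeries.coeff n (evenSymbol (PowerSeries.mk p)) := by
  rw [ofReduced, Polynomial.coeff_X_mul, evenSymbol, PowerSeries.coeff_mk, PowerSeries.coeff_mk]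

variable [Algebra ℂ A] (D : Derivation ℂ A A)

theorem coeff_coeff_symPair (σ : ℂ) (p : ℕ → Polynomial A) (k i : ℕ) :
    (PowerSeries.coeff k (symPair (polyD (D : Module.End ℂ A)) σ Polynomial.X p)).coeff i =
      (1 + (-1) ^ k) * (ofReduced Polynomial.X p k).coeff i +
        ∑ n ∈ Finset.range k, (σ ^ (n + 1) / ((n + 1).factorial : ℂ)) •
          ((D : Module.End ℂ A) ^ (n + 1))
            ((-1) ^ (k - (n + 1)) * (ofReduced Polynomial.X p (k - (n + 1))).coeff i) := by
  have hneg : ∀ (j : ℕ) (q : Polynomial A), ((-1) ^ j * q).coeff i = (-1) ^ j * q.coeff i :=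
    fun j q => by
      rw [show ((-1) ^ j : Polynomial A) = Polynomial.C ((-1) ^ j) by simp, Polynomial.coeff_C_mul]
  rw [symPair, coeff_pairSum, taylorShift, Finset.sum_range_succ', Polynomial.coeff_add,
    Polynomial.coeff_add, Polynomial.finsetSum_coeff]
  simp only [Polynomial.coeff_smul, coeff_polyD_pow, signTwist, hneg]
  simp only [pow_zero, Nat.factorial_zero, Nat.cast_one, div_one, one_smul, Module.End.one_apply,
    Nat.sub_zero]
  ring

variable {D}

theorem isFiltered_symPair {p : ℕ → Polynomial A} (hp : ∀ k, (p k).natDegree ≤ k / 2) (σ : ℂ) :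
    IsFiltered (symPair (polyD (D : Module.End ℂ A)) σ Polynomial.X p) := fun k => by
  rw [Polynomial.natDegree_le_iff_coeff_eq_zero]
  intro i hi
  have hv : ∀ j, (j + 1) / 2 < i → (ofReduced Polynomial.X p j).coeff i = 0 := fun j hj =>
    Polynomial.coeff_eq_zero_of_natDegree_lt ((natDegree_ofReduced_le hp j).trans_lt hj)
  rw [coeff_coeff_symPair, Finset.sum_eq_zero, add_zero]
  · rcases Nat.even_or_odd k with hk | hk
    · obtain ⟨j, rfl⟩ := hk
      rw [hv _ (by omega), mul_zero]
    · rw [hk.neg_one_pow]; ring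
  · intro n hn
    rw [Finset.mem_range] at hn
    rw [hv _ (by omega), mul_zero, map_zero, smul_zero]

/-- At `ε → 0` with `z = ε² / l` fixed the odd coefficients of `v` have size `1 / ε`, so that the
first Taylor term of the shift enters at order `0`, and the second one at order `1`. -/
theorem evenSymbol_symPair {p : ℕ → Polynomial A} (hp : ∀ k, (p k).natDegree ≤ k / 2) (σ : ℂ) :
    evenSymbol (symPair (polyD (D : Module.End ℂ A)) σ Polynomial.X p) =
      2 * (1 + PowerSeries.X * oddSymbol (PowerSeries.mk p)) -
        σ • (PowerSeries.X * coeffD D (evenSymbol (PowerSeries.mk p))) := by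
  have hv : ∀ i j, (j + 1) / 2 < i → (ofReduced Polynomial.X p j).coeff i = 0 := fun i j hj =>
    Polynomial.coeff_eq_zero_of_natDegree_lt ((natDegree_ofReduced_le hp j).trans_lt hj)
  have h2 : (2 : PowerSeries A) = PowerSeries.C 2 := (map_ofNat PowerSeries.C 2).symm
  ext n
  rw [evenSymbol, PowerSeries.coeff_mk, coeff_coeff_symPair, coeff_ofReduced_even, map_sub, h2,
    PowerSeries.coeff_C_mul, (even_two_mul n).neg_one_pow, PowerSeries.coeff_smul]
  cases n with
  | zero => simp; norm_num
  | succ n =>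
    rw [show 2 * (n + 1) = 2 * n + 1 + 1 by ring, Finset.sum_range_succ', Finset.sum_eq_zero,
      PowerSeries.coeff_succ_X_mul, coeff_coeffD]
    · rw [show 2 * n + 1 + 1 - (0 + 1) = 2 * n + 1 by omega, coeff_ofReduced_odd,
        Odd.neg_one_pow ⟨n, rfl⟩]
      simp
      norm_num
      ring
    · intro j hj
      rw [Finset.mem_range] at hj
      rw [hv _ _ (by omega), mul_zero, map_zero, smul_zero]

theorem oddSymbol_symPair {p : ℕ → Polynomial A} (hp : ∀ k, (p k).natDegree ≤ k / 2) (σ : ℂ) :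
    oddSymbol (symPair (polyD (D : Module.End ℂ A)) σ Polynomial.X p) =
      σ • coeffD D (1 + PowerSeries.X * oddSymbol (PowerSeries.mk p)) -
        (σ ^ 2 / 2) •
          (PowerSeries.X * coeffD D (coeffD D (evenSymbol (PowerSeries.mk p)))) := by
  have hv : ∀ i j, (j + 1) / 2 < i → (ofReduced Polynomial.X p j).coeff i = 0 := fun i j hj =>
    Polynomial.coeff_eq_zero_of_natDegree_lt ((natDegree_ofReduced_le hp j).trans_lt hj)
  ext n
  rw [oddSymbol, PowerSeries.coeff_mk, coeff_coeff_symPair, map_sub,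
    Odd.neg_one_pow ⟨n, rfl⟩, PowerSeries.coeff_smul, PowerSeries.coeff_smul, coeff_coeffD,
    ← coeff_ofReduced_even, Finset.sum_range_succ']
  cases n with
  | zero => simp [ofReduced]
  | succ n =>
    rw [show 2 * (n + 1) = 2 * n + 1 + 1 by ring, Finset.sum_range_succ', Finset.sum_eq_zero,
      PowerSeries.coeff_succ_X_mul, coeff_coeffD, coeff_coeffD]
    · rw [show 2 * n + 1 + 1 + 1 - (0 + 1 + 1) = 2 * n + 1 by omega, coeff_ofReduced_odd,
        Odd.neg_one_pow ⟨n, rfl⟩, show 2 * n + 1 + 1 + 1 - (0 + 1) = 2 * (n + 1) by omega,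
        (even_two_mul (n + 1)).neg_one_pow, show 2 * n + 1 + 1 = 2 * (n + 1) by ring]
      simp [pow_succ]
      ring
    · intro j hj
      rw [Finset.mem_range] at hj
      rw [hv _ _ (by omega), mul_zero, map_zero, smul_zero]

section QuadDefect

variable {a : ℕ → A} {p : ℕ → Polynomial A}

theorem isFiltered_quadDefect (hp : ∀ k, (p k).natDegree ≤ k / 2) :
    IsFiltered (quadDefect (polyD (D : Module.End ℂ A)) (fun k => Polynomial.C (a k))
      Polynomial.X p) := by
  have h4 : (4 * Polynomial.C (a 0) : Polynomial A) = Polynomial.C (4 * a 0) := by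
    rw [map_mul, map_ofNat]
  rw [quadDefect, h4, two_mul]
  exact (((isFiltered_mk_C a).mul (isFiltered_symPair hp _)).mul (isFiltered_symPair hp _)).sub
    (((isFiltered_C_C _).add ((isFiltered_mk hp).add (isFiltered_mk hp)).X_mul).add
      ((isFiltered_mk hp).mul (isFiltered_mk hp)).X_sq_mul)

theorem evenSymbol_quadDefect (hp : ∀ k, (p k).natDegree ≤ k / 2) :
    evenSymbol (quadDefect (polyD (D : Module.End ℂ A)) (fun k => Polynomial.C (a k))
      Polynomial.X p) =
      evenQuad D (a 0) (1 + PowerSeries.X * oddSymbol (PowerSeries.mk p))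
        (evenSymbol (PowerSeries.mk p)) := by
  have h4 : (4 * Polynomial.C (a 0) : Polynomial A) = Polynomial.C (4 * a 0) := by
    rw [map_mul, map_ofNat]
  have hp' := isFiltered_mk hp
  rw [quadDefect, h4, evenSymbol_sub, evenSymbol_add, evenSymbol_add, evenSymbol_C_C, two_mul,
    (hp'.add hp').evenSymbol_X_mul, evenSymbol_X_sq_mul, hp'.evenSymbol_mul hp',
    ((isFiltered_mk_C a).mul (isFiltered_symPair hp _)).evenSymbol_mul (isFiltered_symPair hp _),
    (isFiltered_mk_C a).evenSymbol_mul (isFiltered_symPair hp _), evenSymbol_mk_C,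
    evenSymbol_symPair hp, evenSymbol_symPair hp, neg_smul, one_smul, evenQuad, map_mul, map_ofNat]
  ring

theorem oddSymbol_quadDefect (hp : ∀ k, (p k).natDegree ≤ k / 2) :
    oddSymbol (quadDefect (polyD (D : Module.End ℂ A)) (fun k => Polynomial.C (a k))
      Polynomial.X p) =
      oddQuad D (a 0) (a 1) (1 + PowerSeries.X * oddSymbol (PowerSeries.mk p))
        (evenSymbol (PowerSeries.mk p)) := by
  have h4 : (4 * Polynomial.C (a 0) : Polynomial A) = Polynomial.C (4 * a 0) := by
    rw [map_mul, map_ofNat]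
  have hp' := isFiltered_mk hp
  have hhalf : ∀ f : PowerSeries A, 2 * ((1 / 2 : ℂ) • f) = f := fun f => by
    rw [two_mul, ← add_smul]; norm_num
  rw [quadDefect, h4, oddSymbol_sub, oddSymbol_add, oddSymbol_add, oddSymbol_C_C, two_mul,
    oddSymbol_X_mul, evenSymbol_add, oddSymbol_X_sq_mul, hp'.oddSymbol_mul hp',
    ((isFiltered_mk_C a).mul (isFiltered_symPair hp _)).oddSymbol_mul (isFiltered_symPair hp _),
    (isFiltered_mk_C a).oddSymbol_mul (isFiltered_symPair hp _),
    (isFiltered_mk_C a).evenSymbol_mul (isFiltered_symPair hp _), evenSymbol_mk_C, oddSymbol_mk_C,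
    evenSymbol_symPair hp, evenSymbol_symPair hp, oddSymbol_symPair hp, oddSymbol_symPair hp,
    neg_smul, one_smul, neg_smul, one_smul, neg_one_sq, one_pow, oddQuad]
  have h := hhalf (PowerSeries.X * coeffD D (coeffD D (evenSymbol (PowerSeries.mk p))))
  generalize (1 / 2 : ℂ) • (PowerSeries.X * coeffD D (coeffD D (evenSymbol (PowerSeries.mk p)))) = f
    at h ⊢
  linear_combination (-2 * PowerSeries.C (a 0) *
    (1 + PowerSeries.X * oddSymbol (PowerSeries.mk p))) * h

end QuadDefect

end Symbols

/-! ### Polynomial form of the solution up to the critical order -/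

theorem update_agree {M : Type*} (p : ℕ → M) (N : ℕ) (q : M) :
    ∀ i < N, Function.update p N q i = p i := fun _ hi =>
  Function.update_of_ne hi.ne _ _

theorem natDegree_update_le {A : Type*} [CommRing A] {p : ℕ → Polynomial A}
    (hp : ∀ k, (p k).natDegree ≤ k / 2) {N : ℕ} {q : Polynomial A}
    (hq : q.natDegree ≤ N / 2) (k : ℕ) : (Function.update p N q k).natDegree ≤ k / 2 := by
  rcases eq_or_ne k N with rfl | h
  · rwa [Function.update_self]
  · rw [Function.update_of_ne h]; exact hp k

theorem two_mul_half_smul {M : Type*} [Ring M] [Module ℂ M] (x : M) :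
    2 * ((1 / 2 : ℂ) • x) = x := by
  rw [two_mul, ← add_smul]; norm_num

theorem two_mul_cancel {M : Type*} [Ring M] [Module ℂ M] {x y : M} (h : 2 * x = 2 * y) :
    x = y := by
  have h' : (2 : ℂ) • x = (2 : ℂ) • y := by
    rw [two_smul, two_smul, ← two_mul, ← two_mul, h]
  exact (IsUnit.mk0 (2 : ℂ) two_ne_zero).smul_left_cancel.mp h'

section PolynomialForm

variable {A : Type*} [CommRing A] [Algebra ℂ A] {D : Derivation ℂ A A} {a : ℕ → A}
  {p : ℕ → Polynomial A}

variable (D a p) in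
/-- The defect of the reduced quadratic equation for polynomials in `s = 1 / l`. -/
def polyDefect : PowerSeries (Polynomial A) :=
  quadDefect (polyD (D : Module.End ℂ A)) (fun k => Polynomial.C (a k)) Polynomial.X p

theorem evalConst_coeff_polyDefect (s : ℂ) (k : ℕ) :
    evalConst A s (PowerSeries.coeff k (polyDefect D a p)) =
      PowerSeries.coeff k (quadDefect (D : Module.End ℂ A) a (algebraMap ℂ A s)
        fun k => evalConst A s (p k)) := by
  have h := map_quadDefect (evalConst A s) (evalConst_polyD (D : Module.End ℂ A) s)
    (fun k => Polynomial.C (a k)) Polynomial.X p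
  simp only [evalConst_C, evalConst_X] at h
  rw [← h, PowerSeries.coeff_map]
  rfl

theorem coeff_polyDefect_update_of_le {N j : ℕ} (q : Polynomial A) (hj : j ≤ N) :
    PowerSeries.coeff j (polyDefect D a (Function.update p N q)) =
      PowerSeries.coeff j (polyDefect D a p) :=
  coeff_quadDefect_agree (update_agree p N q) j hj

theorem coeff_polyDefect_update {N : ℕ} (hpN : p N = 0) (q : Polynomial A) :
    PowerSeries.coeff (N + 1) (polyDefect D a (Function.update p N q)) =
      PowerSeries.coeff (N + 1) (polyDefect D a p) +
        (4 * Polynomial.C (a 0) * (1 + (-1) ^ (N + 1)) * Polynomial.X - 2) * q := by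
  have h := coeff_quadDefect_sub (D := polyD (D : Module.End ℂ A))
    (a := fun k => Polynomial.C (a k)) (s := Polynomial.X) (update_agree p N q)
  rw [Function.update_self, hpN, sub_zero] at h
  rw [polyDefect, polyDefect, ← h]
  ring

theorem natDegree_smul_le_of_le {q : Polynomial A} {n : ℕ} (h : q.natDegree ≤ n) (c : ℂ) :
    (c • q).natDegree ≤ n :=
  (Polynomial.natDegree_smul_le _ _).trans h

/-- Division by `1 - 4 r s`, with a constant remainder. -/
theorem exists_eq_one_sub_mul_add_C [Nontrivial A] {r : ℂ} (hr : r ≠ 0) (h : Polynomial A) :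
    ∃ q c, q.natDegree ≤ h.natDegree - 1 ∧
      h = 2 * ((1 - Polynomial.C (algebraMap ℂ A (4 * r)) * Polynomial.X) * q) +
        2 * Polynomial.C c := by
  set ρ : A := algebraMap ℂ A (4 * r)⁻¹ with hρ
  have hmul : algebraMap ℂ A (4 * r) * ρ = 1 := by
    rw [hρ, ← map_mul, mul_inv_cancel₀ (by simpa using hr), map_one]
  refine ⟨(-(1 / 2 : ℂ)) • (Polynomial.C ρ * (h /ₘ (Polynomial.X - Polynomial.C ρ))),
    (1 / 2 : ℂ) • h.eval ρ, ?_, ?_⟩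
  · refine natDegree_smul_le_of_le ((Polynomial.natDegree_C_mul_le _ _).trans ?_) _
    rw [Polynomial.natDegree_divByMonic _ (Polynomial.monic_X_sub_C ρ),
      Polynomial.natDegree_X_sub_C]
  · have h1 := Polynomial.modByMonic_add_div h (Polynomial.X - Polynomial.C ρ)
    rw [Polynomial.modByMonic_X_sub_C_eq_C_eval] at h1
    have h2 : (2 : Polynomial A) * Polynomial.C ((1 / 2 : ℂ) • h.eval ρ) =
        Polynomial.C (h.eval ρ) := by
      rw [← Polynomial.smul_C, two_mul_half_smul]
    have h3 := two_mul_half_smul (Polynomial.C ρ * (h /ₘ (Polynomial.X - Polynomial.C ρ)))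
    have h4 : Polynomial.C (algebraMap ℂ A (4 * r)) * Polynomial.C ρ = 1 := by
      rw [← map_mul, hmul, map_one]
    rw [h2, neg_smul]
    conv_lhs => rw [← h1]
    generalize (1 / 2 : ℂ) • (Polynomial.C ρ * (h /ₘ (Polynomial.X - Polynomial.C ρ))) = f
      at h3 ⊢
    linear_combination (1 - Polynomial.C (algebraMap ℂ A (4 * r)) * Polynomial.X) * h3 -
      Polynomial.X * (h /ₘ (Polynomial.X - Polynomial.C ρ)) * h4

variable {Λ : Type*} {lam : Λ → ℂ} {γ : Λ → ℕ → A} {r : ℂ}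

/-- The equation which determines `γ N` if the lower coefficients are polynomials in `1 / l`. -/
theorem evalConst_coeff_polyDefect_eq {N : ℕ} (hpN : p N = 0) {i : Λ}
    (hγ : ∀ k < N, γ i k = evalConst A (lam i)⁻¹ (p k))
    (hdef : quadDefect (D : Module.End ℂ A) a (algebraMap ℂ A (lam i)⁻¹) (γ i) = 0) :
    evalConst A (lam i)⁻¹ (PowerSeries.coeff (N + 1) (polyDefect D a p)) =
      -((4 * a 0 * (1 + (-1) ^ (N + 1)) * algebraMap ℂ A (lam i)⁻¹ - 2) * γ i N) := by
  have h := coeff_quadDefect_sub (D := (D : Module.End ℂ A)) (a := a)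
    (s := algebraMap ℂ A (lam i)⁻¹) hγ
  rw [hdef, map_zero, hpN, map_zero, sub_zero] at h
  rw [evalConst_coeff_polyDefect, ← h]
  ring

theorem eq_of_even_step {N : ℕ} (hN : Even N) (hpN : p N = 0) {i : Λ}
    (hγ : ∀ k < N, γ i k = evalConst A (lam i)⁻¹ (p k))
    (hdef : quadDefect (D : Module.End ℂ A) a (algebraMap ℂ A (lam i)⁻¹) (γ i) = 0) :
    γ i N = evalConst A (lam i)⁻¹
      ((1 / 2 : ℂ) • PowerSeries.coeff (N + 1) (polyDefect D a p)) := by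
  have h := evalConst_coeff_polyDefect_eq hpN hγ hdef
  rw [hN.add_one.neg_one_pow] at h
  apply two_mul_cancel
  rw [map_smul, two_mul_half_smul, h]
  ring

theorem eq_of_odd_step (ha : a 0 = algebraMap ℂ A r) {N : ℕ} (hN : Odd N) (hpN : p N = 0) {i : Λ}
    (h0 : lam i ≠ 0) (h4 : lam i ≠ 4 * r)
    (hγ : ∀ k < N, γ i k = evalConst A (lam i)⁻¹ (p k))
    (hdef : quadDefect (D : Module.End ℂ A) a (algebraMap ℂ A (lam i)⁻¹) (γ i) = 0)
    {q : Polynomial A} {c : A} (hq : PowerSeries.coeff (N + 1) (polyDefect D a p) =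
      2 * ((1 - Polynomial.C (algebraMap ℂ A (4 * r)) * Polynomial.X) * q) + 2 * Polynomial.C c) :
    γ i N = evalConst A (lam i)⁻¹ q + (lam i / (lam i - 4 * r)) • c := by
  have h := evalConst_coeff_polyDefect_eq hpN hγ hdef
  rw [hN.add_one.neg_one_pow, hq, ha] at h
  simp only [map_add, map_sub, map_mul, map_ofNat, map_one, evalConst_C, evalConst_X] at h
  have h5 : lam i - 4 * r ≠ 0 := sub_ne_zero.mpr h4
  have hκ : algebraMap ℂ A (lam i / (lam i - 4 * r)) *
      (1 - 4 * algebraMap ℂ A r * algebraMap ℂ A (lam i)⁻¹) = 1 := by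
    rw [← map_ofNat (algebraMap ℂ A) 4, ← map_one (algebraMap ℂ A), ← map_mul, ← map_mul, ← map_sub,
      ← map_mul]
    congr 1
    field_simp
  apply two_mul_cancel
  rw [Algebra.smul_def]
  linear_combination (-algebraMap ℂ A (lam i / (lam i - 4 * r))) * h -
    (2 * γ i N - 2 * evalConst A (lam i)⁻¹ q) * hκ

/-- As long as no multiple of `l / (l - 4 r)` can occur, the coefficients `γ k` are polynomials in
`1 / l` of degree at most `k / 2`. -/
theorem exists_polynomials [Nontrivial A] (hr : r ≠ 0) (ha : a 0 = algebraMap ℂ A r)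
    (h0 : ∀ i, lam i ≠ 0) (h4 : ∀ i, lam i ≠ 4 * r)
    (hdef : ∀ i, quadDefect (D : Module.End ℂ A) a (algebraMap ℂ A (lam i)⁻¹) (γ i) = 0)
    {M : ℕ} (hstr : ∀ k < M, Odd k → ∀ (q : Polynomial A) (c : A), q.natDegree ≤ k / 2 →
      (∀ i, γ i k = evalConst A (lam i)⁻¹ q + (lam i / (lam i - 4 * r)) • c) → c = 0) :
    ∀ N ≤ M, ∃ p : ℕ → Polynomial A, (∀ k, (p k).natDegree ≤ k / 2) ∧ (∀ k, N ≤ k → p k = 0) ∧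
      (∀ k < N, ∀ i, γ i k = evalConst A (lam i)⁻¹ (p k)) ∧
      ∀ j ≤ N, PowerSeries.coeff j (polyDefect D a p) = 0 := by
  intro N
  induction N with
  | zero =>
    intro _
    refine ⟨0, by simp, by simp, by simp, fun j hj => ?_⟩
    rw [Nat.le_zero.mp hj]
    exact coeff_zero_quadDefect _ _ _
  | succ N ih =>
    intro hN
    obtain ⟨p, hdeg, hvan, heq, hcoef⟩ := ih (by omega)
    have hpN := hvan N le_rfl
    have hh : (PowerSeries.coeff (N + 1) (polyDefect D a p)).natDegree ≤ (N + 1) / 2 :=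
      isFiltered_quadDefect hdeg (N + 1)
    have main : ∃ q : Polynomial A, q.natDegree ≤ N / 2 ∧
        (∀ i, γ i N = evalConst A (lam i)⁻¹ q) ∧
        PowerSeries.coeff (N + 1) (polyDefect D a p) +
          (4 * Polynomial.C (a 0) * (1 + (-1) ^ (N + 1)) * Polynomial.X - 2) * q = 0 := by
      rcases Nat.even_or_odd N with hev | hodd
      · refine ⟨_, natDegree_smul_le_of_le (hh.trans ?_) (1 / 2), fun i =>
          eq_of_even_step hev hpN (fun k hk => heq k hk i) (hdef i), ?_⟩
        · obtain ⟨j, rfl⟩ := hev; omega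
        · rw [hev.add_one.neg_one_pow, add_neg_cancel, mul_zero, zero_mul, zero_sub, neg_mul,
            two_mul_half_smul, add_neg_cancel]
      · obtain ⟨q, c, hq, hqc⟩ :=
          exists_eq_one_sub_mul_add_C hr (PowerSeries.coeff (N + 1) (polyDefect D a p))
        have hq' : q.natDegree ≤ N / 2 := by omega
        have hrep := fun i => eq_of_odd_step ha hodd hpN (h0 i) (h4 i) (fun k hk => heq k hk i)
          (hdef i) hqc
        have hc := hstr N (by omega) hodd q c hq' hrep
        refine ⟨q, hq', fun i => by rw [hrep i, hc, smul_zero, add_zero], ?_⟩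
        rw [hqc, hc, hodd.add_one.neg_one_pow, ha, map_mul, map_mul, map_ofNat, map_ofNat, map_zero]
        ring
    obtain ⟨q, hq, hγq, hcq⟩ := main
    refine ⟨Function.update p N q, natDegree_update_le hdeg hq, fun k hk => ?_, fun k hk i => ?_,
      fun j hj => ?_⟩
    · rw [Function.update_of_ne (by omega), hvan k (by omega)]
    · rcases Nat.lt_succ_iff_lt_or_eq.mp hk with h | rfl
      · rw [Function.update_of_ne h.ne, heq k h i]
      · rw [Function.update_self, hγq i]
    · rcases hj.lt_or_eq with h | rfl
      · rw [coeff_polyDefect_update_of_le q (by omega), hcoef j (by omega)]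
      · rw [coeff_polyDefect_update hpN, hcq]

/-- At the critical order `M` a multiple `c` of `l / (l - 4 r)` occurs in `γ M`. It is carried on to
`γ (M + 1)`, and the polynomial parts satisfy the equation of order `M + 1` only up to the constant
`2 c`. -/
theorem exists_polynomials_critical [Nontrivial A] (hr : r ≠ 0) (ha : a 0 = algebraMap ℂ A r)
    (h0 : ∀ i, lam i ≠ 0) (h4 : ∀ i, lam i ≠ 4 * r)
    (hdef : ∀ i, quadDefect (D : Module.End ℂ A) a (algebraMap ℂ A (lam i)⁻¹) (γ i) = 0)
    {M : ℕ} (hM : Odd M) (hstr : ∀ k < M, Odd k → ∀ (q : Polynomial A) (c : A),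
      q.natDegree ≤ k / 2 →
      (∀ i, γ i k = evalConst A (lam i)⁻¹ q + (lam i / (lam i - 4 * r)) • c) → c = 0) :
    ∃ (p : ℕ → Polynomial A) (c : A), (∀ k, (p k).natDegree ≤ k / 2) ∧
      (∀ i, γ i M = evalConst A (lam i)⁻¹ (p M) + (lam i / (lam i - 4 * r)) • c) ∧
      (∀ i, γ i (M + 1) = evalConst A (lam i)⁻¹ (p (M + 1)) +
        (2 * (lam i - 4 * r)⁻¹) • (a 1 * c)) ∧
      (∀ j ≤ M + 2, j ≠ M + 1 → PowerSeries.coeff j (polyDefect D a p) = 0) ∧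
      PowerSeries.coeff (M + 1) (polyDefect D a p) = Polynomial.C (2 * c) := by
  obtain ⟨p, hdeg, hvan, heq, hcoef⟩ := exists_polynomials hr ha h0 h4 hdef hstr M le_rfl
  have hpM := hvan M le_rfl
  obtain ⟨q, c, hq, hqc⟩ :=
    exists_eq_one_sub_mul_add_C hr (PowerSeries.coeff (M + 1) (polyDefect D a p))
  have hh : (PowerSeries.coeff (M + 1) (polyDefect D a p)).natDegree ≤ (M + 1) / 2 :=
    isFiltered_quadDefect hdeg (M + 1)
  have hq' : q.natDegree ≤ M / 2 := by omega
  have hrep := fun i => eq_of_odd_step ha hM hpM (h0 i) (h4 i) (fun k hk => heq k hk i)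
    (hdef i) hqc
  set p₁ := Function.update p M q with hp₁
  have hdeg₁ : ∀ k, (p₁ k).natDegree ≤ k / 2 := natDegree_update_le hdeg hq'
  have hp₁M : p₁ (M + 1) = 0 := by
    rw [hp₁, Function.update_of_ne (by omega), hvan _ (by omega)]
  have hcoef₁ : PowerSeries.coeff (M + 1) (polyDefect D a p₁) = Polynomial.C (2 * c) := by
    rw [hp₁, coeff_polyDefect_update hpM, hqc, hM.add_one.neg_one_pow, ha, map_mul, map_mul,
      map_ofNat, map_mul, map_ofNat, map_ofNat]
    ring
  set h := PowerSeries.coeff (M + 2) (polyDefect D a p₁) with hh₁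
  have hhdeg : ((1 / 2 : ℂ) • h).natDegree ≤ (M + 1) / 2 := by
    refine natDegree_smul_le_of_le ((isFiltered_quadDefect hdeg₁ (M + 2)).trans ?_) _
    obtain ⟨j, rfl⟩ := hM
    omega
  refine ⟨Function.update p₁ (M + 1) ((1 / 2 : ℂ) • h), c, natDegree_update_le hdeg₁ hhdeg,
    fun i => ?_, fun i => ?_, fun j hj hj' => ?_, ?_⟩
  · rw [Function.update_of_ne (by omega), hp₁, Function.update_self, hrep i]
  · rw [Function.update_self]
    have hag : ∀ k < M, γ i k = evalConst A (lam i)⁻¹ (p₁ k) := fun k hk => by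
      rw [hp₁, Function.update_of_ne hk.ne, heq k hk i]
    have hD1 : (D : Module.End ℂ A) 1 = 0 := D.map_one_eq_zero
    have e1 := coeff_quadDefect_succ_sub (D := (D : Module.End ℂ A)) (a := a)
      (s := algebraMap ℂ A (lam i)⁻¹) hD1 hM hag
    have e2 := coeff_one_quadDefect hD1 a (algebraMap ℂ A (lam i)⁻¹) (γ i)
    rw [hdef i, map_zero] at e1 e2
    rw [← evalConst_coeff_polyDefect, ← hh₁, hp₁M, map_zero, hp₁, Function.update_self, hrep i,
      Algebra.smul_def] at e1
    have hs : algebraMap ℂ A (lam i)⁻¹ * algebraMap ℂ A (lam i / (lam i - 4 * r)) =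
        algebraMap ℂ A (lam i - 4 * r)⁻¹ := by
      rw [← map_mul]
      congr 1
      have := h0 i
      field_simp
    apply two_mul_cancel
    rw [map_smul, mul_add, two_mul_half_smul, Algebra.smul_def, map_mul, map_ofNat]
    linear_combination e1 - algebraMap ℂ A (lam i)⁻¹ *
      (algebraMap ℂ A (lam i / (lam i - 4 * r)) * c) * e2 + 4 * a 1 * c * hs
  · rcases hj.lt_or_eq with hlt | rfl
    · rw [coeff_polyDefect_update_of_le _ (by omega), hp₁,
        coeff_polyDefect_update_of_le _ (by omega), hcoef j (by omega)]
    · rw [coeff_polyDefect_update hp₁M, hM.add_one.add_one.neg_one_pow, add_neg_cancel, mul_zero,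
        zero_mul, zero_sub, neg_mul, two_mul_half_smul, ← hh₁, add_neg_cancel]
  · rw [coeff_polyDefect_update_of_le _ le_rfl, hcoef₁]

end PolynomialForm

/-! ### The leading symbols of the critical solution -/

/-- The leading symbols of a polynomial solution of the reduced quadratic equation are, up to the
order to which the equation holds, the generating series of the hierarchy. -/
theorem coeff_eq_map_hierarchyCoeff {A : Type*} [CommRing A] [Algebra ℂ A] {D : Derivation ℂ A A}
    {r : ℝ} (hr : r ≠ 0) {a : ℕ → A} {p : ℕ → Polynomial A} {m : ℕ} (hm : 1 ≤ m)
    {φ : DiffPoly →+* A} (hφD : ∀ q, φ (totalD q) = D (φ q))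
    (hφr : φ (MvPolynomial.C r) = a 0) (hφu : φ (MvPolynomial.X 0) = a 1)
    (ha : a 0 = algebraMap ℂ A r) (hp : ∀ k, (p k).natDegree ≤ k / 2)
    (h0 : ∀ j ≤ 2 * m + 1, j ≠ 2 * m → PowerSeries.coeff j (polyDefect D a p) = 0)
    {c : A} (hc : PowerSeries.coeff (2 * m) (polyDefect D a p) = Polynomial.C c) :
    (p (2 * m)).coeff m = φ (hierarchyCoeff r m).2 := by
  have heven := map_evenQuad totalD D φ hφD (MvPolynomial.C r) (hierarchyE r)
    (hierarchyO r)
  have hodd := map_oddQuad totalD D φ hφD (MvPolynomial.C r) (MvPolynomial.X 0)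
    (hierarchyE r) (hierarchyO r)
  rw [evenQuad_hierarchy hr, map_zero, hφr] at heven
  rw [oddQuad_hierarchy hr, map_zero, hφr, hφu] at hodd
  have h2 : IsUnit (2 : A) := by
    rw [← map_ofNat (algebraMap ℂ A) 2]
    exact (IsUnit.mk0 (2 : ℂ) two_ne_zero).map _
  have h8 : IsUnit (8 * a 0) := by
    rw [ha, ← map_ofNat (algebraMap ℂ A) 8, ← map_mul]
    exact (IsUnit.mk0 _ (mul_ne_zero (by norm_num) (by exact_mod_cast hr))).map _
  have key := quad_unique D (u := a 1) h8 h2 (m := m)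
    (E := 1 + PowerSeries.X * oddSymbol (PowerSeries.mk p)) (O := evenSymbol (PowerSeries.mk p))
    (E' := PowerSeries.map φ (hierarchyE r)) (O' := PowerSeries.map φ (hierarchyO r))
    (by rw [map_add, map_one, map_mul, PowerSeries.constantCoeff_X, zero_mul, add_zero])
    (by
      rw [← PowerSeries.coeff_zero_eq_constantCoeff_apply, PowerSeries.coeff_map,
        PowerSeries.coeff_zero_eq_constantCoeff_apply, hierarchyE_constantCoeff, map_one])
    (fun n hn => by
      rw [← evenSymbol_quadDefect hp, ← heven, map_zero, evenSymbol, PowerSeries.coeff_mk]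
      rcases hn.lt_or_eq with h | rfl
      · exact (congrArg (Polynomial.coeff · n) (h0 (2 * n) (by omega) (by omega))).trans
          (Polynomial.coeff_zero n)
      -- the exceptional coefficient is constant in `1 / l`, so that its symbol vanishes
      · exact (congrArg (Polynomial.coeff · n) hc).trans
          (by simp only [Polynomial.coeff_C]; rw [if_neg (by omega)]))
    (fun n hn => by
      rw [← oddSymbol_quadDefect hp, ← hodd, map_zero, oddSymbol, PowerSeries.coeff_mk]
      exact (congrArg (Polynomial.coeff · n) (h0 (2 * n + 1) (by omega) (by omega))).trans
        (Polynomial.coeff_zero n))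
  have h := (key m le_rfl).2
  rw [evenSymbol, PowerSeries.coeff_mk, PowerSeries.coeff_mk, PowerSeries.coeff_map, hierarchyO,
    PowerSeries.coeff_mk] at h
  exact h

theorem coeff_eq_evalSmooth_hierarchyCoeff {I : Set ℝ} (hI : IsOpen I) {r : ℝ} (hr : r ≠ 0)
    {a : ℕ → smoothFun I} {p : ℕ → Polynomial (smoothFun I)} {m : ℕ} (hm : 1 ≤ m)
    (ha : a 0 = algebraMap ℂ (smoothFun I) r) (hp : ∀ k, (p k).natDegree ≤ k / 2)
    (h0 : ∀ j ≤ 2 * m + 1, j ≠ 2 * m → PowerSeries.coeff j (polyDefect (smoothD hI) a p) = 0)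
    {c : smoothFun I}
    (hc : PowerSeries.coeff (2 * m) (polyDefect (smoothD hI) a p) = Polynomial.C c) :
    (p (2 * m)).coeff m = evalSmooth hI (a 1) (hierarchyCoeff r m).2 := by
  refine coeff_eq_map_hierarchyCoeff (φ := (evalSmooth hI (a 1) : DiffPoly →+* smoothFun I)) hr hm
    (evalSmooth_totalD hI (a 1)) ?_ ?_ ha hp h0 hc
  · rw [ha, RingHom.coe_coe, ← MvPolynomial.algebraMap_eq, AlgHom.commutes]
    exact IsScalarTower.algebraMap_apply ℝ ℂ (smoothFun I) r
  · rw [RingHom.coe_coe, evalSmooth, MvPolynomial.aeval_X, pow_zero]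
    rfl

/-! ### Generating functions as formal series over smooth functions -/

section Generating

variable {I : Set ℝ} (hI : IsOpen I)

theorem evalAt_taylorShift (σ : ℤ) {f : ℕ → ℝ → ℂ} (hf : ∀ k, ContDiffOn ℝ ∞ (f k) I) (y : ℂ)
    (k : ℕ) (x : I) :
    evalAt x (taylorShift (smoothD hI : Module.End ℂ (smoothFun I)) σ
      (fun k => y • mkSmooth (f k) (hf k)) k) = y * epsShift σ f k x := by
  rw [taylorShift, epsShift, map_sum, Finset.mul_sum]
  refine Finset.sum_congr rfl fun n _ => ?_
  rw [map_smul, map_smul, map_smul, evalAt_apply, smoothD_pow_mk, smul_eq_mul, smul_eq_mul]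
  ring

theorem map_evalAt_pairSum (σ : ℤ) {f g : ℕ → ℝ → ℂ} (hf : ∀ k, ContDiffOn ℝ ∞ (f k) I)
    (hg : ∀ k, ContDiffOn ℝ ∞ (g k) I) (y : ℂ) (x : I) :
    PowerSeries.map (evalAt x : smoothFun I →+* ℂ)
      (pairSum (smoothD hI : Module.End ℂ (smoothFun I)) σ (fun k => y • mkSmooth (f k) (hf k))
        (fun k => y • mkSmooth (g k) (hg k))) =
      PowerSeries.C y * (epsSeries f x + epsSeries (epsShift σ g) x) := by
  ext k
  rw [PowerSeries.coeff_map, coeff_pairSum, RingHom.coe_coe, map_add, evalAt_taylorShift,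
    PowerSeries.coeff_C_mul, map_add, epsSeries, epsSeries, PowerSeries.coeff_mk,
    PowerSeries.coeff_mk, map_smul, evalAt_apply, mkSmooth_apply, smul_eq_mul]
  ring

/-- The quadratic equation, normalized by the leading coefficient `1 / y`, over the ring of smooth
functions. -/
theorem quadratic_smoothFun {a f g : ℕ → ℝ → ℂ} (ha : ∀ k, ContDiffOn ℝ ∞ (a k) I)
    (hf : ∀ k, ContDiffOn ℝ ∞ (f k) I) (hg : ∀ k, ContDiffOn ℝ ∞ (g k) I) (y l : ℂ)
    (h : ∀ x ∈ I, epsSeries a x * (epsSeries f x + epsSeries (epsShift (-1) g) x) *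
      (epsSeries f x + epsSeries (epsShift 1 g) x) =
        PowerSeries.C l * (epsSeries f x ^ 2 - 1)) :
    PowerSeries.mk (fun k => mkSmooth (a k) (ha k)) *
      pairSum (smoothD hI : Module.End ℂ (smoothFun I)) (-1) (fun k => y • mkSmooth (f k) (hf k))
        (fun k => y • mkSmooth (g k) (hg k)) *
      pairSum (smoothD hI : Module.End ℂ (smoothFun I)) 1 (fun k => y • mkSmooth (f k) (hf k))
        (fun k => y • mkSmooth (g k) (hg k)) =
      PowerSeries.C (algebraMap ℂ (smoothFun I) l) *
        (PowerSeries.mk (fun k => y • mkSmooth (f k) (hf k)) ^ 2 -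
          PowerSeries.C (algebraMap ℂ (smoothFun I) (y ^ 2))) := by
  refine powerSeries_smoothFun_ext fun x => ?_
  have h1 := map_evalAt_pairSum hI (-1) hf hg y x
  have h2 := map_evalAt_pairSum hI 1 hf hg y x
  rw [Int.cast_neg, Int.cast_one] at h1
  rw [Int.cast_one] at h2
  have h3 : PowerSeries.map (evalAt x : smoothFun I →+* ℂ)
      (PowerSeries.mk fun k => mkSmooth (a k) (ha k)) = epsSeries a x := by
    ext k; simp [epsSeries, evalAt_apply, mkSmooth_apply]
  have h4 : PowerSeries.map (evalAt x : smoothFun I →+* ℂ)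
      (PowerSeries.mk fun k => y • mkSmooth (f k) (hf k)) =
        PowerSeries.C y * epsSeries f x := by
    ext k
    rw [PowerSeries.coeff_map, PowerSeries.coeff_mk, RingHom.coe_coe, map_smul,
      PowerSeries.coeff_C_mul, epsSeries, PowerSeries.coeff_mk]
    rfl
  have h5 : ∀ c, PowerSeries.map (evalAt x : smoothFun I →+* ℂ)
      (PowerSeries.C (algebraMap ℂ (smoothFun I) c)) = PowerSeries.C c := fun c => by
    rw [PowerSeries.map_C, RingHom.coe_coe, AlgHom.commutes]; rfl
  rw [map_mul, map_mul, h1, h2, h3, map_mul, h5, map_sub, map_pow, h4, h5, map_pow]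
  linear_combination PowerSeries.C y ^ 2 * h x x.2

end Generating

/-! ### The string equations -/

section StringEquations

variable {P : Polynomial ℝ} {R r : ℝ} {I : Set ℝ}

/-- A moment of a polynomial in `1 / l` plus a multiple of `1 / (l - 4 r)`. -/
theorem critMoment_polynomial (hr : 0 < r) (hR : 4 * r < R) {q : Polynomial (smoothFun I)} {d : ℕ}
    (hq : q.natDegree ≤ d) (c : smoothFun I) (x : I) :
    critMoment P R r (fun l => l⁻¹ * evalAt x (evalConst (smoothFun I) l⁻¹ q +
      (l / (l - 4 * (r : ℂ))) • c)) =
      ∑ i ∈ Finset.range (d + 1), evalAt x (q.coeff i) *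
        critMoment P R r (fun l => (l⁻¹) ^ (i + 1)) +
      evalAt x c * critMoment P R r (fun l => (l - 4 * (r : ℂ))⁻¹) := by
  have hR0 : 0 < R := by linarith
  simp only [← critMoment_const_mul]
  have hcont : ∀ i ∈ Finset.range (d + 1), ContinuousOn
      (fun l : ℂ => evalAt x (q.coeff i) * l⁻¹ ^ (i + 1)) (Metric.sphere 0 R) := fun i _ =>
    continuousOn_const.mul (continuousOn_inv_pow hR0 _)
  rw [← critMoment_sum hr hR _ hcont, ← critMoment_add hr hR (continuousOn_finsetSum _ hcont)
    (g := fun l => evalAt x c * (l - 4 * (r : ℂ))⁻¹)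
    (continuousOn_const.mul (continuousOn_inv_sub hr hR))]
  refine contourInt_congr hR0.le fun l hl => ?_
  congr 1
  have hl0 : l ≠ 0 := norm_pos_iff.mp (by rw [hl]; exact hR0)
  beta_reduce
  rw [map_add, evalConst_eq_sum _ hq, map_sum, map_smul, smul_eq_mul, mul_add, Finset.mul_sum]
  congr 1
  · refine Finset.sum_congr rfl fun i _ => ?_
    rw [map_smul, smul_eq_mul]; ring
  · field_simp

end StringEquations

/-! ### The reduced generating function of a symmetric solution -/

theorem constantCoeff_epsSeries (f : ℕ → ℝ → ℂ) (x : ℝ) :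
    PowerSeries.constantCoeff (epsSeries f x) = f 0 x := by
  rw [← PowerSeries.coeff_zero_eq_constantCoeff_apply, epsSeries, PowerSeries.coeff_mk]

theorem epsShift_zero (s : ℤ) (f : ℕ → ℝ → ℂ) (x : ℝ) : epsShift s f 0 x = f 0 x := by
  simp [epsShift]

theorem quadratic_constantCoeff {s t : ℤ} {a f g : ℕ → ℝ → ℂ} {l : ℂ} {x : ℝ}
    (h : epsSeries a x * (epsSeries f x + epsSeries (epsShift s g) x) *
      (epsSeries f x + epsSeries (epsShift t g) x) =
        PowerSeries.C l * (epsSeries f x ^ 2 - 1)) :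
    a 0 x * (f 0 x + g 0 x) ^ 2 = l * (f 0 x ^ 2 - 1) := by
  have h0 := congrArg PowerSeries.constantCoeff h
  simp only [map_mul, map_add, map_sub, map_pow, map_one, constantCoeff_epsSeries, epsShift_zero,
    PowerSeries.constantCoeff_C] at h0
  linear_combination h0

/-- The quadratic system for formal series over an arbitrary differential ring, normalized to
`v 0 = w 0 = 1`, yields the reduced quadratic equation. -/
theorem quadDefect_eq_zero_of_quadratic_system {C : Type*} [CommRing C] [Algebra ℂ C]
    {D : Derivation ℂ C C} {a v w : ℕ → C} {l y r : ℂ} (hl : l ≠ 0) (hy : y ≠ 0)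
    (hly : l * y ^ 2 = l - 4 * r) (ha : a 0 = algebraMap ℂ C r) (hv : v 0 = 1) (hw : w 0 = 1)
    (h1 : PowerSeries.mk a * pairSum (D : Module.End ℂ C) (-1) v w *
      pairSum (D : Module.End ℂ C) 1 v w =
        PowerSeries.C (algebraMap ℂ C l) *
          (PowerSeries.mk v ^ 2 - PowerSeries.C (algebraMap ℂ C (y ^ 2))))
    (h2 : PowerSeries.mk (signTwist a) * pairSum (D : Module.End ℂ C) (-1) w v *
      pairSum (D : Module.End ℂ C) 1 w v =
        PowerSeries.C (algebraMap ℂ C l) *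
          (PowerSeries.mk w ^ 2 - PowerSeries.C (algebraMap ℂ C (y ^ 2)))) :
    quadDefect (D : Module.End ℂ C) a (algebraMap ℂ C l⁻¹)
      (fun k => algebraMap ℂ C l * v (k + 1)) = 0 := by
  have hl4 : l - 4 * r ≠ 0 := hly ▸ mul_ne_zero hl (pow_ne_zero 2 hy)
  have h4 : (4 : C) * algebraMap ℂ C r = algebraMap ℂ C (4 * r) := by rw [map_mul, map_ofNat]
  rw [eq_signTwist_of_quadratic_system ha ((IsUnit.mk0 l hl).map _)
    (by rw [h4, ← map_sub]; exact (IsUnit.mk0 _ hl4).map _) hv hw h1 h2] at h1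
  refine quadDefect_eq_zero ?_ hv ?_ h1
  · rw [← map_mul, mul_inv_cancel₀ hl, map_one]
  · rw [ha, h4, ← map_mul, ← map_sub, hly]

/-- The domain `|l| > 4 r` of the generating functions. -/
abbrev OuterDomain (r : ℝ) : Type := {l : ℂ // 4 * r < ‖l‖}

section Reduced

variable {r : ℝ} {I : Set ℝ} {a b : ℕ → ℝ → ℂ} {V W : ℕ → ℂ → ℝ → ℂ}

theorem IsGeneratingPair.zero_eq (h : IsGeneratingPair r I a b V W) (hr : 0 < r)
    (ha : ∀ x ∈ I, a 0 x = r) (hb : ∀ x ∈ I, b 0 x = r) {l : ℂ} (hl : 4 * r < ‖l‖) {x : ℝ}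
    (hx : x ∈ I) : V 0 l x = (critRoot r l)⁻¹ ∧ W 0 l x = (critRoot r l)⁻¹ := by
  refine leading_coefficient hr (h.holo_V 0 x hx).continuousOn (h.holo_W 0 x hx).continuousOn
    (h.lim_V 0 x hx) (h.lim_W 0 x hx) (fun z hz => ?_) (fun z hz => ?_) hl
  · have h0 := quadratic_constantCoeff (h.quad_V z hz x hx)
    rwa [ha x hx] at h0
  · have h0 := quadratic_constantCoeff (h.quad_W z hz x hx)
    rw [hb x hx] at h0
    linear_combination h0

/-- The first generating function of a symmetric solution is `(l / w_c) (1 + ε γ / l)`, where `γ`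
solves the reduced quadratic equation. -/
theorem IsGeneratingPair.exists_reduced (h : IsGeneratingPair r I a b V W) (hr : 0 < r)
    (hI : IsOpen I) (hsa : ∀ k, ContDiffOn ℝ ∞ (a k) I) (hsb : ∀ k, ContDiffOn ℝ ∞ (b k) I)
    (ha : ∀ x ∈ I, a 0 x = r) (hb : ∀ x ∈ I, b 0 x = r) (hsym : IsSymmetricPair I a b) :
    ∃ γ : OuterDomain r → ℕ → smoothFun I,
      (∀ l : OuterDomain r, quadDefect (smoothD hI : Module.End ℂ (smoothFun I))
        (fun k => mkSmooth (a k) (hsa k)) (algebraMap ℂ (smoothFun I) (l : ℂ)⁻¹) (γ l) = 0) ∧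
      ∀ (l : OuterDomain r) k (x : I), V (k + 1) l x =
        (critRoot r l)⁻¹ * ((l : ℂ)⁻¹ * evalAt x (γ l k)) := by
  have ha0 : mkSmooth (a 0) (hsa 0) = algebraMap ℂ (smoothFun I) r :=
    Subtype.ext (funext fun x => ha x x.2)
  have hb' : (fun k => mkSmooth (b k) (hsb k)) = signTwist fun k => mkSmooth (a k) (hsa k) := by
    funext k
    refine smoothFun_ext fun x => ?_
    rw [signTwist, map_mul, map_pow, map_neg, map_one]
    exact hsym k x x.2
  refine ⟨fun l k => algebraMap ℂ (smoothFun I) l *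
    (critRoot r l • mkSmooth (V (k + 1) l) (h.smooth_V (k + 1) l l.2)), fun l => ?_,
    fun l k x => ?_⟩
  · obtain ⟨l, hl⟩ := l
    have hl0 : l ≠ 0 := norm_pos_iff.mp (lt_trans (by positivity) hl)
    have hy := critRoot_ne_zero hr hl
    have hβ : l * critRoot r l ^ 2 = l - 4 * r := by rw [critRoot_sq]; field_simp
    have hv0 : critRoot r l • mkSmooth (V 0 l) (h.smooth_V 0 l hl) = 1 := by
      refine smoothFun_ext fun x => ?_
      rw [map_smul, map_one, smul_eq_mul, evalAt_apply, mkSmooth_apply,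
        (h.zero_eq hr ha hb hl x.2).1, mul_inv_cancel₀ hy]
    have hw0 : critRoot r l • mkSmooth (W 0 l) (h.smooth_W 0 l hl) = 1 := by
      refine smoothFun_ext fun x => ?_
      rw [map_smul, map_one, smul_eq_mul, evalAt_apply, mkSmooth_apply,
        (h.zero_eq hr ha hb hl x.2).2, mul_inv_cancel₀ hy]
    have q1 := quadratic_smoothFun hI hsa (fun k => h.smooth_V k l hl)
      (fun k => h.smooth_W k l hl) (critRoot r l) l (h.quad_V l hl)
    have q2 := quadratic_smoothFun hI hsb (fun k => h.smooth_W k l hl)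
      (fun k => h.smooth_V k l hl) (critRoot r l) l (h.quad_W l hl)
    rw [hb'] at q2
    exact quadDefect_eq_zero_of_quadratic_system (D := smoothD hI)
      (a := fun k => mkSmooth (a k) (hsa k))
      (v := fun k => critRoot r l • mkSmooth (V k l) (h.smooth_V k l hl))
      (w := fun k => critRoot r l • mkSmooth (W k l) (h.smooth_W k l hl))
      hl0 hy hβ ha0 hv0 hw0 q1 q2
  · have hl0 : (l : ℂ) ≠ 0 := norm_pos_iff.mp (lt_trans (by positivity) l.2)
    have hy := critRoot_ne_zero hr l.2
    rw [map_mul, AlgHom.commutes, map_smul, evalAt_apply, mkSmooth_apply, smul_eq_mul,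
      Algebra.algebraMap_self, RingHom.id_apply]
    field_simp

end Reduced

/-! ### The string equations at a merging point -/

section StringAtMerging

variable {P : Polynomial ℝ} {R r T : ℝ} {m : ℕ} {I : Set ℝ} {V : ℕ → ℂ → ℝ → ℂ}
  {γ : OuterDomain r → ℕ → smoothFun I}

/-- The contour integral of the string equation for a coefficient of `γ` that is polynomial in
`1 / l` up to a multiple of `l / (l - 4 r)`: all moments of order at most `m` vanish. -/
theorem contourInt_of_polynomial (hR : 4 * r < R) (h : IsMergingOfOrder P R T (4 * r) m)
    (hV : ∀ (l : OuterDomain r) k (x : I), V (k + 1) l x =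
      (critRoot r l)⁻¹ * ((l : ℂ)⁻¹ * evalAt x (γ l k)))
    {k : ℕ} {q : Polynomial (smoothFun I)} (hq : q.natDegree ≤ m) {c : smoothFun I}
    (hγ : ∀ l : OuterDomain r, γ l k = evalConst (smoothFun I) (l : ℂ)⁻¹ q +
      ((l : ℂ) / ((l : ℂ) - 4 * (r : ℂ))) • c) (x : I) :
    contourInt R (fun l => dPot P l * V (k + 1) l x) =
      evalAt x (q.coeff m) * critMoment P R r (fun l => l⁻¹ ^ (m + 1)) +
        evalAt x c * critMoment P R r (fun l => (l - 4 * (r : ℂ))⁻¹) := by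
  have hr : 0 < r := by linarith [h.pos]
  have hint : contourInt R (fun l => dPot P l * V (k + 1) l x) =
      critMoment P R r (fun l => l⁻¹ * evalAt x (evalConst (smoothFun I) l⁻¹ q +
        (l / (l - 4 * (r : ℂ))) • c)) := by
    refine contourInt_congr (by linarith) fun l hl => ?_
    have hl4 : 4 * r < ‖l‖ := by rw [hl]; exact hR
    rw [hV ⟨l, hl4⟩ k x, hγ ⟨l, hl4⟩, mul_assoc]
  rw [hint, critMoment_polynomial hr hR hq, Finset.sum_range_succ, Finset.sum_eq_zero, zero_add]
  intro i hi
  rw [h.critMoment_eq_zero hR (by omega) (by have := Finset.mem_range.mp hi; omega), mul_zero]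

/-- The string equations at the orders `ε ^ (2 m)` and `ε ^ (2 m + 1)` give the equation for the
symbol `o_m` of the generating function. -/
theorem hierarchyCoeff_equation [Nonempty I] (hI : IsOpen I) (hR : 4 * r < R)
    (h : IsMergingOfOrder P R T (4 * r) m) {a : ℕ → smoothFun I}
    (ha : a 0 = algebraMap ℂ (smoothFun I) r)
    (hdef : ∀ l : OuterDomain r, quadDefect (smoothD hI : Module.End ℂ (smoothFun I)) a
      (algebraMap ℂ (smoothFun I) (l : ℂ)⁻¹) (γ l) = 0)
    (hV : ∀ (l : OuterDomain r) k (x : I), V (k + 1) l x =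
      (critRoot r l)⁻¹ * ((l : ℂ)⁻¹ * evalAt x (γ l k)))
    (hstr : ∀ k (x : I), contourInt R (fun l => dPot P l * V k l x) = stringRHS T m k x) (x : I) :
    2 * r * evalAt x (evalSmooth hI (a 1) (hierarchyCoeff r m).2) *
      critMoment P R r (fun l => l⁻¹ ^ (m + 1)) + x * evalAt x (a 1) = 0 := by
  have hm := h.one_le
  have hr : 0 < r := by linarith [h.pos]
  have hrC : (r : ℂ) ≠ 0 := by exact_mod_cast hr.ne'
  have hψ := h.critMoment_inv_sub_ne_zero hR
  have hl0 : ∀ l : OuterDomain r, (l : ℂ) ≠ 0 := fun l =>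
    norm_pos_iff.mp (lt_trans (by positivity) l.2)
  have hl4 : ∀ l : OuterDomain r, (l : ℂ) ≠ 4 * r := fun l hl => by
    have h1 := l.2
    rw [hl, norm_mul, Complex.norm_real, Real.norm_of_nonneg hr.le] at h1
    norm_num at h1
  have hcoeff : ∀ {q : Polynomial (smoothFun I)}, q.natDegree < m → ∀ y : I,
      evalAt y (q.coeff m) = 0 := fun hq y => by
    rw [Polynomial.coeff_eq_zero_of_natDegree_lt hq, map_zero]
  obtain ⟨p, c, hp, hpM, hpM1, h0, hc⟩ := exists_polynomials_critical (D := smoothD hI) hrC ha hl0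
    hl4 hdef (M := 2 * m - 1) ⟨m - 1, by omega⟩ fun k hk _ q c hq hrep => by
      refine smoothFun_ext fun y => ?_
      have h1 := contourInt_of_polynomial hR h hV (by omega) hrep y
      rw [hstr, hcoeff (by omega), zero_mul, zero_add, stringRHS, if_neg (by omega),
        if_neg (by omega), add_zero] at h1
      rw [map_zero]
      exact (mul_eq_zero.mp h1.symm).resolve_right hψ
  have hM1 : 2 * m - 1 + 1 = 2 * m := by omega
  have hM2 : 2 * m - 1 + 2 = 2 * m + 1 := by omega
  rw [hM1] at hpM1 h0 hc
  rw [hM2] at h0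
  have e1 := contourInt_of_polynomial hR h hV ((hp _).trans (by omega)) hpM x
  rw [hstr, hcoeff ((hp _).trans_lt (by omega)), zero_mul, zero_add, hM1, stringRHS,
    if_neg (by omega), if_pos rfl, zero_add] at e1
  -- `2 / (l - 4 r) = (l / (l - 4 r) - 1) / (2 r)`
  have hrep : ∀ l : OuterDomain r, γ l (2 * m) =
      evalConst (smoothFun I) (l : ℂ)⁻¹ (p (2 * m) -
        Polynomial.C ((2 * (r : ℂ))⁻¹ • (a 1 * c))) +
      ((l : ℂ) / ((l : ℂ) - 4 * (r : ℂ))) • (2 * (r : ℂ))⁻¹ • (a 1 * c) := fun l => by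
    have hl : (l : ℂ) - 4 * r ≠ 0 := sub_ne_zero.mpr (hl4 l)
    have hfrac : 2 * ((l : ℂ) - 4 * r)⁻¹ =
        (l : ℂ) / ((l : ℂ) - 4 * r) * (2 * (r : ℂ))⁻¹ - (2 * (r : ℂ))⁻¹ := by
      field_simp
      ring
    rw [hpM1, map_sub, evalConst_C, hfrac, sub_smul, smul_smul]
    ring
  have hdeg : (p (2 * m) - Polynomial.C ((2 * (r : ℂ))⁻¹ • (a 1 * c))).natDegree ≤ m :=
    (Polynomial.natDegree_sub_C).trans_le ((hp _).trans (by omega))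
  have e2 := contourInt_of_polynomial hR h hV hdeg hrep x
  rw [hstr, stringRHS, if_neg (by omega), if_neg (by omega), add_zero, Polynomial.coeff_sub,
    Polynomial.coeff_C, if_neg (by omega), sub_zero, map_smul, map_mul, smul_eq_mul,
    coeff_eq_evalSmooth_hierarchyCoeff hI hr.ne' hm ha hp h0 hc] at e2
  have hinv : (r : ℂ) * (2 * (r : ℂ))⁻¹ * 2 = 1 := by field_simp
  linear_combination (-(2 * r : ℂ)) * e2 + evalAt x (a 1) * e1 -
    evalAt x (a 1) * evalAt x c * critMoment P R r (fun l => (l - 4 * (r : ℂ))⁻¹) * hinv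

end StringAtMerging

end

theorem theorem3 (P : Polynomial ℝ) (m : ℕ) (r T R : ℝ) (hR : 4 * r < R)
    (hmerge : IsMergingOfOrder P R T (4 * r) m)
    (I : Set ℝ) (hI : IsOpen I) (a b : ℕ → ℝ → ℂ)
    (hsol : IsFormalStringSolution P R T r m I a b)
    (hsym : IsSymmetricPair I a b) :
    (∃! RS : (ℕ → DiffPoly) × (ℕ → DiffPoly), IsPainleveIIHierarchy r RS.1 RS.2) ∧
    ∀ Rp Sp : ℕ → DiffPoly, IsPainleveIIHierarchy r Rp Sp →
      ∀ x ∈ I,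
        2 * (r : ℂ) * phiCoeff P R r m * evalDiffPoly (Rp m) (a 1) x + (x : ℂ) * a 1 x = 0 := by
  have hr : 0 < r := by linarith [hmerge.pos]
  refine ⟨existsUnique_isPainleveIIHierarchy hr.ne', fun Rp Sp hRS x hx => ?_⟩
  rw [(hRS.unique hr.ne' (isPainleveIIHierarchy_hierarchyCoeff hr.ne')).1]
  obtain ⟨V, W, hgen, hstr⟩ := hsol.string_eqs
  obtain ⟨γ, hdef, hV⟩ := hgen.exists_reduced hr hI hsol.smooth_a hsol.smooth_b hsol.zero_a
    hsol.zero_b hsym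
  have : Nonempty I := ⟨⟨x, hx⟩⟩
  have key := hierarchyCoeff_equation hI hR hmerge
    (a := fun k => mkSmooth (a k) (hsol.smooth_a k))
    (Subtype.ext (funext fun y => hsol.zero_a y y.2)) hdef hV
    (fun k y => (hstr k y y.2).1) ⟨x, hx⟩
  rw [evalAt_evalSmooth, evalAt_apply, mkSmooth_apply] at key
  have hev : evalDiffPoly (MvPolynomial.C (-(1 / (4 * r))) * (hierarchyCoeff r m).2) (a 1) x =
      -(1 / (4 * r)) * evalDiffPoly (hierarchyCoeff r m).2 (a 1) x := by
    rw [evalDiffPoly, map_mul, MvPolynomial.aeval_C, evalDiffPoly]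
    congr 1
    simp
  rw [hev, hmerge.phiCoeff_eq_moment hR]
  have hrC : (r : ℂ) ≠ 0 := by exact_mod_cast hr.ne'
  rw [← key]
  field_simp
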